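/- Let $1\le p\le n$ be integers and let $\Omega\subset\mathbb R^n$ be a strictly convex bounded domain with smooth boundary, i.e. a nonempty, bounded, connected open set with smooth boundary all of whose principal curvatures, taken with respect to the exterior unit normal (so that spheres bounding balls have positive curvature), are positive at every point of $\partial\Omega$. For a $C^2$ function $u$ on $\Omega$ let $w=\sqrt{1+|Du|^2}$, let $\nu=(-Du,1)/w$ be the upward unit normal of the graph of $u$, and let $\kappa=(\kappa_1,\dots,\kappa_n)$ be the principal curvatures of the graph, i.e. the eigenvalues of $h_{ij}=u_{ij}/w$ with respect to $g_{ij}=\delta_{ij}+u_iu_j$. The function $u$ is called admissible if $\kappa_{i_1}+\cdots+\kappa_{i_p}>0$ for all $i_1<\cdots<i_p$ at every point of $\Omega$. Then for all real numbers $K,L$ and all $m>0$ there is a constant $C>0$, depending only on $n,p,\Omega,K,L,m$, such that the following holds. Let $f=f(x,z,\nu)$ be a positive smooth function on $\Omega\times\mathbb R\times\mathbb S^n$, and let $u\in C^3(\overline\Omega)$ be an admissible solution of $$\prod_{1\le i_1<\cdots<i_p\le n}(\kappa_{i_1}+\cdots+\kappa_{i_p})=f(x,u,\nu)\ \text{ in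 }\Omega,\qquad u=0\ \text{ on }\partial\Omega .$$ If $|u|\le K$ and $|Du|\le K$ in $\Omega$, and if $|f|\le L$, $|Df|\le L$ and $f\ge m$ on $\Omega\times[-\max|u|,\max|u|]\times\mathbb S^n$, where $Df$ is the full derivative of $f$ in $(x,z,\nu)$, then $$\max_{\partial\Omega}|D^2u|\le C .$$ In other words, $\max_{\partial\Omega}|D^2u|$ is bounded by a constant depending only on $n$, $p$, $|u|_{C^1}$, $|f|_{C^1}$, $\inf f$ and $\partial\Omega$. -/

import Mathlib

open scoped ContDiff

namespace PConvex

noncomputable section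

/-- Euclidean space of dimension `n`. -/
abbrev E (n : ℕ) : Type := EuclideanSpace ℝ (Fin n)

/-! ### Domains -/

/-- `ρ` is a smooth local defining function of `Ω` at `x`: near `x` the set `Ω` is `{ρ < 0}`, and
the gradient of `ρ` does not vanish at `x`. At a boundary point `x` the vector
`∇ρ(x) / |∇ρ(x)|` is then the exterior unit normal. -/
def IsLocalDefiningFunction {n : ℕ} (Ω : Set (E n)) (x : E n) (ρ : E n → ℝ) : Prop :=
  ContDiff ℝ ∞ ρ ∧ gradient ρ x ≠ 0 ∧ ∀ᶠ y in nhds x, (y ∈ Ω ↔ ρ y < 0)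

/-- The boundary of `Ω` is smooth (and `Ω` lies locally on one side of it). -/
def HasSmoothBoundary {n : ℕ} (Ω : Set (E n)) : Prop :=
  ∀ x ∈ frontier Ω, ∃ ρ : E n → ℝ, IsLocalDefiningFunction Ω x ρ

/-- `κ` is a principal curvature of `∂Ω` at `x`, that is, an eigenvalue of the differential of the
exterior unit normal on the tangent space `{ξ | ⟨∇ρ(x), ξ⟩ = 0}`: there is a nonzero tangent vector
`ξ` with `D²ρ(x)(ξ, η) / |∇ρ(x)| = κ ⟨ξ, η⟩` for all tangent `η`. The sign is such that the unit
sphere, as the boundary of the unit ball, has principal curvatures `1`. -/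
def IsBoundaryPrincipalCurvature {n : ℕ} (Ω : Set (E n)) (x : E n) (κ : ℝ) : Prop :=
  ∃ ρ : E n → ℝ, IsLocalDefiningFunction Ω x ρ ∧
    ∃ ξ : E n, ξ ≠ 0 ∧ inner ℝ (gradient ρ x) ξ = 0 ∧
      ∀ η : E n, inner ℝ (gradient ρ x) η = 0 →
        iteratedFDeriv ℝ 2 ρ x ![ξ, η] = κ * ‖gradient ρ x‖ * inner ℝ ξ η

/-- A strictly convex bounded domain with smooth boundary: an open, connected, nonempty, bounded
set with smooth boundary, all of whose boundary principal curvatures are positive. -/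
structure IsStrictlyConvexDomain {n : ℕ} (Ω : Set (E n)) : Prop where
  isOpen : IsOpen Ω
  isConnected : IsConnected Ω
  isBounded : Bornology.IsBounded Ω
  smooth_boundary : HasSmoothBoundary Ω
  curvature_pos : ∀ x ∈ frontier Ω, ∀ κ : ℝ, IsBoundaryPrincipalCurvature Ω x κ → 0 < κ

/-! ### Geometry of the graph of `u` at interior points -/

/-- The Hessian matrix `(u_{ij}(x))`. -/
def hessianMatrix {n : ℕ} (u : E n → ℝ) (x : E n) : Matrix (Fin n) (Fin n) ℝ :=
  Matrix.of fun i j =>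
    iteratedFDeriv ℝ 2 u x ![EuclideanSpace.single i 1, EuclideanSpace.single j 1]

/-- `w = √(1 + |Du|²)`. -/
def w {n : ℕ} (u : E n → ℝ) (x : E n) : ℝ := Real.sqrt (1 + ‖gradient u x‖ ^ 2)

/-- The induced metric `g_{ij} = δ_{ij} + u_i u_j`. -/
def metric {n : ℕ} (u : E n → ℝ) (x : E n) : Matrix (Fin n) (Fin n) ℝ :=
  1 + Matrix.vecMulVec (fun i => gradient u x i) (fun j => gradient u x j)

/-- The second fundamental form `h_{ij} = u_{ij} / w`. -/
def secondForm {n : ℕ} (u : E n → ℝ) (x : E n) : Matrix (Fin n) (Fin n) ℝ :=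
  (w u x)⁻¹ • hessianMatrix u x

/-- The upward unit normal `ν = (-Du, 1) / w`. -/
def upwardNormal {n : ℕ} (u : E n → ℝ) (x : E n) : E (n + 1) :=
  WithLp.toLp 2 (Fin.snoc (fun i : Fin n => -(gradient u x i) / w u x) (1 / w u x))

/-- The principal curvatures of the graph at `(x, u(x))`, as a multiset: the eigenvalues, with
multiplicity, of `h` with respect to `g`. -/
def principalCurvatures {n : ℕ} (u : E n → ℝ) (x : E n) : Multiset ℝ :=
  ((metric u x)⁻¹ * secondForm u x).charpoly.roots

/-- The cone `𝒫_p`: all sums of `p` of the entries are positive. -/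
def InCone (p : ℕ) (κ : Multiset ℝ) : Prop :=
  ∀ s ∈ κ.powersetCard p, 0 < s.sum

/-- `∏_{i₁ < ⋯ < i_p} (κ_{i₁} + ⋯ + κ_{i_p})`. -/
def curvatureProduct (p : ℕ) (κ : Multiset ℝ) : ℝ :=
  ((κ.powersetCard p).map Multiset.sum).prod

/-! ### The right-hand side and the Dirichlet problem -/

/-- The extension of `f(x, z, ν)`, `ν` in the unit sphere, that is constant on the rays
`{tν | t > 0}`. Only the values of `f` at unit vectors enter. The derivative of this extension at a
point `(x, z, ν)` with `|ν| = 1` is the derivative of `f` on `Ω × ℝ × 𝕊ⁿ`, extended by zero in the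
direction `ν` normal to the sphere. -/
def radialExtension {n : ℕ} (f : E n → ℝ → E (n + 1) → ℝ) : E n × ℝ × E (n + 1) → ℝ :=
  fun q => f q.1 q.2.1 (‖q.2.2‖⁻¹ • q.2.2)

/-- `f` is a smooth positive function on `Ω × ℝ × 𝕊ⁿ`. -/
structure IsSmoothPositive {n : ℕ} (Ω : Set (E n)) (f : E n → ℝ → E (n + 1) → ℝ) : Prop where
  smooth : ContDiffOn ℝ ∞ (radialExtension f) {q | q.1 ∈ Ω ∧ q.2.2 ≠ 0}
  pos : ∀ x ∈ Ω, ∀ z : ℝ, ∀ ν : E (n + 1), ‖ν‖ = 1 → 0 < f x z ν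

/-- `u` is an admissible (strictly `p`-convex) solution of class `C³(Ω̄)` of the curvature equation
`∏ (κ_{i₁} + ⋯ + κ_{i_p}) = f(x, u, ν)` in `Ω` with `u = 0` on `∂Ω`. -/
structure IsAdmissibleSolution {n : ℕ} (p : ℕ) (Ω : Set (E n)) (f : E n → ℝ → E (n + 1) → ℝ)
    (u : E n → ℝ) : Prop where
  contDiffOn : ContDiffOn ℝ 3 u (closure Ω)
  admissible : ∀ x ∈ Ω, InCone p (principalCurvatures u x)
  equation : ∀ x ∈ Ω, curvatureProduct p (principalCurvatures u x) = f x (u x) (upwardNormal u x)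
  boundary : ∀ x ∈ frontier Ω, u x = 0

/-- The points `(x, z, ν)` with `x ∈ Ω`, `|z| ≤ |u(y)|` for some `y ∈ Ω̄` (that is,
`|z| ≤ max |u|`), and `|ν| = 1`, on which the norms of `f` are taken. -/
def relevantPoints {n : ℕ} (Ω : Set (E n)) (u : E n → ℝ) : Set (E n × ℝ × E (n + 1)) :=
  {q | q.1 ∈ Ω ∧ (∃ y ∈ closure Ω, |q.2.1| ≤ |u y|) ∧ ‖q.2.2‖ = 1}

end

end PConvex

/-! On the boundary the Hessian of `u` splits into tangential, mixed and double normal parts, taken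
relative to a defining function ρ that is uniformly convex near `∂Ω`
(`exists_convexDefiningFunction`).

Tangential part. Since `u = 0` on `∂Ω`, there `Du = a ∇ρ`, and `D²u = a D²ρ` on tangent vectors
(`tangential_hessWithin`). The gradient bound controls `a` from above. A lower bound `a ≥ ε > 0`
comes from `u ≤ ε ρ`: at a positive interior maximum of `u - ε ρ` the curvatures would be too small
for their product to reach `m`.

Mixed part, the heart of the proof. For a boundary point `x₀` with normal `e` and a tangent vector
`ξ`, consider `Φ = ⟨Du, ξ + Z(x - x₀)⟩ - ½ |Du^⊥|² + k(-ρ) + B |x - x₀|²`, where `⊥` removes the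
`e`-component. The skew map `Z` keeps `ξ + Z(x - x₀)` tangential up to quadratic error, so `Φ ≥ 0`
on `∂Ω` for a suitable `B`, while `Φ(x₀) = 0`. If `Φ` has no interior minimum in a collar, then `Φ ≥
0` there, and the inward derivative at `x₀` bounds `⟨D²u e, ξ⟩` from above; replacing `ξ` by `-ξ`
gives the other side.

Interior minima are excluded by `exists_no_interior_min`. Let `fᵢ` be the derivative of the
logarithm of the curvature product in `κᵢ`. Weighting the second-order conditions with `fᵢ`, and
using the once differentiated equation, leaves bad terms of the form `∑ fᵢ |κᵢ| (k'|Xᵢ| + 1)`. The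
term `-½ |Du^⊥|²` yields `-∑ fᵢ κᵢ²` over all indices but one, and the missing index is recovered
from the structure of the p-sums. The barrier satisfies `k'' = -C₃ k'²`. If `∑ fᵢ` is large, the
convexity of ρ multiplied by `k'` dominates; if it is bounded, all `fᵢ` are bounded below and `k''`
dominates (`exists_barrier_constants`).

The equation is differentiated without differentiating eigenvalues: in a fixed frame the diagonal
entries give, by concavity, a smooth upper barrier of the logarithm of the product that touches it
at the base point (`log_curvatureProduct_le`, `deriv_log_curvatureProduct`).

Double normal part. With the tangential block bounded and positive definite and the mixed entries
bounded, a large positive entry makes all curvatures bounded below and one of them huge, against the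
bound on the product; a very negative one violates admissibility (`exists_abs_inner_normal_le`). -/

namespace PConvex

open Finset

/-- The `p`-element subsets of the index set. -/
def subsetsOfCard (n p : ℕ) : Finset (Finset (Fin n)) := (univ : Finset (Fin n)).powersetCard p

/-- The derivative of `∑ log (κ_{i₁} + ⋯ + κ_{i_p})` with respect to `κ i`. -/
noncomputable def logSumDeriv {n : ℕ} (p : ℕ) (κ : Fin n → ℝ) (i : Fin n) : ℝ :=
  ∑ J ∈ (subsetsOfCard n p).filter (fun J => i ∈ J), (∑ j ∈ J, κ j)⁻¹

/-! ### Algebra of the linearised operator and the choice of barrier constants -/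

section Algebra

variable {n p : ℕ} {κ : Fin n → ℝ}

lemma logSumDeriv_nonneg (hκ : ∀ J ∈ subsetsOfCard n p, 0 < ∑ j ∈ J, κ j) (i : Fin n) :
    0 ≤ logSumDeriv p κ i :=
  sum_nonneg fun J hJ => (inv_pos.2 (hκ J (mem_filter.1 hJ).1)).le

lemma inv_le_logSumDeriv (hκ : ∀ J ∈ subsetsOfCard n p, 0 < ∑ j ∈ J, κ j) {i : Fin n}
    {J : Finset (Fin n)} (hJ : J ∈ subsetsOfCard n p) (hi : i ∈ J) :
    (∑ j ∈ J, κ j)⁻¹ ≤ logSumDeriv p κ i :=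
  single_le_sum (f := fun J : Finset (Fin n) => (∑ j ∈ J, κ j)⁻¹)
    (fun J' hJ' => (inv_pos.2 (hκ J' (mem_filter.1 hJ').1)).le) (mem_filter.2 ⟨hJ, hi⟩)

lemma sum_logSumDeriv_mul (a : Fin n → ℝ) :
    ∑ i, logSumDeriv p κ i * a i
      = ∑ J ∈ subsetsOfCard n p, (∑ j ∈ J, κ j)⁻¹ * ∑ i ∈ J, a i := by
  simp only [logSumDeriv, sum_filter, sum_mul, mul_sum]
  rw [sum_comm]
  refine sum_congr rfl fun J _ => ?_
  rw [← sum_filter_add_sum_filter_not univ (fun i => i ∈ J)]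
  rw [sum_eq_zero (s := filter (fun i => i ∉ J) univ)]
  · rw [add_zero, filter_mem_eq_inter, univ_inter]
    exact sum_congr rfl fun i hi => by simp [hi]
  · intro i hi
    simp [(mem_filter.1 hi).2]

lemma sum_logSumDeriv_mul_self (hκ : ∀ J ∈ subsetsOfCard n p, 0 < ∑ j ∈ J, κ j) :
    ∑ i, logSumDeriv p κ i * κ i = (subsetsOfCard n p).card := by
  rw [sum_logSumDeriv_mul, sum_congr rfl fun J hJ => inv_mul_cancel₀ (hκ J hJ).ne']
  simp

lemma exists_mem_subsetsOfCard (hp : 1 ≤ p) (hpn : p ≤ n) (i : Fin n) :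
    ∃ J ∈ subsetsOfCard n p, i ∈ J := by
  obtain ⟨J, h1, -, h3⟩ := exists_subsuperset_card_eq (s := {i}) (t := univ) (n := p)
    (subset_univ _) (by simpa using hp) (by simpa using hpn)
  exact ⟨J, mem_powersetCard.2 ⟨subset_univ _, h3⟩, h1 (mem_singleton_self i)⟩

/-- This replaces the one index missing from the good quadratic term. In a p-sum `s` containing `κ
r`, either `|κ r| ≤ 2 s` and the contribution is only linear in `κ r`, or the other entries must
compensate for `κ r`, and Cauchy–Schwarz over the p-subset bounds its square by theirs. -/
lemma logSumDeriv_mul_sq_le (hκ : ∀ J ∈ subsetsOfCard n p, 0 < ∑ j ∈ J, κ j) (r : Fin n) :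
    logSumDeriv p κ r * κ r ^ 2
      ≤ 4 * p * ∑ i ∈ univ.erase r, logSumDeriv p κ i * κ i ^ 2
        + 2 * (subsetsOfCard n p).card * |κ r| := by
  have key : ∀ J ∈ subsetsOfCard n p, r ∈ J → (∑ j ∈ J, κ j)⁻¹ * κ r ^ 2
      ≤ 4 * p * ((∑ j ∈ J, κ j)⁻¹ * ∑ i ∈ J, if i = r then 0 else κ i ^ 2) + 2 * |κ r| := by
    intro J hJ hr
    have hpos := hκ J hJ
    set s := ∑ j ∈ J, κ j with hs
    have hsum0 : 0 ≤ ∑ i ∈ J, (if i = r then 0 else κ i ^ 2) :=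
      sum_nonneg fun i _ => by split_ifs <;> positivity
    by_cases hc : |κ r| ≤ 2 * s
    · have : s⁻¹ * κ r ^ 2 ≤ 2 * |κ r| := by
        rw [← sq_abs, inv_mul_le_iff₀ hpos]
        nlinarith [abs_nonneg (κ r)]
      have : 0 ≤ 4 * p * (s⁻¹ * ∑ i ∈ J, if i = r then 0 else κ i ^ 2) := by positivity
      linarith
    · push Not at hc
      have h1 : ∑ i ∈ J, (if i = r then 0 else κ i) = s - κ r := by
        rw [hs, ← add_sum_erase J κ hr, ← add_sum_erase J _ hr]
        simp only [if_true, zero_add, add_sub_cancel_left]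
        exact sum_congr rfl fun i hi => if_neg (ne_of_mem_erase hi)
      have h2 : (s - κ r) ^ 2 ≤ p * ∑ i ∈ J, (if i = r then 0 else κ i ^ 2) := by
        have := sq_sum_le_card_mul_sum_sq (s := J) (f := fun i => if i = r then 0 else κ i)
        rw [h1, (mem_powersetCard.1 hJ).2] at this
        refine this.trans (le_of_eq ?_)
        congr 1
        exact sum_congr rfl fun i _ => by split_ifs <;> simp
      have h3 : κ r ^ 2 ≤ 4 * (s - κ r) ^ 2 := by
        have h4 : |κ r| ≤ 2 * |s - κ r| := by
          have := abs_sub_abs_le_abs_sub (κ r) s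
          rw [abs_of_pos hpos, abs_sub_comm] at this
          linarith
        calc κ r ^ 2 = |κ r| ^ 2 := (sq_abs _).symm
          _ ≤ (2 * |s - κ r|) ^ 2 := by gcongr
          _ = 4 * (s - κ r) ^ 2 := by rw [mul_pow, sq_abs]; norm_num
      have h5 : s⁻¹ * κ r ^ 2 ≤ s⁻¹ * (4 * (p * ∑ i ∈ J, (if i = r then 0 else κ i ^ 2))) := by
        gcongr; linarith
      nlinarith [abs_nonneg (κ r)]
  have e1 : ∑ i ∈ univ.erase r, logSumDeriv p κ i * κ i ^ 2
      = ∑ J ∈ subsetsOfCard n p, (∑ j ∈ J, κ j)⁻¹ * ∑ i ∈ J, if i = r then 0 else κ i ^ 2 := by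
    rw [← sum_logSumDeriv_mul, ← add_sum_erase univ _ (mem_univ r)]
    simp only [if_true, mul_zero, zero_add]
    exact sum_congr rfl fun i hi => by rw [if_neg (ne_of_mem_erase hi)]
  rw [e1, logSumDeriv, sum_mul]
  calc ∑ J ∈ (subsetsOfCard n p).filter (fun J => r ∈ J), (∑ j ∈ J, κ j)⁻¹ * κ r ^ 2
      ≤ ∑ J ∈ (subsetsOfCard n p).filter (fun J => r ∈ J),
        (4 * p * ((∑ j ∈ J, κ j)⁻¹ * ∑ i ∈ J, if i = r then 0 else κ i ^ 2) + 2 * |κ r|) :=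
        sum_le_sum fun J hJ => key J (mem_filter.1 hJ).1 (mem_filter.1 hJ).2
    _ ≤ ∑ J ∈ subsetsOfCard n p,
        (4 * p * ((∑ j ∈ J, κ j)⁻¹ * ∑ i ∈ J, if i = r then 0 else κ i ^ 2) + 2 * |κ r|) := by
        refine sum_le_sum_of_subset_of_nonneg (filter_subset _ _) fun J hJ _ => ?_
        have := inv_pos.2 (hκ J hJ)
        have : 0 ≤ ∑ i ∈ J, (if i = r then 0 else κ i ^ 2) :=
          sum_nonneg fun i _ => by split_ifs <;> positivity
        positivity
    _ = _ := by
        rw [sum_add_distrib, ← mul_sum, sum_const, nsmul_eq_mul]; ring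

/-- Young's inequality treats the indices other than `r`. At `r` the square is not available on the
right, and `logSumDeriv_mul_sq_le` supplies it up to a linear term. -/
lemma sum_logSumDeriv_mul_abs_le (hκ : ∀ J ∈ subsetsOfCard n p, 0 < ∑ j ∈ J, κ j) (r : Fin n)
    {Y : Fin n → ℝ} {Y₀ ε : ℝ} (hY : ∀ i, 0 ≤ Y i) (hY₀ : ∀ i, Y i ≤ Y₀) (hε : 0 < ε) :
    ∑ i, logSumDeriv p κ i * |κ i| * Y i
      ≤ (8 * p + 1) * ε * (∑ i ∈ univ.erase r, logSumDeriv p κ i * κ i ^ 2)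
        + (4 * ε)⁻¹ * (∑ i, logSumDeriv p κ i * Y i ^ 2)
        + 4 * (subsetsOfCard n p).card * Y₀ := by
  set S := ∑ i ∈ univ.erase r, logSumDeriv p κ i * κ i ^ 2 with hS
  have hf := logSumDeriv_nonneg hκ
  have hS0 : 0 ≤ S := sum_nonneg fun i _ => mul_nonneg (hf i) (sq_nonneg _)
  have young : ∀ i, logSumDeriv p κ i * |κ i| * Y i
      ≤ ε * (logSumDeriv p κ i * κ i ^ 2) + (4 * ε)⁻¹ * (logSumDeriv p κ i * Y i ^ 2) := by
    intro i
    have h1 : |κ i| * Y i ≤ ε * κ i ^ 2 + (4 * ε)⁻¹ * Y i ^ 2 := by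
      rw [← sq_abs (κ i)]
      have h2 : 0 ≤ (4 * ε)⁻¹ * (2 * ε * |κ i| - Y i) ^ 2 := by positivity
      have h3 : (4 * ε)⁻¹ * (2 * ε * |κ i| - Y i) ^ 2
          = ε * |κ i| ^ 2 + (4 * ε)⁻¹ * Y i ^ 2 - |κ i| * Y i := by
        field_simp; ring
      linarith
    nlinarith [mul_le_mul_of_nonneg_left h1 (hf i)]
  have hr : logSumDeriv p κ r * |κ r| * Y r ≤ 8 * p * ε * S
      + (4 * ε)⁻¹ * (logSumDeriv p κ r * Y r ^ 2) + 4 * (subsetsOfCard n p).card * Y₀ := by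
    have hN : (0 : ℝ) ≤ (subsetsOfCard n p).card := Nat.cast_nonneg _
    have hY00 : 0 ≤ Y₀ := (hY r).trans (hY₀ r)
    have h4 : 0 ≤ (4 * ε)⁻¹ * (logSumDeriv p κ r * Y r ^ 2) := by
      have := hf r; positivity
    -- With `N` the number of p-subsets: when `f_r |κ_r| ≥ 4N`, the linear term `2N |κ_r|` is at
    -- most half of `f_r κ_r²` and is absorbed. Otherwise the summand is bounded outright.
    by_cases hc : 4 * (subsetsOfCard n p).card ≤ logSumDeriv p κ r * |κ r|
    · have h1 := logSumDeriv_mul_sq_le hκ r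
      have h2 : logSumDeriv p κ r * κ r ^ 2 ≤ 8 * p * S := by
        have h3 := mul_le_mul_of_nonneg_right hc (abs_nonneg (κ r))
        rw [mul_assoc _ |κ r|, ← sq, sq_abs] at h3
        linarith
      have h5 := young r
      have h6 := mul_le_mul_of_nonneg_left h2 hε.le
      have h7 : 0 ≤ 4 * (subsetsOfCard n p).card * Y₀ := by positivity
      linarith
    · push Not at hc
      have h1 : logSumDeriv p κ r * |κ r| * Y r ≤ 4 * (subsetsOfCard n p).card * Y₀ :=
        mul_le_mul hc.le (hY₀ r) (hY r) (by positivity)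
      have : 0 ≤ 8 * p * ε * S := by positivity
      linarith
  rw [← add_sum_erase univ _ (mem_univ r), ← add_sum_erase univ
    (fun i => logSumDeriv p κ i * Y i ^ 2) (mem_univ r)]
  have h8 : ∑ i ∈ univ.erase r, logSumDeriv p κ i * |κ i| * Y i
      ≤ ε * S + (4 * ε)⁻¹ * ∑ i ∈ univ.erase r, logSumDeriv p κ i * Y i ^ 2 := by
    rw [hS, mul_sum, mul_sum, ← sum_add_distrib]
    exact sum_le_sum fun i _ => young i
  linarith

/-- If `∑ fᵢ` is bounded then every `fᵢ` is bounded below. -/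
lemma le_logSumDeriv_of_sum_le (hp : 1 ≤ p) (hpn : p ≤ n)
    (hκ : ∀ J ∈ subsetsOfCard n p, 0 < ∑ j ∈ J, κ j) {L T : ℝ} (hT : 1 ≤ T)
    (hL : ∏ J ∈ subsetsOfCard n p, ∑ j ∈ J, κ j ≤ L) (hsum : ∑ i, logSumDeriv p κ i ≤ T)
    (i : Fin n) : (L * T ^ (subsetsOfCard n p).card)⁻¹ ≤ logSumDeriv p κ i := by
  have hT0 : 0 < T := by linarith
  -- The inverse of each p-sum is a term of some `logSumDeriv`, hence at most `T`. All p-sums being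
  -- at least `1/T`, the bound on their product limits each single one from above.
  have hlow : ∀ J ∈ subsetsOfCard n p, T⁻¹ ≤ ∑ j ∈ J, κ j := by
    intro J hJ
    have hne : J.Nonempty := by
      rw [← card_pos, (mem_powersetCard.1 hJ).2]; omega
    obtain ⟨j, hj⟩ := hne
    rw [inv_le_comm₀ hT0 (hκ J hJ)]
    refine (inv_le_logSumDeriv hκ hJ hj).trans (le_trans ?_ hsum)
    exact single_le_sum (f := logSumDeriv p κ) (fun k _ => logSumDeriv_nonneg hκ k) (mem_univ j)
  obtain ⟨J, hJ, hi⟩ := exists_mem_subsetsOfCard hp hpn i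
  refine le_trans ?_ (inv_le_logSumDeriv hκ hJ hi)
  have hsJ := hκ J hJ
  rw [inv_le_inv₀ ?_ hsJ]
  · rw [← mul_prod_erase _ _ hJ] at hL
    have h1 : (T⁻¹) ^ ((subsetsOfCard n p).card - 1)
        ≤ ∏ J' ∈ (subsetsOfCard n p).erase J, ∑ j ∈ J', κ j := by
      rw [← card_erase_of_mem hJ, ← prod_const]
      exact prod_le_prod (fun _ _ => by positivity) fun J' hJ' => hlow J' (mem_of_mem_erase hJ')
    have h2 : (∑ j ∈ J, κ j) * (T⁻¹) ^ ((subsetsOfCard n p).card - 1) ≤ L :=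
      (mul_le_mul_of_nonneg_left h1 hsJ.le).trans hL
    have hL0 : 0 ≤ L := le_trans (by positivity) h2
    rw [inv_pow, ← div_eq_mul_inv, div_le_iff₀ (by positivity)] at h2
    -- The natural exponent is the number of p-subsets minus one; `1 ≤ T` allows the full number.
    exact h2.trans (mul_le_mul_of_nonneg_left (pow_le_pow_right₀ hT (Nat.sub_le _ _)) hL0)
  · have : 0 < ∏ J ∈ subsetsOfCard n p, ∑ j ∈ J, κ j := prod_pos hκ
    have : 0 < L := lt_of_lt_of_le this hL
    positivity

lemma barrier_lower_order_le {C C₂ R N k F : ℝ} (hC : 0 < C) (hC₂ : 0 < C₂) (hR : 0 ≤ R)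
    (hN : 0 ≤ N) (hk : 1 ≤ k) (hF : 0 ≤ F) :
    C * (1 + k) + C * F + C₂ * F + 4 * C * N * (k * R + 1)
      ≤ 2 * (C + C₂ + 4 * C * N * (R + 1)) * k + (C + C₂ + 4 * C * N * (R + 1)) * F := by
  have h1 : 4 * C * N * (k * R + 1) ≤ 4 * C * N * ((R + 1) * k) :=
    mul_le_mul_of_nonneg_left (by linarith) (by positivity)
  have h2 : C * 1 ≤ C * k := mul_le_mul_of_nonneg_left hk hC.le
  have h3 : 0 ≤ 4 * C * N * (R + 1) * F := by positivity
  have h4 : 0 ≤ C₂ * k := by positivity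
  have h5 : 0 ≤ 4 * C * N * (R + 1) * k := by positivity
  linarith

/-- Here `F` stands for `∑ fᵢ` and `Q` for `∑ fᵢ Xᵢ²`. For `F ≥ T` half of `θ k F` beats `2 C₄ k`
and the other half beats `C₄ F`. For `F < T` the term `k² Q` is quadratic in `k` with a fixed
positive coefficient, while the bad terms grow linearly. -/
lemma barrier_dichotomy_neg {C₄ k θ F Q T c₂ c : ℝ} (hC₄ : 0 < C₄) (hk : 1 ≤ k) (hθ : 0 < θ)
    (hF : 0 ≤ F) (hQ : 0 ≤ Q) (hkθ : 4 * C₄ < θ * k) (hT : 4 * C₄ ≤ θ * T)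
    (hkc : 3 * C₄ + C₄ * T < k * (c₂ * c)) (hQlow : F < T → c₂ * c ≤ Q) :
    2 * C₄ * k + C₄ * F - θ * k * F - k ^ 2 * Q < 0 := by
  have hk0 : 0 < k := by linarith
  have hkQ : 0 ≤ k ^ 2 * Q := by positivity
  by_cases hFT : T ≤ F
  · have h7 : 4 * C₄ ≤ θ * F := hT.trans (mul_le_mul_of_nonneg_left hFT hθ.le)
    have h8 := mul_le_mul_of_nonneg_right h7 hk0.le
    have h9 := mul_le_mul_of_nonneg_right hkθ.le hF
    have h10 : 0 < C₄ * k := by positivity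
    nlinarith
  · push Not at hFT
    have h8 : k ^ 2 * (c₂ * c) ≤ k ^ 2 * Q := mul_le_mul_of_nonneg_left (hQlow hFT) (by positivity)
    have hT0 : 0 < T := lt_of_le_of_lt hF hFT
    have h9 : C₄ * F ≤ C₄ * T * k :=
      (mul_le_mul_of_nonneg_left hFT.le hC₄.le).trans (le_mul_of_one_le_right (by positivity) hk)
    have h10 : 0 ≤ θ * k * F := by positivity
    have h11 := mul_lt_mul_of_pos_left hkc hk0
    have h12 : 0 < C₄ * k := by positivity
    nlinarith

/-- The inequality that holds at an interior minimum of the test function is violated as soon as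
the slope `k` of the barrier is large. -/
lemma exists_barrier_constants (n p : ℕ) (hp : 1 ≤ p) (hpn : p ≤ n) {L C W θ R c : ℝ}
    (hL : 0 < L) (hC : 0 < C) (hW : 1 ≤ W) (hθ : 0 < θ) (hR : 0 ≤ R) (hc : 0 < c) :
    ∃ C₃ : ℝ, 0 < C₃ ∧ ∃ k₀ : ℝ, 1 ≤ k₀ ∧ ∀ (κ X : Fin n → ℝ) (r : Fin n) (k : ℝ), k₀ ≤ k →
      (∀ J ∈ subsetsOfCard n p, 0 < ∑ j ∈ J, κ j) →
      ∏ J ∈ subsetsOfCard n p, ∑ j ∈ J, κ j ≤ L →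
      (∀ i, 0 ≤ X i ∧ X i ≤ R) → c ≤ ∑ i, X i ^ 2 →
      C * (1 + k) + C * (∑ i, logSumDeriv p κ i * |κ i| * (k * X i + 1))
        - 1 / 2 * (∑ i ∈ univ.erase r, logSumDeriv p κ i * κ i ^ 2)
        - θ * k * (∑ i, logSumDeriv p κ i)
        - C₃ / W * k ^ 2 * (∑ i, logSumDeriv p κ i * X i ^ 2)
        + C * (∑ i, logSumDeriv p κ i) < 0 := by
  set N : ℝ := ((subsetsOfCard n p).card : ℝ) with hN
  have hN0 : 0 ≤ N := Nat.cast_nonneg _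
  -- Chosen so that Young's inequality uses only a quarter of the sum over `i ≠ r`, half of which is
  -- available. `C₂` is the resulting factor of `k² Q + F`, from `(k X + 1)² ≤ 2 k² X² + 2`.
  set ε : ℝ := 1 / (4 * (8 * p + 1) * C) with hε
  have hε0 : 0 < ε := by positivity
  set C₂ : ℝ := 2 * C * (4 * ε)⁻¹ with hC2
  have hC20 : 0 < C₂ := by positivity
  set C₄ : ℝ := C + C₂ + 4 * C * N * (R + 1) with hC4
  have hC40 : 0 < C₄ := by positivity
  set T : ℝ := 4 * C₄ / θ + 1 with hT
  have hT1 : 1 ≤ T := by rw [hT]; linarith [div_pos (mul_pos four_pos hC40) hθ]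
  set c₂ : ℝ := (L * T ^ (subsetsOfCard n p).card)⁻¹ with hc2
  have hc20 : 0 < c₂ := by positivity
  -- After division by `W` this choice of `C₃` pays for `C₂ k² Q` and leaves exactly `k² Q`. The
  -- threshold for `k` adds up the two requirements of `barrier_dichotomy_neg`.
  refine ⟨W * (C₂ + 1), by positivity, 1 + 4 * C₄ / θ + (3 * C₄ + C₄ * T) / (c₂ * c), ?_, ?_⟩
  · have : 0 < 4 * C₄ / θ := by positivity
    have : 0 < (3 * C₄ + C₄ * T) / (c₂ * c) := by positivity
    linarith
  intro κ X r k hk hκ hprod hX hXc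
  have hk1 : 1 ≤ k := by
    have : 0 < 4 * C₄ / θ := by positivity
    have : 0 < (3 * C₄ + C₄ * T) / (c₂ * c) := by positivity
    linarith
  have hf := logSumDeriv_nonneg hκ
  have hbad := sum_logSumDeriv_mul_abs_le hκ r (Y := fun i => k * X i + 1) (Y₀ := k * R + 1)
    (fun i => by have := (hX i).1; positivity)
    (fun i => by have := (hX i).2; gcongr) hε0
  set S := ∑ i ∈ univ.erase r, logSumDeriv p κ i * κ i ^ 2 with hS
  set F := ∑ i, logSumDeriv p κ i with hF
  set Q := ∑ i, logSumDeriv p κ i * X i ^ 2 with hQ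
  set A := ∑ i, logSumDeriv p κ i * |κ i| * (k * X i + 1) with hA
  have hS0 : 0 ≤ S := sum_nonneg fun i _ => mul_nonneg (hf i) (sq_nonneg _)
  have hF0 : 0 ≤ F := sum_nonneg fun i _ => hf i
  have hQ0 : 0 ≤ Q := sum_nonneg fun i _ => mul_nonneg (hf i) (sq_nonneg _)
  have hY2 : ∑ i, logSumDeriv p κ i * (k * X i + 1) ^ 2 ≤ 2 * k ^ 2 * Q + 2 * F := by
    rw [hQ, hF, mul_sum, mul_sum, ← sum_add_distrib]
    refine sum_le_sum fun i _ => ?_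
    nlinarith [mul_nonneg (hf i) (sq_nonneg (k * X i - 1))]
  have hεC : C * ((8 * p + 1) * ε) = 1 / 4 := by
    rw [hε]; field_simp
  have h1 : C * A ≤ 1 / 4 * S + C₂ * (k ^ 2 * Q + F) + 4 * C * N * (k * R + 1) := by
    have h2 := mul_le_mul_of_nonneg_left hbad hC.le
    have h3 : C * ((4 * ε)⁻¹ * ∑ i, logSumDeriv p κ i * (k * X i + 1) ^ 2)
        ≤ C * ((4 * ε)⁻¹ * (2 * k ^ 2 * Q + 2 * F)) := by gcongr
    have h4 : C * ((4 * ε)⁻¹ * (2 * k ^ 2 * Q + 2 * F)) = C₂ * (k ^ 2 * Q + F) := by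
      rw [hC2]; ring
    have h5 : C * ((8 * p + 1) * ε * S) = 1 / 4 * S := by rw [← mul_assoc, hεC]
    rw [mul_add, mul_add] at h2
    linarith
  have h6 : W * (C₂ + 1) / W = C₂ + 1 := by field_simp
  rw [h6]
  have hlin := barrier_lower_order_le hC hC20 hR hN0 hk1 hF0
  rw [← hC4] at hlin
  have p1 : 0 < 4 * C₄ / θ := by positivity
  have p2 : 0 < (3 * C₄ + C₄ * T) / (c₂ * c) := by positivity
  have hkθ : 4 * C₄ < θ * k := by
    have : 4 * C₄ / θ < k := by linarith
    rwa [div_lt_iff₀ hθ, mul_comm k] at this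
  have hTθ : 4 * C₄ ≤ θ * T := by
    have : 4 * C₄ / θ ≤ T := by linarith
    rwa [div_le_iff₀ hθ, mul_comm T] at this
  have hkc : 3 * C₄ + C₄ * T < k * (c₂ * c) := by
    have : (3 * C₄ + C₄ * T) / (c₂ * c) < k := by linarith
    rwa [div_lt_iff₀ (by positivity)] at this
  have hQlow : F < T → c₂ * c ≤ Q := by
    intro hFT
    have hlow := le_logSumDeriv_of_sum_le hp hpn hκ hT1 hprod hFT.le
    calc c₂ * c ≤ c₂ * ∑ i, X i ^ 2 := mul_le_mul_of_nonneg_left hXc hc20.le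
      _ ≤ Q := by
        rw [hQ, mul_sum]
        exact sum_le_sum fun i _ => mul_le_mul_of_nonneg_right (hlow i) (sq_nonneg _)
  have hfinal := barrier_dichotomy_neg hC40 hk1 hθ hF0 hQ0 hkθ hTθ hkc hQlow
  clear_value S F Q A C₂ C₄ T c₂ N ε
  linarith
end Algebra

end PConvex

namespace PConvex

open Finset Matrix

/-! ### Passing from multisets of curvatures to indexed families -/

section Multisets

variable {n p : ℕ}

lemma powersetCard_map_univ (κ : Fin n → ℝ) :
    ((univ.val.map κ).powersetCard p).map Multiset.sum
      = (subsetsOfCard n p).val.map fun J => ∑ j ∈ J, κ j := by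
  rw [Multiset.powersetCard_map, Multiset.map_map, subsetsOfCard,
    ← Finset.map_val_val_powersetCard, Multiset.map_map]
  rfl

lemma curvatureProduct_map (κ : Fin n → ℝ) :
    curvatureProduct p (univ.val.map κ) = ∏ J ∈ subsetsOfCard n p, ∑ j ∈ J, κ j := by
  rw [curvatureProduct, powersetCard_map_univ]; rfl

lemma inCone_map_iff (κ : Fin n → ℝ) :
    InCone p (univ.val.map κ) ↔ ∀ J ∈ subsetsOfCard n p, 0 < ∑ j ∈ J, κ j := by
  have h : InCone p (univ.val.map κ)
      ↔ ∀ t ∈ ((univ.val.map κ).powersetCard p).map Multiset.sum, 0 < t := by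
    simp only [InCone, Multiset.mem_map, forall_exists_index, and_imp]
    exact ⟨fun h t s hs hst => hst ▸ h s hs, fun h s hs => h _ s hs rfl⟩
  rw [h, powersetCard_map_univ]
  simp

end Multisets

/-! ### Concavity by way of doubly stochastic matrices -/

section Birkhoff

variable {n p : ℕ}

/-- The squared entries of the orthogonal diagonalising matrix are doubly stochastic, and by
Birkhoff's theorem such a matrix is a convex combination of permutation matrices. -/
lemma exists_perm_weights {b : Matrix (Fin n) (Fin n) ℝ} (hb : b.IsHermitian) :
    ∃ c : Equiv.Perm (Fin n) → ℝ, (∀ σ, 0 ≤ c σ) ∧ ∑ σ, c σ = 1 ∧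
      ∀ i, b i i = ∑ σ, c σ * hb.eigenvalues (σ i) := by
  set U : Matrix (Fin n) (Fin n) ℝ := (hb.eigenvectorUnitary : Matrix (Fin n) (Fin n) ℝ) with hU
  have hU1 : U * Uᵀ = 1 := by
    have := Unitary.coe_mul_star_self hb.eigenvectorUnitary
    rwa [Unitary.coe_star, Matrix.star_eq_conjTranspose, conjTranspose_eq_transpose_of_trivial] at this
  have hU2 : Uᵀ * U = 1 := mul_eq_one_comm.1 hU1
  have hD : (Matrix.of fun i k => U i k ^ 2) ∈ doublyStochastic ℝ (Fin n) := by
    rw [mem_doublyStochastic_iff_sum]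
    refine ⟨fun i j => sq_nonneg _, fun i => ?_, fun j => ?_⟩
    · have := congrFun (congrFun hU1 i) i
      simpa [mul_apply, sq] using this
    · have := congrFun (congrFun hU2 j) j
      simpa [mul_apply, sq] using this
  obtain ⟨c, hc0, hc1, hc2⟩ := exists_eq_sum_perm_of_mem_doublyStochastic hD
  refine ⟨c, hc0, hc1, fun i => ?_⟩
  have hspec : b i i = ∑ k, U i k ^ 2 * hb.eigenvalues k := by
    have h := hb.spectral_theorem
    rw [Unitary.conjStarAlgAut_apply, Matrix.star_eq_conjTranspose,
      conjTranspose_eq_transpose_of_trivial] at h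
    have h2 := congrFun (congrFun h i) i
    rw [h2, mul_apply]
    refine sum_congr rfl fun k _ => ?_
    rw [mul_diagonal, transpose_apply]
    simp only [Function.comp, RCLike.ofReal_real_eq_id, id]
    ring
  rw [hspec]
  have hUk : ∀ k, U i k ^ 2 = ∑ σ, c σ * (if σ i = k then 1 else 0) := by
    intro k
    have := congrFun (congrFun hc2 i) k
    rw [of_apply] at this
    rw [← this, Matrix.sum_apply]
    refine sum_congr rfl fun σ _ => ?_
    simp [Equiv.Perm.permMatrix, PEquiv.toMatrix_apply, eq_comm]
  simp only [hUk, sum_mul]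
  rw [sum_comm]
  refine sum_congr rfl fun σ _ => ?_
  simp

lemma map_perm_mem_subsetsOfCard {J : Finset (Fin n)} (hJ : J ∈ subsetsOfCard n p)
    (σ : Equiv.Perm (Fin n)) : J.map σ.toEmbedding ∈ subsetsOfCard n p :=
  mem_powersetCard.2 ⟨subset_univ _, by rw [card_map, (mem_powersetCard.1 hJ).2]⟩

/-- The logarithm of the curvature product of a symmetric matrix is at most the same expression
formed with the diagonal entries. -/
lemma log_curvatureProduct_le {b : Matrix (Fin n) (Fin n) ℝ} (hb : b.IsHermitian)
    (hcone : InCone p b.charpoly.roots) :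
    (∀ J ∈ subsetsOfCard n p, 0 < ∑ i ∈ J, b i i) ∧
      Real.log (curvatureProduct p b.charpoly.roots)
        ≤ ∑ J ∈ subsetsOfCard n p, Real.log (∑ i ∈ J, b i i) := by
  have hroots : b.charpoly.roots = univ.val.map hb.eigenvalues := by
    rw [hb.roots_charpoly_eq_eigenvalues]; rfl
  rw [hroots, inCone_map_iff] at hcone
  rw [hroots, curvatureProduct_map]
  obtain ⟨c, hc0, hc1, hc⟩ := exists_perm_weights hb
  set μ := hb.eigenvalues
  have hsum : ∀ J : Finset (Fin n), ∑ i ∈ J, b i i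
      = ∑ σ, c σ * ∑ j ∈ J.map σ.toEmbedding, μ j := by
    intro J
    simp only [hc, sum_map, mul_sum]
    rw [sum_comm]; rfl
  have hpos : ∀ J ∈ subsetsOfCard n p, ∀ σ : Equiv.Perm (Fin n),
      0 < ∑ j ∈ J.map σ.toEmbedding, μ j :=
    fun J hJ σ => hcone _ (map_perm_mem_subsetsOfCard hJ σ)
  constructor
  · intro J hJ
    rw [hsum]
    have hne : ∃ σ, 0 < c σ := by
      by_contra! h
      have : ∑ σ, c σ ≤ 0 := sum_nonpos fun σ _ => h σ
      linarith
    obtain ⟨σ, hσ⟩ := hne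
    exact sum_pos' (fun σ _ => mul_nonneg (hc0 σ) (hpos J hJ σ).le)
      ⟨σ, mem_univ σ, mul_pos hσ (hpos J hJ σ)⟩
  · rw [Real.log_prod fun J hJ => (hcone J hJ).ne']
    -- Jensen's inequality for the logarithm, over the permutations with their weights.
    have hconc : ∀ J ∈ subsetsOfCard n p,
        ∑ σ, c σ * Real.log (∑ j ∈ J.map σ.toEmbedding, μ j) ≤ Real.log (∑ i ∈ J, b i i) := by
      intro J hJ
      rw [hsum]
      have := strictConcaveOn_log_Ioi.concaveOn.le_map_sum (t := univ) (w := c)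
        (p := fun σ : Equiv.Perm (Fin n) => ∑ j ∈ J.map σ.toEmbedding, μ j)
        (fun σ _ => hc0 σ) hc1 (fun σ _ => hpos J hJ σ)
      simpa [smul_eq_mul] using this
    refine le_trans (le_of_eq ?_) (sum_le_sum hconc)
    rw [sum_comm]
    -- A permutation of the indices permutes the p-subsets, so every `σ` contributes the same sum
    -- and only the total weight 1 matters.
    have hperm : ∀ σ : Equiv.Perm (Fin n),
        ∑ J ∈ subsetsOfCard n p, c σ * Real.log (∑ j ∈ J.map σ.toEmbedding, μ j)
          = c σ * ∑ J ∈ subsetsOfCard n p, Real.log (∑ j ∈ J, μ j) := by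
      intro σ
      rw [← mul_sum]
      congr 1
      refine sum_bij' (fun J _ => J.map σ.toEmbedding) (fun J _ => J.map σ.symm.toEmbedding)
        (fun J hJ => map_perm_mem_subsetsOfCard hJ σ)
        (fun J hJ => map_perm_mem_subsetsOfCard hJ σ.symm) ?_ ?_ ?_
      · intro J _; ext; simp
      · intro J _; ext; simp
      · intro J _; rfl
    rw [sum_congr rfl fun σ _ => hperm σ, ← sum_mul, hc1, one_mul]

end Birkhoff

/-! ### The square root of the graph metric -/

section MetricRoot

variable {n : ℕ}

open scoped RealInnerProductSpace

/-- `√(1 + |q|²)`. -/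
noncomputable def areaFactor (q : E n) : ℝ := Real.sqrt (1 + ‖q‖ ^ 2)

lemma areaFactor_sq (q : E n) : areaFactor q ^ 2 = 1 + ‖q‖ ^ 2 := Real.sq_sqrt (by positivity)

lemma one_le_areaFactor (q : E n) : 1 ≤ areaFactor q :=
  Real.one_le_sqrt.2 (by linarith [sq_nonneg ‖q‖])

lemma areaFactor_pos (q : E n) : 0 < areaFactor q := by linarith [one_le_areaFactor q]

/-- The inverse square root of the metric `1 + q ⊗ q`, applied to `v`. -/
noncomputable def metricRootInv (q v : E n) : E n :=
  v - (⟪q, v⟫ / (areaFactor q * (1 + areaFactor q))) • q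

/-- The square root of the metric `1 + q ⊗ q`, applied to `v`. -/
noncomputable def metricRoot (q v : E n) : E n := v + (⟪q, v⟫ / (1 + areaFactor q)) • q

/-- `q` is an eigenvector of the metric with eigenvalue `areaFactor q ^ 2`, hence of the inverse
root with eigenvalue `1 / areaFactor q`. The factorisation `|q|² = (W - 1)(W + 1)` clears the
denominators. -/
lemma inner_metricRootInv (q v : E n) : ⟪q, metricRootInv q v⟫ = ⟪q, v⟫ / areaFactor q := by
  have h := areaFactor_sq q
  have h1 := areaFactor_pos q
  rw [metricRootInv, inner_sub_right, inner_smul_right, real_inner_self_eq_norm_sq]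
  have h2 : ‖q‖ ^ 2 = (areaFactor q - 1) * (1 + areaFactor q) := by linarith
  rw [h2]; field_simp; ring

lemma metricRootInv_metric (q v : E n) :
    metricRootInv q v + ⟪q, metricRootInv q v⟫ • q = metricRoot q v := by
  have h1 := areaFactor_pos q
  rw [inner_metricRootInv, metricRootInv, metricRoot, sub_add, ← sub_smul, sub_eq_add_neg,
    ← neg_smul]
  congr 2
  field_simp; ring

lemma inner_metricRoot_metricRootInv (q v z : E n) :
    ⟪metricRoot q v, metricRootInv q z⟫ = ⟪v, z⟫ := by
  have h1 := areaFactor_pos q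
  rw [metricRoot, inner_add_left, inner_smul_left, inner_metricRootInv, metricRootInv,
    inner_sub_right, inner_smul_right, real_inner_comm q v]
  simp only [conj_trivial]
  field_simp; ring

/-- `metricRootInv q` maps orthonormal frames to frames orthonormal for the metric. -/
lemma metricRootInv_orthonormal (q v z : E n) :
    ⟪metricRootInv q v, metricRootInv q z⟫ + ⟪q, metricRootInv q v⟫ * ⟪q, metricRootInv q z⟫
      = ⟪v, z⟫ := by
  rw [← inner_metricRoot_metricRootInv q v z, ← metricRootInv_metric, inner_add_left,
    inner_smul_left]
  simp

lemma inner_metricRootInv_comm (q v z : E n) :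
    ⟪metricRootInv q v, z⟫ = ⟪v, metricRootInv q z⟫ := by
  simp only [metricRootInv, inner_sub_left, inner_sub_right, inner_smul_left, inner_smul_right,
    conj_trivial, real_inner_comm]
  ring

lemma norm_metricRootInv_sq (q v : E n) :
    ‖metricRootInv q v‖ ^ 2 = ‖v‖ ^ 2 - (⟪q, v⟫ / areaFactor q) ^ 2 := by
  have h := metricRootInv_orthonormal q v v
  rw [inner_metricRootInv, real_inner_self_eq_norm_sq, real_inner_self_eq_norm_sq] at h
  linarith

lemma norm_metricRootInv_le (q v : E n) : ‖metricRootInv q v‖ ≤ ‖v‖ := by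
  have := norm_metricRootInv_sq q v
  exact abs_le_of_sq_le_sq' (by linarith [sq_nonneg (⟪q, v⟫ / areaFactor q)])
    (norm_nonneg _) |>.2

/-- The largest eigenvalue of the metric is at most `1 + |q|²`, by Cauchy–Schwarz. -/
lemma div_le_norm_metricRootInv_sq (q v : E n) :
    ‖v‖ ^ 2 / areaFactor q ^ 2 ≤ ‖metricRootInv q v‖ ^ 2 := by
  rw [norm_metricRootInv_sq, div_pow, div_le_iff₀ (pow_pos (areaFactor_pos q) 2), sub_mul,
    div_mul_cancel₀ _ (pow_pos (areaFactor_pos q) 2).ne', areaFactor_sq]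
  have := abs_real_inner_le_norm q v
  have h2 : ⟪q, v⟫ ^ 2 ≤ (‖q‖ * ‖v‖) ^ 2 := sq_le_sq' (by linarith [abs_le.1 this]) (abs_le.1 this).2
  nlinarith

lemma norm_metricRoot_sq (q v : E n) : ‖metricRoot q v‖ ^ 2 = ‖v‖ ^ 2 + ⟪q, v⟫ ^ 2 := by
  have h := areaFactor_sq q
  have h1 := areaFactor_pos q
  rw [metricRoot, ← real_inner_self_eq_norm_sq, inner_add_left, inner_add_right, inner_add_right,
    inner_smul_left, inner_smul_right, inner_smul_left, inner_smul_right,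
    real_inner_self_eq_norm_sq, real_inner_self_eq_norm_sq, real_inner_comm q v]
  have h2 : ‖q‖ ^ 2 = (areaFactor q - 1) * (1 + areaFactor q) := by linarith
  rw [h2, conj_trivial]
  field_simp; ring

end MetricRoot

/-! ### Symmetrising the shape operator -/

section MatrixLink

variable {n : ℕ}

open scoped RealInnerProductSpace

/-- If the columns of `M` are orthonormal for the metric `g`, then `g⁻¹ = M Mᵀ`, and moving the
factor `M` to the other end of the product preserves the characteristic polynomial. -/
lemma charpoly_inv_metric_mul (q : E n) (h : Matrix (Fin n) (Fin n) ℝ)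
    (m : Fin n → E n)
    (hm : ∀ i j, ⟪m i, m j⟫ + ⟪q, m i⟫ * ⟪q, m j⟫ = if i = j then 1 else 0) :
    ((1 + vecMulVec (fun i => q i) (fun j => q j))⁻¹ * h).charpoly
      = (Matrix.of fun i j => ∑ k, ∑ l, m i k * h k l * m j l).charpoly := by
  set g : Matrix (Fin n) (Fin n) ℝ := 1 + vecMulVec (fun i => q i) (fun j => q j) with hg
  set M : Matrix (Fin n) (Fin n) ℝ := Matrix.of fun k i => m i k with hM
  have hin : ∀ x y : E n, ⟪x, y⟫ = ∑ k, x k * y k := by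
    intro x y
    simp [PiLp.inner_apply, mul_comm]
  have h1 : Mᵀ * (g * M) = 1 := by
    ext i j
    rw [one_apply, ← hm i j]
    have e : ∀ k, (g * M) k j = m j k + q k * ⟪q, m j⟫ := by
      intro k
      rw [hg, Matrix.add_mul, Matrix.one_mul, Matrix.add_apply, mul_apply, hin, mul_sum]
      simp [hM, vecMulVec_apply, mul_assoc]
    rw [mul_apply]
    simp only [e, transpose_apply, mul_add, sum_add_distrib]
    rw [hin (m i) (m j), hin q (m i), sum_mul]
    congr 1
    exact sum_congr rfl fun k _ => by rw [hM, of_apply]; ring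
  have h2 : (g * M) * Mᵀ = 1 := mul_eq_one_comm.1 h1
  rw [Matrix.mul_assoc] at h2
  have h3 : g⁻¹ = M * Mᵀ := inv_eq_right_inv h2
  rw [h3, Matrix.mul_assoc, charpoly_mul_comm]
  congr 1
  ext i j
  rw [mul_apply]
  simp only [mul_apply, hM, transpose_apply, of_apply, sum_mul]
  rw [sum_comm]

end MatrixLink

end PConvex

namespace PConvex

open Finset Matrix
open scoped RealInnerProductSpace

/-! ### Frames that diagonalise the second fundamental form -/

section Frames

variable {n p : ℕ}

lemma exists_orthonormalBasis_eq {Q : Fin n → E n} (hQ : Orthonormal ℝ Q) :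
    ∃ b : OrthonormalBasis (Fin n) ℝ (E n), ∀ i, b i = Q i := by
  have hspan : ⊤ ≤ Submodule.span ℝ (Set.range Q) :=
    (hQ.linearIndependent.span_eq_top_of_card_eq_finrank' (by simp)).ge
  exact ⟨OrthonormalBasis.mk hQ hspan, fun i => by simp⟩

lemma sum_inner_sq_of_orthonormal {Q : Fin n → E n} (hQ : Orthonormal ℝ Q) (v : E n) :
    ∑ i, ⟪Q i, v⟫ ^ 2 = ‖v‖ ^ 2 := by
  obtain ⟨b, hb⟩ := exists_orthonormalBasis_eq hQ
  rw [← b.sum_sq_norm_inner_right v]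
  exact sum_congr rfl fun i _ => by rw [hb, Real.norm_eq_abs, sq_abs]

/-- An orthonormal frame `Q` whose image under the inverse square root of the metric diagonalizes
the second fundamental form, with principal curvatures `κ`. -/
structure IsCurvatureFrame (p : ℕ) (m L : ℝ) (q : E n) (H : E n →L[ℝ] E n) (Q : Fin n → E n)
    (κ : Fin n → ℝ) : Prop where
  orthonormal : Orthonormal ℝ Q
  diag : ∀ i j, ⟪H (metricRootInv q (Q i)), metricRootInv q (Q j)⟫
    = if i = j then areaFactor q * κ i else 0
  pos : ∀ J ∈ subsetsOfCard n p, 0 < ∑ j ∈ J, κ j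
  le_prod : m ≤ ∏ J ∈ subsetsOfCard n p, ∑ j ∈ J, κ j
  prod_le : ∏ J ∈ subsetsOfCard n p, ∑ j ∈ J, κ j ≤ L

lemma metricRootInv_add (q v z : E n) :
    metricRootInv q (v + z) = metricRootInv q v + metricRootInv q z := by
  simp only [metricRootInv, inner_add_right, add_div, add_smul]; abel

lemma metricRootInv_smul (q : E n) (c : ℝ) (v : E n) :
    metricRootInv q (c • v) = c • metricRootInv q v := by
  simp only [metricRootInv, inner_smul_right, smul_sub, smul_smul, mul_div_assoc]

lemma metricRoot_sub (q v z : E n) :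
    metricRoot q (v - z) = metricRoot q v - metricRoot q z := by
  simp only [metricRoot, inner_sub_right, sub_div, sub_smul]; abel

lemma metricRoot_smul (q : E n) (c : ℝ) (v : E n) :
    metricRoot q (c • v) = c • metricRoot q v := by
  simp only [metricRoot, inner_smul_right, smul_add, smul_smul, mul_div_assoc]

lemma eq_zero_of_metricRootInv_eq_zero {q v : E n} (h : metricRootInv q v = 0) : v = 0 := by
  have h1 := div_le_norm_metricRootInv_sq q v
  rw [h, norm_zero, div_le_iff₀ (pow_pos (areaFactor_pos q) 2)] at h1
  simpa using h1

/-- With `τᵢ = g^{-1/2} Qᵢ`, this is the generalised eigenvector equation `H τᵢ = W κᵢ g τᵢ`. The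
diagonal form tests it against every `τⱼ`; Parseval and injectivity of the inverse root then give
equality of vectors. -/
lemma IsCurvatureFrame.apply {m L : ℝ} {q : E n} {H : E n →L[ℝ] E n} {Q : Fin n → E n}
    {κ : Fin n → ℝ} (h : IsCurvatureFrame p m L q H Q κ) (i : Fin n) :
    H (metricRootInv q (Q i)) = (areaFactor q * κ i) • metricRoot q (Q i) := by
  rw [← sub_eq_zero]
  apply eq_zero_of_metricRootInv_eq_zero (q := q)
  have h1 := sum_inner_sq_of_orthonormal h.orthonormal
    (metricRootInv q (H (metricRootInv q (Q i)) - (areaFactor q * κ i) • metricRoot q (Q i)))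
  rw [sum_eq_zero] at h1
  · simpa using h1.symm
  · intro j _
    rw [← inner_metricRootInv_comm, inner_sub_right, inner_smul_right, real_inner_comm, h.diag,
      real_inner_comm, inner_metricRoot_metricRootInv, orthonormal_iff_ite.1 h.orthonormal]
    split_ifs <;> simp

/-- The `τᵢ` resolve the inverse metric. -/
lemma sum_inner_metricRootInv_sq {Q : Fin n → E n} (hQ : Orthonormal ℝ Q) (q v : E n) :
    ∑ i, ⟪metricRootInv q (Q i), v⟫ ^ 2 = ‖metricRootInv q v‖ ^ 2 := by
  rw [← sum_inner_sq_of_orthonormal hQ]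
  exact sum_congr rfl fun i _ => by rw [inner_metricRootInv_comm]

/-- The spectral theorem applied to `g^{-1/2} H g^{-1/2}`; the eigenvalues are divided by `W`
because the second fundamental form is `H / W`. -/
lemma exists_isCurvatureFrame_diag (q : E n) (H : E n →L[ℝ] E n)
    (hH : ∀ x y, ⟪H x, y⟫ = ⟪x, H y⟫) :
    ∃ (Q : Fin n → E n) (κ : Fin n → ℝ), Orthonormal ℝ Q ∧
      ∀ i j, ⟪H (metricRootInv q (Q i)), metricRootInv q (Q j)⟫
        = if i = j then areaFactor q * κ i else 0 := by
  let a : E n →ₗ[ℝ] E n :=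
    { toFun := fun v => metricRootInv q (H (metricRootInv q v))
      map_add' := fun v z => by simp only [metricRootInv_add, map_add]
      map_smul' := fun c v => by simp [metricRootInv_smul] }
  have ha : a.IsSymmetric := by
    intro x y
    change ⟪metricRootInv q (H (metricRootInv q x)), y⟫
      = ⟪x, metricRootInv q (H (metricRootInv q y))⟫
    rw [inner_metricRootInv_comm, hH, ← inner_metricRootInv_comm]
  have hn : Module.finrank ℝ (E n) = n := by simp
  refine ⟨fun i => ha.eigenvectorBasis hn i, fun i => ha.eigenvalues hn i / areaFactor q,
    (ha.eigenvectorBasis hn).orthonormal, fun i j => ?_⟩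
  have h1 := ha.apply_eigenvectorBasis hn i
  rw [← inner_metricRootInv_comm]
  change ⟪a (ha.eigenvectorBasis hn i), _⟫ = _
  rw [h1, inner_smul_left, orthonormal_iff_ite.1 (ha.eigenvectorBasis hn).orthonormal]
  have := (areaFactor_pos q).ne'
  split_ifs
  · simp; field_simp
  · simp

/-- The second fundamental form in a frame, as a matrix. -/
noncomputable def frameMatrix (q : E n) (H : E n →L[ℝ] E n) (Q : Fin n → E n) :
    Matrix (Fin n) (Fin n) ℝ :=
  Matrix.of fun i j => ⟪H (metricRootInv q (Q i)), metricRootInv q (Q j)⟫ / areaFactor q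

lemma isHermitian_frameMatrix (q : E n) (H : E n →L[ℝ] E n) (Q : Fin n → E n)
    (hH : ∀ x y, ⟪H x, y⟫ = ⟪x, H y⟫) : (frameMatrix q H Q).IsHermitian := by
  ext i j
  simp only [frameMatrix, conjTranspose_apply, of_apply, star_trivial]
  rw [hH, real_inner_comm]

/-- An arbitrary orthonormal `Q` is allowed, not only an eigenframe, so that `Q` can stay fixed
while the base point moves. -/
lemma principalCurvatures_eq_roots (u : E n → ℝ) (x : E n) (H : E n →L[ℝ] E n)
    (hess : ∀ i j, hessianMatrix u x i j
      = ⟪H (EuclideanSpace.single i 1), EuclideanSpace.single j 1⟫)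
    {Q : Fin n → E n} (hQ : Orthonormal ℝ Q) :
    principalCurvatures u x = (frameMatrix (gradient u x) H Q).charpoly.roots := by
  set q := gradient u x with hq
  rw [principalCurvatures, metric, ← hq,
    charpoly_inv_metric_mul q (secondForm u x) (fun i => metricRootInv q (Q i))]
  · congr 2
    ext i j
    simp only [of_apply, frameMatrix, secondForm, Matrix.smul_apply, hess, smul_eq_mul]
    have hexp : ∀ v : E n, v = ∑ k, v k • EuclideanSpace.single k (1 : ℝ) := by
      intro v
      have := (EuclideanSpace.basisFun (Fin n) ℝ).sum_repr v
      simpa using this.symm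
    have hw : w u x = areaFactor q := rfl
    conv_rhs => rw [hexp (metricRootInv q (Q i)), hexp (metricRootInv q (Q j))]
    rw [map_sum, sum_inner, sum_div]
    refine sum_congr rfl fun k _ => ?_
    rw [inner_sum, sum_div]
    refine sum_congr rfl fun l _ => ?_
    rw [map_smul, inner_smul_left, inner_smul_right, hw]
    simp only [conj_trivial]
    field_simp
  · intro i j
    rw [metricRootInv_orthonormal, orthonormal_iff_ite.1 hQ]

lemma roots_charpoly_diagonal (κ : Fin n → ℝ) :
    (Matrix.diagonal κ).charpoly.roots = univ.val.map κ := by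
  rw [Matrix.charpoly_diagonal, Polynomial.roots_prod _ _ (prod_ne_zero_iff.2 fun i _ => Polynomial.X_sub_C_ne_zero _)]
  simp

lemma frameMatrix_eq_diagonal {q : E n} {H : E n →L[ℝ] E n} {Q : Fin n → E n} {κ : Fin n → ℝ}
    (h : ∀ i j, ⟪H (metricRootInv q (Q i)), metricRootInv q (Q j)⟫
        = if i = j then areaFactor q * κ i else 0) :
    frameMatrix q H Q = Matrix.diagonal κ := by
  ext i j
  rw [frameMatrix, of_apply, h, diagonal_apply]
  have := (areaFactor_pos q).ne'
  split_ifs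
  · field_simp
  · simp

end Frames

/-! ### First variation of the curvature product -/

section Touching

variable {n p : ℕ}

lemma differentiable_areaFactor : Differentiable ℝ (areaFactor (n := n)) := by
  intro q
  unfold areaFactor
  refine DifferentiableAt.sqrt ?_ (by positivity)
  exact (differentiableAt_const _).add (differentiableAt_id.norm_sq ℝ)

lemma differentiableAt_metricRootInv {q : ℝ → E n} {s : ℝ} (hq : DifferentiableAt ℝ q s)
    (v : E n) : DifferentiableAt ℝ (fun s => metricRootInv (q s) v) s := by
  have hw : DifferentiableAt ℝ (fun s => areaFactor (q s)) s :=
    (differentiable_areaFactor (q s)).comp s hq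
  unfold metricRootInv
  refine (differentiableAt_const _).sub (DifferentiableAt.fun_smul ?_ hq)
  refine DifferentiableAt.fun_div (hq.inner ℝ (differentiableAt_const _))
    (hw.mul ((differentiableAt_const _).add hw)) ?_
  have := areaFactor_pos (q s)
  positivity

lemma hasDerivAt_areaFactor {q : ℝ → E n} {q' : E n} {s : ℝ} (hq : HasDerivAt q q' s) :
    HasDerivAt (fun s => areaFactor (q s)) (⟪q s, q'⟫ / areaFactor (q s)) s := by
  have h1 : HasDerivAt (fun s => 1 + ‖q s‖ ^ 2) (2 * ⟪q s, q'⟫) s := by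
    simpa using (hq.norm_sq).const_add 1
  have h2 := h1.sqrt (by positivity)
  refine h2.congr_deriv ?_
  unfold areaFactor
  rw [mul_div_mul_left _ _ two_ne_zero]

/-- First variation of a diagonal entry of the second fundamental form in a moving frame. -/
lemma hasDerivAt_frameMatrix_diag {q : ℝ → E n} {q' : E n} {H : ℝ → E n →L[ℝ] E n}
    {H' : E n →L[ℝ] E n} {v : E n} {κ : ℝ} (hq : HasDerivAt q q' 0) (hH : HasDerivAt H H' 0)
    (hsymm : ∀ x y, ⟪H 0 x, y⟫ = ⟪x, H 0 y⟫) (hv : ‖v‖ = 1)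
    (heig : H 0 (metricRootInv (q 0) v) = (areaFactor (q 0) * κ) • metricRoot (q 0) v) :
    HasDerivAt (fun s => ⟪H s (metricRootInv (q s) v), metricRootInv (q s) v⟫ / areaFactor (q s))
      (⟪H' (metricRootInv (q 0) v), metricRootInv (q 0) v⟫ / areaFactor (q 0)
        - 2 * κ * (⟪q 0, metricRootInv (q 0) v⟫ * ⟪q', metricRootInv (q 0) v⟫)
        - κ * ⟪q 0, q'⟫ / areaFactor (q 0) ^ 2) 0 := by
  obtain ⟨m', hm⟩ : ∃ m', HasDerivAt (fun s => metricRootInv (q s) v) m' 0 :=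
    ⟨_, (differentiableAt_metricRootInv hq.differentiableAt v).hasDerivAt⟩
  set τ := metricRootInv (q 0) v with hτ
  set W := areaFactor (q 0) with hW
  have hWpos : 0 < W := areaFactor_pos _
  -- Differentiating the normalisation of `τ` in the metric. Since `H τ` is proportional to `g τ`,
  -- this one contraction of `m'` is all that is needed, and `m'` itself is never computed.
  have hconst : ⟪τ, m'⟫ + ⟪q 0, τ⟫ * ⟪q 0, m'⟫ = -(⟪q 0, τ⟫ * ⟪q', τ⟫) := by
    have h1 : HasDerivAt (fun s => ⟪metricRootInv (q s) v, metricRootInv (q s) v⟫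
        + ⟪q s, metricRootInv (q s) v⟫ * ⟪q s, metricRootInv (q s) v⟫)
        ((⟪τ, m'⟫ + ⟪m', τ⟫) + ((⟪q 0, m'⟫ + ⟪q', τ⟫) * ⟪q 0, τ⟫
          + ⟪q 0, τ⟫ * (⟪q 0, m'⟫ + ⟪q', τ⟫))) 0 :=
      (hm.inner ℝ hm).add ((hq.inner ℝ hm).mul (hq.inner ℝ hm))
    have h2 : (fun s => ⟪metricRootInv (q s) v, metricRootInv (q s) v⟫
        + ⟪q s, metricRootInv (q s) v⟫ * ⟪q s, metricRootInv (q s) v⟫) = fun _ => ⟪v, v⟫ :=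
      funext fun s => metricRootInv_orthonormal (q s) v v
    rw [h2] at h1
    have h3 := h1.unique (hasDerivAt_const _ _)
    rw [real_inner_comm τ m'] at h3
    linarith
  have hHm : HasDerivAt (fun s => H s (metricRootInv (q s) v)) (H' τ + H 0 m') 0 :=
    hH.clm_apply hm
  have h4 : HasDerivAt (fun s => ⟪H s (metricRootInv (q s) v), metricRootInv (q s) v⟫
      / areaFactor (q s)) (((⟪H 0 τ, m'⟫ + ⟪H' τ + H 0 m', τ⟫) * W
        - ⟪H 0 τ, τ⟫ * (⟪q 0, q'⟫ / W)) / W ^ 2) 0 :=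
    (hHm.inner ℝ hm).div (hasDerivAt_areaFactor hq) hWpos.ne'
  refine h4.congr_deriv ?_
  have h5 : ⟪H 0 τ, m'⟫ = W * κ * -(⟪q 0, τ⟫ * ⟪q', τ⟫) := by
    rw [heig, ← metricRootInv_metric, inner_smul_left, inner_add_left, inner_smul_left, ← hτ,
      ← hconst]
    simp
  have h6 : ⟪H 0 m', τ⟫ = ⟪H 0 τ, m'⟫ := by rw [hsymm, real_inner_comm]
  have h7 : ⟪H 0 τ, τ⟫ = W * κ := by
    rw [heig, inner_smul_left, inner_metricRoot_metricRootInv, real_inner_self_eq_norm_sq, hv]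
    simp
  rw [inner_add_left, h6, h5, h7]
  field_simp
  ring

/-- The differentiated curvature equation: the derivative of the logarithm of the curvature
product, by concavity. -/
lemma deriv_log_curvatureProduct {q : ℝ → E n} {q' : E n} {H : ℝ → E n →L[ℝ] E n}
    {H' : E n →L[ℝ] E n} {Q : Fin n → E n} {κ : Fin n → ℝ} {φ : ℝ → ℝ} {φ' m L : ℝ}
    (hq : HasDerivAt q q' 0) (hH : HasDerivAt H H' 0) (hφ : HasDerivAt φ φ' 0)
    (hsymm : ∀ᶠ s in nhds 0, ∀ x y, ⟪H s x, y⟫ = ⟪x, H s y⟫)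
    (hframe : IsCurvatureFrame p m L (q 0) (H 0) Q κ)
    (hcone : ∀ᶠ s in nhds 0, InCone p (frameMatrix (q s) (H s) Q).charpoly.roots)
    (hlog : ∀ᶠ s in nhds 0,
      φ s = Real.log (curvatureProduct p (frameMatrix (q s) (H s) Q).charpoly.roots)) :
    φ' = ∑ i, logSumDeriv p κ i *
      (⟪H' (metricRootInv (q 0) (Q i)), metricRootInv (q 0) (Q i)⟫ / areaFactor (q 0)
        - 2 * κ i * (⟪q 0, metricRootInv (q 0) (Q i)⟫ * ⟪q', metricRootInv (q 0) (Q i)⟫)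
        - κ i * ⟪q 0, q'⟫ / areaFactor (q 0) ^ 2) := by
  set d : Fin n → ℝ := fun i =>
    (⟪H' (metricRootInv (q 0) (Q i)), metricRootInv (q 0) (Q i)⟫ / areaFactor (q 0)
        - 2 * κ i * (⟪q 0, metricRootInv (q 0) (Q i)⟫ * ⟪q', metricRootInv (q 0) (Q i)⟫)
        - κ i * ⟪q 0, q'⟫ / areaFactor (q 0) ^ 2) with hd
  have hdiag : ∀ i, HasDerivAt (fun s => frameMatrix (q s) (H s) Q i i) (d i) 0 := fun i =>
    hasDerivAt_frameMatrix_diag hq hH hsymm.self_of_nhds (hframe.orthonormal.1 i)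
      (hframe.apply i)
  have hM0 : frameMatrix (q 0) (H 0) Q = Matrix.diagonal κ := frameMatrix_eq_diagonal hframe.diag
  have hii : ∀ i, frameMatrix (q 0) (H 0) Q i i = κ i := fun i => by
    rw [hM0, diagonal_apply_eq]
  have hΨ : HasDerivAt (fun s => ∑ J ∈ subsetsOfCard n p,
      Real.log (∑ i ∈ J, frameMatrix (q s) (H s) Q i i))
      (∑ J ∈ subsetsOfCard n p, (∑ i ∈ J, d i) / (∑ i ∈ J, κ i)) 0 := by
    refine HasDerivAt.fun_sum fun J hJ => ?_
    have h1 := (HasDerivAt.fun_sum (u := J) fun i _ => hdiag i).log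
      (by simp only [hii]; exact (hframe.pos J hJ).ne')
    simpa only [hii] using h1
  -- The diagonal expression dominates the logarithm of the product near 0 and equals it at 0, where
  -- the matrix is diagonal. So the derivatives agree, even when curvatures coincide and eigenvalues
  -- need not be differentiable.
  have hmin : IsLocalMin (fun s => (∑ J ∈ subsetsOfCard n p,
      Real.log (∑ i ∈ J, frameMatrix (q s) (H s) Q i i)) - φ s) 0 := by
    have h0 : (∑ J ∈ subsetsOfCard n p,
        Real.log (∑ i ∈ J, frameMatrix (q 0) (H 0) Q i i)) - φ 0 = 0 := by
      rw [hlog.self_of_nhds, hM0, roots_charpoly_diagonal, curvatureProduct_map,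
        Real.log_prod fun J hJ => (hframe.pos J hJ).ne']
      simp
    filter_upwards [hsymm, hcone, hlog] with s h1 h2 h3
    rw [h0, h3]
    have := (log_curvatureProduct_le (isHermitian_frameMatrix (q s) (H s) Q h1) h2).2
    linarith
  have hder := hmin.hasDerivAt_eq_zero (hΨ.sub hφ)
  rw [sum_logSumDeriv_mul]
  rw [← sub_eq_zero.1 hder]
  exact sum_congr rfl fun J _ => by rw [div_eq_inv_mul]

end Touching

end PConvex

namespace PConvex

open Finset Matrix
open scoped RealInnerProductSpace Topology

/-! ### Second and third derivatives in the interior -/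

section InteriorCalculus

variable {n : ℕ}

/-- The Hessian of `u` as an operator: the derivative of the gradient. -/
noncomputable def hessOp (u : E n → ℝ) (x : E n) : E n →L[ℝ] E n := fderiv ℝ (gradient u) x

/-- The derivative of the Hessian operator. -/
noncomputable def thirdOp (u : E n → ℝ) (x : E n) : E n →L[ℝ] E n →L[ℝ] E n :=
  fderiv ℝ (hessOp u) x

lemma ContDiffAt.gradient' {u : E n → ℝ} {x : E n} {k l : WithTop ℕ∞} (hu : ContDiffAt ℝ k u x)
    (hl : l + 1 ≤ k) : ContDiffAt ℝ l (gradient u) x :=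
  (InnerProductSpace.toDual ℝ (E n)).symm.contDiff.contDiffAt.comp x (hu.fderiv_right hl)

lemma contDiffAt_hessOp {u : E n → ℝ} {x : E n} (hu : ContDiffAt ℝ 3 u x) :
    ContDiffAt ℝ 1 (hessOp u) x :=
  ContDiffAt.fderiv_right (m := 1) (n := 2)
    (ContDiffAt.gradient' (l := 2) hu (by norm_num)) (by norm_num)

lemma fderiv_fderiv_apply {u : E n → ℝ} {x : E n} (hu : ContDiffAt ℝ 2 u x) (a b : E n) :
    fderiv ℝ (fderiv ℝ u) x a b = ⟪hessOp u x a, b⟫ := by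
  have h1 : DifferentiableAt ℝ (gradient u) x :=
    (ContDiffAt.gradient' (l := 1) hu (by norm_num)).differentiableAt (by norm_num)
  have h2 : fderiv ℝ u = fun y => InnerProductSpace.toDual ℝ (E n) (gradient u y) := by
    funext y; simp [gradient]
  have h3 : HasFDerivAt (fun y => InnerProductSpace.toDual ℝ (E n) (gradient u y))
      ((InnerProductSpace.toDual ℝ (E n)).toContinuousLinearEquiv.toContinuousLinearMap.comp
        (hessOp u x)) x :=
    (InnerProductSpace.toDual ℝ (E n)).toContinuousLinearEquiv.toContinuousLinearMap.hasFDerivAt.comp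
      x h1.hasFDerivAt
  rw [h2, h3.fderiv]
  simp

lemma hessOp_symm {u : E n → ℝ} {x : E n} (hu : ContDiffAt ℝ 2 u x) (a b : E n) :
    ⟪hessOp u x a, b⟫ = ⟪a, hessOp u x b⟫ := by
  rw [real_inner_comm _ a, ← fderiv_fderiv_apply hu, ← fderiv_fderiv_apply hu]
  exact (hu.isSymmSndFDerivAt (by simp)) a b

lemma hessianMatrix_apply {u : E n → ℝ} {x : E n} (hu : ContDiffAt ℝ 2 u x) (i j : Fin n) :
    hessianMatrix u x i j
      = ⟪hessOp u x (EuclideanSpace.single i 1), EuclideanSpace.single j 1⟫ := by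
  rw [hessianMatrix, of_apply, iteratedFDeriv_two_apply, ← fderiv_fderiv_apply hu]
  rfl

/-- Needed to turn the third derivative in a second-order condition, twice along `η` and once along
`T`, into the derivative of the Hessian along `T` that the differentiated equation contains. -/
lemma thirdOp_symm {u : E n → ℝ} {x : E n} (hu : ContDiffAt ℝ 3 u x) (a b : E n) :
    ⟪thirdOp u x a a, b⟫ = ⟪thirdOp u x b a, a⟫ := by
  have h1 : ∀ a b, thirdOp u x a b = thirdOp u x b a := by
    have := (ContDiffAt.gradient' (l := 2) hu (by norm_num)).isSymmSndFDerivAt (by simp)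
    exact fun a b => this a b
  have h2 : ∀ a b c, ⟪thirdOp u x a b, c⟫ = ⟪b, thirdOp u x a c⟫ := by
    intro a b c
    have hd := ((contDiffAt_hessOp hu).differentiableAt (by norm_num)).hasFDerivAt
    have e1 : HasFDerivAt (fun y => ⟪hessOp u y b, c⟫ - ⟪b, hessOp u y c⟫) _ x :=
      ((hd.clm_apply (hasFDerivAt_const b x)).inner ℝ (hasFDerivAt_const c x)).sub
        ((hasFDerivAt_const b x).inner ℝ (hd.clm_apply (hasFDerivAt_const c x)))
    have e2 : (fun y => ⟪hessOp u y b, c⟫ - ⟪b, hessOp u y c⟫) =ᶠ[𝓝 x] fun _ => 0 := by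
      filter_upwards [hu.eventually (by simp)] with y hy
      rw [hessOp_symm (hy.of_le (by norm_num)), sub_self]
    have e3 := e1.unique ((hasFDerivAt_const (0 : ℝ) x).congr_of_eventuallyEq e2)
    have e4 := congrArg (fun l => l a) e3
    simp at e4
    change ⟪fderiv ℝ (hessOp u) x a b, c⟫ = ⟪b, fderiv ℝ (hessOp u) x a c⟫
    linarith
  rw [h2, h1 a b, real_inner_comm]

end InteriorCalculus

/-! ### The normal as a smooth function of the gradient -/

section Normal

variable {n : ℕ}

/-- The upward unit normal as a function of the gradient. -/
noncomputable def normalOfGradient (q : E n) : E (n + 1) :=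
  WithLp.toLp 2 (Fin.snoc (fun i : Fin n => -(q i) / areaFactor q) (1 / areaFactor q))

lemma upwardNormal_eq (u : E n → ℝ) (x : E n) :
    upwardNormal u x = normalOfGradient (gradient u x) := rfl

lemma norm_normalOfGradient (q : E n) : ‖normalOfGradient q‖ = 1 := by
  have h1 := areaFactor_pos q
  have h : ‖normalOfGradient q‖ ^ 2 = 1 := by
    rw [EuclideanSpace.norm_sq_eq, Fin.sum_univ_castSucc]
    simp only [normalOfGradient, Fin.snoc_castSucc, Fin.snoc_last, Real.norm_eq_abs, sq_abs,
      div_pow, neg_sq, one_pow]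
    rw [← sum_div, ← add_div, div_eq_one_iff_eq (by positivity), areaFactor_sq,
      EuclideanSpace.norm_sq_eq]
    simp [add_comm]
  exact (pow_eq_one_iff_of_nonneg (norm_nonneg _) two_ne_zero).1 h

lemma contDiff_areaFactor : ContDiff ℝ ∞ (areaFactor (n := n)) := by
  unfold areaFactor
  exact ContDiff.sqrt (contDiff_const.add (contDiff_norm_sq ℝ)) fun q => by positivity

lemma contDiff_normalOfGradient : ContDiff ℝ ∞ (normalOfGradient (n := n)) := by
  rw [contDiff_euclidean]
  intro i
  have hne : ∀ q : E n, areaFactor q ≠ 0 := fun q => (areaFactor_pos q).ne'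
  refine Fin.lastCases ?_ (fun j => ?_) i
  · simp only [normalOfGradient, Fin.snoc_last]
    exact contDiff_const.div contDiff_areaFactor hne
  · simp only [normalOfGradient, Fin.snoc_castSucc]
    exact ContDiff.div (contDiff_euclidean.1 contDiff_id j).neg contDiff_areaFactor hne

lemma exists_bound_fderiv_normalOfGradient (n : ℕ) (K : ℝ) :
    ∃ C : ℝ, 0 ≤ C ∧ ∀ q : E n, ‖q‖ ≤ K → ‖fderiv ℝ (normalOfGradient (n := n)) q‖ ≤ C := by
  have hcont : Continuous (fderiv ℝ (normalOfGradient (n := n))) :=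
    contDiff_normalOfGradient.continuous_fderiv (by simp)
  obtain ⟨C, hC⟩ := (isCompact_closedBall (0 : E n) K).exists_bound_of_continuousOn
    hcont.continuousOn
  exact ⟨max C 0, le_max_right _ _, fun q hq =>
    (hC q (by simpa using hq)).trans (le_max_left _ _)⟩

end Normal

/-! ### The differentiated curvature equation -/

section InteriorEquation

variable {n p : ℕ}

/-- All hypotheses of the boundary estimate on the pair `(f, u)`. -/
structure IsControlledSolution (p : ℕ) (Ω : Set (E n)) (K L m : ℝ)
    (f : E n → ℝ → E (n + 1) → ℝ) (u : E n → ℝ) : Prop where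
  smoothPositive : IsSmoothPositive Ω f
  solution : IsAdmissibleSolution p Ω f u
  bound : ∀ x ∈ Ω, |u x| ≤ K ∧ ‖gradient u x‖ ≤ K
  rhs_bound : ∀ q ∈ relevantPoints Ω u,
    |f q.1 q.2.1 q.2.2| ≤ L ∧ ‖fderiv ℝ (radialExtension f) q‖ ≤ L
  le_rhs : ∀ q ∈ relevantPoints Ω u, m ≤ f q.1 q.2.1 q.2.2

variable {Ω : Set (E n)} {K L m : ℝ} {f : E n → ℝ → E (n + 1) → ℝ} {u : E n → ℝ}

lemma IsControlledSolution.contDiffAt (h : IsControlledSolution p Ω K L m f u) (hΩ : IsOpen Ω)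
    {x : E n} (hx : x ∈ Ω) : ContDiffAt ℝ 3 u x :=
  h.solution.contDiffOn.contDiffAt
    (Filter.mem_of_superset (hΩ.mem_nhds hx) subset_closure)

lemma mem_relevantPoints {x : E n} (hx : x ∈ Ω) :
    (x, u x, upwardNormal u x) ∈ relevantPoints Ω u :=
  ⟨hx, ⟨x, subset_closure hx, le_rfl⟩, norm_normalOfGradient _⟩

lemma rhs_eq_radialExtension (x : E n) :
    f x (u x) (upwardNormal u x) = radialExtension f (x, u x, upwardNormal u x) := by
  simp [radialExtension, upwardNormal_eq, norm_normalOfGradient]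

lemma IsControlledSolution.exists_frame (h : IsControlledSolution p Ω K L m f u) (hΩ : IsOpen Ω)
    {x : E n} (hx : x ∈ Ω) :
    ∃ Q κ, IsCurvatureFrame p m L (gradient u x) (hessOp u x) Q κ := by
  have hu := (h.contDiffAt hΩ hx).of_le (show (2 : WithTop ℕ∞) ≤ 3 by norm_num)
  obtain ⟨Q, κ, hQ, hdiag⟩ := exists_isCurvatureFrame_diag (gradient u x) (hessOp u x)
    (hessOp_symm hu)
  have hpc : principalCurvatures u x = univ.val.map κ := by
    rw [principalCurvatures_eq_roots u x (hessOp u x) (hessianMatrix_apply hu) hQ,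
      frameMatrix_eq_diagonal hdiag, roots_charpoly_diagonal]
  have heq := h.solution.equation x hx
  have hcone := h.solution.admissible x hx
  rw [hpc, curvatureProduct_map] at heq
  rw [hpc, inCone_map_iff] at hcone
  refine ⟨Q, κ, hQ, hdiag, hcone, ?_, ?_⟩
  · rw [heq]; exact h.le_rhs _ (mem_relevantPoints hx)
  · rw [heq]; exact (le_abs_self _).trans (h.rhs_bound _ (mem_relevantPoints hx)).1

/-- The curvature equation differentiated once, with bounded right-hand side. -/
lemma exists_frame_linearized (n p : ℕ) {K L m : ℝ} (hm : 0 < m) :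
    ∃ C : ℝ, 0 < C ∧ ∀ (Ω : Set (E n)), IsOpen Ω →
      ∀ (f : E n → ℝ → E (n + 1) → ℝ) (u : E n → ℝ), IsControlledSolution p Ω K L m f u →
      ∀ x ∈ Ω, ∃ Q κ, IsCurvatureFrame p m L (gradient u x) (hessOp u x) Q κ ∧
        ∀ T : E n, |∑ i, logSumDeriv p κ i *
          (⟪thirdOp u x T (metricRootInv (gradient u x) (Q i)), metricRootInv (gradient u x) (Q i)⟫
              / areaFactor (gradient u x)
            - 2 * κ i * (⟪gradient u x, metricRootInv (gradient u x) (Q i)⟫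
              * ⟪hessOp u x T, metricRootInv (gradient u x) (Q i)⟫)
            - κ i * ⟪gradient u x, hessOp u x T⟫ / areaFactor (gradient u x) ^ 2)|
          ≤ C * (‖T‖ + ‖hessOp u x T‖) := by
  obtain ⟨Cν, hCν0, hCν⟩ := exists_bound_fderiv_normalOfGradient n K
  -- The derivative of `log f` is `Df / f`, at most `L / m` times the speed of `(x, u, ν)`; the
  -- three summands bound the speeds of the three components, and `+ 1` makes the constant positive.
  refine ⟨|L| / m * (1 + |K| + Cν) + 1, by positivity, fun Ω hΩ f u h x hx => ?_⟩
  obtain ⟨Q, κ, hframe⟩ := h.exists_frame hΩ hx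
  refine ⟨Q, κ, hframe, fun T => ?_⟩
  have hu := h.contDiffAt hΩ hx
  have hline : HasDerivAt (fun s : ℝ => x + s • T) T 0 := by
    simpa using ((hasDerivAt_id (0 : ℝ)).smul_const T).const_add x
  have hline0 : x + (0 : ℝ) • T = x := by simp
  have hev : ∀ᶠ s : ℝ in 𝓝 0, x + s • T ∈ Ω := by
    refine hline.continuousAt.eventually_mem ?_
    rw [hline0]; exact hΩ.mem_nhds hx
  have hG : HasFDerivAt (gradient u) (hessOp u x) (x + (0 : ℝ) • T) := by
    rw [hline0]
    exact ((ContDiffAt.gradient' (l := 2) hu (by norm_num)).differentiableAt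
      (by norm_num)).hasFDerivAt
  have hH : HasFDerivAt (hessOp u) (thirdOp u x) (x + (0 : ℝ) • T) := by
    rw [hline0]
    exact ((contDiffAt_hessOp hu).differentiableAt (by norm_num)).hasFDerivAt
  have hq : HasDerivAt (fun s : ℝ => gradient u (x + s • T)) (hessOp u x T) 0 :=
    HasFDerivAt.comp_hasDerivAt (f := fun s : ℝ => x + s • T) (0 : ℝ) hG hline
  have hHs : HasDerivAt (fun s : ℝ => hessOp u (x + s • T)) (thirdOp u x T) 0 :=
    hH.comp_hasDerivAt 0 hline
  have hus : HasDerivAt (fun s : ℝ => u (x + s • T)) (fderiv ℝ u x T) 0 := by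
    have : HasFDerivAt u (fderiv ℝ u x) (x + (0 : ℝ) • T) := by
      rw [hline0]
      exact (hu.differentiableAt (by norm_num)).hasFDerivAt
    exact this.comp_hasDerivAt 0 hline
  have hνs : HasDerivAt (fun s : ℝ => upwardNormal u (x + s • T))
      (fderiv ℝ (normalOfGradient (n := n)) (gradient u x) (hessOp u x T)) 0 := by
    have : HasFDerivAt (normalOfGradient (n := n))
        (fderiv ℝ (normalOfGradient (n := n)) (gradient u x)) (gradient u (x + (0 : ℝ) • T)) := by
      rw [hline0]
      exact (contDiff_normalOfGradient.differentiable (by simp) _).hasFDerivAt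
    exact this.comp_hasDerivAt 0 hq
  set P : E n × ℝ × E (n + 1) := (x, u x, upwardNormal u x) with hP
  have hPmem : P ∈ relevantPoints Ω u := mem_relevantPoints hx
  have hdf : DifferentiableAt ℝ (radialExtension f) P := by
    have hopen : IsOpen {q : E n × ℝ × E (n + 1) | q.1 ∈ Ω ∧ q.2.2 ≠ 0} :=
      (hΩ.preimage continuous_fst).inter
        (isOpen_ne.preimage (continuous_snd.comp continuous_snd))
    refine (h.smoothPositive.smooth.contDiffAt (hopen.mem_nhds ⟨hx, ?_⟩)).differentiableAt (by simp)
    rw [← norm_ne_zero_iff]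
    simp [hP, upwardNormal_eq, norm_normalOfGradient]
  have hφ0 : HasDerivAt (fun s : ℝ => radialExtension f
      (x + s • T, u (x + s • T), upwardNormal u (x + s • T)))
      (fderiv ℝ (radialExtension f) P (T, fderiv ℝ u x T,
        fderiv ℝ (normalOfGradient (n := n)) (gradient u x) (hessOp u x T))) 0 := by
    have h1 : HasFDerivAt (radialExtension f) (fderiv ℝ (radialExtension f) P)
        (x + (0 : ℝ) • T, u (x + (0 : ℝ) • T), upwardNormal u (x + (0 : ℝ) • T)) := by
      rw [hline0]; exact hdf.hasFDerivAt
    exact h1.comp_hasDerivAt (0 : ℝ) (hline.prodMk (hus.prodMk hνs))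
  have hval : radialExtension f P = f x (u x) (upwardNormal u x) :=
    (rhs_eq_radialExtension x).symm
  have hfm : m ≤ radialExtension f P := by
    rw [hval]; exact h.le_rhs _ hPmem
  have hφ := hφ0.log (by rw [hline0]; exact (hm.trans_le hfm).ne')
  -- The frame `Q` belongs to the point `x` and is frozen along the line, while the gradient and the
  -- Hessian vary.
  have key := deriv_log_curvatureProduct (p := p) (m := m) (L := L) (Q := Q) (κ := κ) hq hHs hφ
    (by
      filter_upwards [hev] with s hs
      exact hessOp_symm ((h.contDiffAt hΩ hs).of_le (by norm_num)))
    (by rw [hline0]; exact hframe)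
    (by
      filter_upwards [hev] with s hs
      have hu2 := (h.contDiffAt hΩ hs).of_le (show (2 : WithTop ℕ∞) ≤ 3 by norm_num)
      rw [← principalCurvatures_eq_roots u _ _ (hessianMatrix_apply hu2) hframe.orthonormal]
      exact h.solution.admissible _ hs)
    (by
      filter_upwards [hev] with s hs
      have hu2 := (h.contDiffAt hΩ hs).of_le (show (2 : WithTop ℕ∞) ≤ 3 by norm_num)
      rw [← principalCurvatures_eq_roots u _ _ (hessianMatrix_apply hu2) hframe.orthonormal,
        h.solution.equation _ hs, ← rhs_eq_radialExtension])
  simp only [hline0] at key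
  rw [← key]
  have hbound := h.rhs_bound _ hPmem
  have hL0 : 0 ≤ L := (abs_nonneg _).trans hbound.1
  have hK := (h.bound x hx).2
  rw [abs_div, abs_of_pos (hm.trans_le hfm), abs_of_nonneg hL0]
  have h1 : |fderiv ℝ (radialExtension f) P (T, fderiv ℝ u x T,
        fderiv ℝ (normalOfGradient (n := n)) (gradient u x) (hessOp u x T))|
      ≤ L * (‖T‖ + |K| * ‖T‖ + Cν * ‖hessOp u x T‖) := by
    rw [← Real.norm_eq_abs]
    refine (ContinuousLinearMap.le_opNorm _ _).trans ?_
    refine mul_le_mul hbound.2 ?_ (norm_nonneg _) hL0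
    have e1 : ‖fderiv ℝ u x T‖ ≤ |K| * ‖T‖ := by
      rw [← inner_gradient_left, Real.norm_eq_abs]
      refine (abs_real_inner_le_norm _ _).trans ?_
      exact mul_le_mul_of_nonneg_right (hK.trans (le_abs_self K)) (norm_nonneg _)
    have e2 : ‖fderiv ℝ (normalOfGradient (n := n)) (gradient u x) (hessOp u x T)‖
        ≤ Cν * ‖hessOp u x T‖ :=
      (ContinuousLinearMap.le_opNorm _ _).trans
        (mul_le_mul_of_nonneg_right (hCν _ hK) (norm_nonneg _))
    have e3 : 0 ≤ |K| * ‖T‖ := by positivity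
    have e4 : 0 ≤ Cν * ‖hessOp u x T‖ := by positivity
    rw [norm_prod_le_iff, norm_prod_le_iff]
    refine ⟨?_, ?_, ?_⟩ <;> simp only <;> linarith [norm_nonneg T]
  have h2 : ‖T‖ + |K| * ‖T‖ + Cν * ‖hessOp u x T‖
      ≤ (1 + |K| + Cν) * (‖T‖ + ‖hessOp u x T‖) := by
    have := norm_nonneg T
    have := norm_nonneg (hessOp u x T)
    have := abs_nonneg K
    have e1 : 0 ≤ Cν * ‖T‖ := by positivity
    have e2 : 0 ≤ |K| * ‖hessOp u x T‖ := by positivity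
    linarith
  have h3 : 0 ≤ (1 + |K| + Cν) * (‖T‖ + ‖hessOp u x T‖) := by positivity
  calc _ ≤ L * ((1 + |K| + Cν) * (‖T‖ + ‖hessOp u x T‖)) / m := by
        refine div_le_div₀ (by positivity) (h1.trans ?_) hm hfm
        exact mul_le_mul_of_nonneg_left h2 hL0
    _ = L / m * (1 + |K| + Cν) * (‖T‖ + ‖hessOp u x T‖) := by ring
    _ ≤ _ := by
        refine mul_le_mul_of_nonneg_right ?_ (by positivity)
        linarith

end InteriorEquation

end PConvex

namespace PConvex

open Finset Matrix
open scoped RealInnerProductSpace Topology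

/-- A negative second derivative would make the point a local maximum too, so the function would be
locally constant and its second derivative zero. -/
lemma IsLocalMin.second_deriv_nonneg {φ φ' : ℝ → ℝ} {a c : ℝ} (hmin : IsLocalMin φ a)
    (h1 : ∀ᶠ s in 𝓝 a, HasDerivAt φ (φ' s) s) (h2 : HasDerivAt φ' c a) : 0 ≤ c := by
  by_contra! hc
  have hd : deriv (fun s => -φ s) =ᶠ[𝓝 a] fun s => -φ' s := by
    filter_upwards [h1] with s hs using hs.neg.deriv
  have h3 : deriv (deriv fun s => -φ s) a = -c := by
    rw [hd.deriv_eq]; exact h2.neg.deriv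
  have h4 : deriv (fun s => -φ s) a = 0 := by
    change deriv (-φ) a = 0
    rw [h1.self_of_nhds.neg.deriv, hmin.hasDerivAt_eq_zero h1.self_of_nhds, neg_zero]
  have h5 : IsLocalMin (fun s => -φ s) a :=
    isLocalMin_of_deriv_deriv_pos (by rw [h3]; linarith) h4 h1.self_of_nhds.neg.continuousAt
  have h6 : φ =ᶠ[𝓝 a] fun _ => φ a := by
    filter_upwards [hmin, h5] with s hs1 hs2
    linarith
  have h7 : φ' =ᶠ[𝓝 a] fun _ => 0 := by
    filter_upwards [h1, h6.eventuallyEq_nhds] with s hs1 hs2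
    exact hs1.unique ((hasDerivAt_const s (φ a)).congr_of_eventuallyEq hs2)
  have h8 := h2.unique ((hasDerivAt_const a (0 : ℝ)).congr_of_eventuallyEq h7)
  linarith

/-! ### Projection orthogonal to a fixed normal -/

section Projection

variable {n : ℕ}

/-- The component of `v` orthogonal to the unit vector `e`. -/
noncomputable def perp (e v : E n) : E n := v - ⟪v, e⟫ • e

lemma perp_add_smul (e v : E n) : perp e v + ⟪v, e⟫ • e = v := sub_add_cancel _ _

lemma norm_perp_sq {e : E n} (he : ‖e‖ = 1) (v : E n) : ‖perp e v‖ ^ 2 = ‖v‖ ^ 2 - ⟪v, e⟫ ^ 2 := by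
  rw [perp, ← real_inner_self_eq_norm_sq, inner_sub_left, inner_sub_right, inner_sub_right,
    inner_smul_left, inner_smul_right, inner_smul_left, inner_smul_right,
    real_inner_self_eq_norm_sq, real_inner_self_eq_norm_sq, he, real_inner_comm v e]
  simp; ring

lemma norm_perp_le {e : E n} (he : ‖e‖ = 1) (v : E n) : ‖perp e v‖ ≤ ‖v‖ := by
  have := norm_perp_sq he v
  exact (abs_le_of_sq_le_sq' (by linarith [sq_nonneg ⟪v, e⟫]) (norm_nonneg _)).2

lemma inner_perp_right (e v z : E n) : ⟪z, perp e v⟫ = ⟪z, v⟫ - ⟪v, e⟫ * ⟪z, e⟫ := by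
  rw [perp, inner_sub_right, inner_smul_right]

/-- At most one vector of a dual frame of the metric can be close to a given line. -/
lemma one_le_norm_perp_metricRoot {e : E n} (he : ‖e‖ = 1) (q : E n) {v z : E n} (hv : ‖v‖ = 1)
    (hz : ‖z‖ = 1) (hvz : ⟪v, z⟫ = 0) :
    1 ≤ ‖perp e (metricRoot q v)‖ ^ 2 + ‖perp e (metricRoot q z)‖ ^ 2 := by
  set a := metricRoot q v with ha
  set b := metricRoot q z with hb
  set s := ⟪a, e⟫ with hs
  set t := ⟪b, e⟫ with ht
  -- The combination `t a - s b` has no `e`-component, so its norm is governed by the projections.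
  -- It is not short, because the square root of the metric does not decrease norms.
  have h1 : s ^ 2 + t ^ 2 ≤ ‖t • a - s • b‖ ^ 2 := by
    rw [ha, hb, ← metricRoot_smul, ← metricRoot_smul, ← metricRoot_sub, norm_metricRoot_sq]
    have : ‖t • v - s • z‖ ^ 2 = s ^ 2 + t ^ 2 := by
      rw [norm_sub_sq_real, norm_smul, norm_smul, inner_smul_left, inner_smul_right, hvz, hv, hz]
      simp; ring
    rw [this]
    linarith [sq_nonneg ⟪q, t • v - s • z⟫]
  have h2 : t • a - s • b = t • perp e a - s • perp e b := by
    simp only [perp, smul_sub, smul_smul, ← hs, ← ht, mul_comm t s]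
    abel
  have h3 : ‖t • a - s • b‖ ≤ |t| * ‖perp e a‖ + |s| * ‖perp e b‖ := by
    rw [h2]
    refine (norm_sub_le _ _).trans ?_
    rw [norm_smul, norm_smul, Real.norm_eq_abs, Real.norm_eq_abs]
  have h4 : ‖t • a - s • b‖ ^ 2 ≤ (s ^ 2 + t ^ 2) * (‖perp e a‖ ^ 2 + ‖perp e b‖ ^ 2) := by
    calc ‖t • a - s • b‖ ^ 2 ≤ (|t| * ‖perp e a‖ + |s| * ‖perp e b‖) ^ 2 := by gcongr
      _ ≤ (|s| ^ 2 + |t| ^ 2) * (‖perp e a‖ ^ 2 + ‖perp e b‖ ^ 2) := by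
        nlinarith [sq_nonneg (|t| * ‖perp e b‖ - |s| * ‖perp e a‖)]
      _ = _ := by rw [sq_abs, sq_abs]
  rcases (add_nonneg (sq_nonneg s) (sq_nonneg t)).eq_or_lt with h0 | h0
  · have hs0 : s ^ 2 = 0 := by linarith [sq_nonneg s, sq_nonneg t]
    rw [norm_perp_sq he a, ← hs, hs0, ha, norm_metricRoot_sq, hv]
    linarith [sq_nonneg ⟪q, v⟫, sq_nonneg ‖perp e b‖]
  · by_contra! h
    nlinarith [h1.trans h4]

end Projection

/-! ### Conditions at a minimum of the test function -/

section TestFunction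

variable {n : ℕ}

/-- The test function for the mixed second derivatives at the boundary. -/
noncomputable def testFunction (G : E n → E n) (ρ : E n → ℝ) (k : ℝ → ℝ) (B : ℝ) (x₀ e ξ : E n)
    (Z : E n →L[ℝ] E n) (x : E n) : ℝ :=
  ⟪G x, ξ + Z (x - x₀)⟫ - 1 / 2 * (⟪G x, G x⟫ - ⟪G x, e⟫ ^ 2) + k (-ρ x) + B * ⟪x - x₀, x - x₀⟫

lemma hasDerivAt_comp_line {F : Type*} [NormedAddCommGroup F] [NormedSpace ℝ F] {g : E n → F}
    {g' : E n →L[ℝ] F} {y η : E n} {s : ℝ} (hg : HasFDerivAt g g' (y + s • η)) :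
    HasDerivAt (fun s : ℝ => g (y + s • η)) (g' η) s := by
  have hline : HasDerivAt (fun s : ℝ => y + s • η) η s := by
    simpa using ((hasDerivAt_id s).smul_const η).const_add y
  exact HasFDerivAt.comp_hasDerivAt (f := fun s : ℝ => y + s • η) s hg hline

lemma hasDerivAt_testFunction {u ρ : E n → ℝ} {k : ℝ → ℝ} {k₁ B : ℝ} {x₀ e ξ : E n}
    {Z : E n →L[ℝ] E n} {y η : E n} {s : ℝ} (hu : ContDiffAt ℝ 3 u (y + s • η))
    (hρ : ContDiff ℝ ∞ ρ) (hk : HasDerivAt k k₁ (-ρ (y + s • η))) :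
    HasDerivAt (fun s : ℝ => testFunction (gradient u) ρ k B x₀ e ξ Z (y + s • η))
      (⟪hessOp u (y + s • η) η, ξ + Z (y + s • η - x₀)⟫ + ⟪gradient u (y + s • η), Z η⟫
        - (⟪gradient u (y + s • η), hessOp u (y + s • η) η⟫
            - ⟪gradient u (y + s • η), e⟫ * ⟪hessOp u (y + s • η) η, e⟫)
        - k₁ * ⟪gradient ρ (y + s • η), η⟫ + 2 * B * ⟪y + s • η - x₀, η⟫) s := by
  have hG : HasDerivAt (fun s : ℝ => gradient u (y + s • η)) (hessOp u (y + s • η) η) s :=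
    hasDerivAt_comp_line ((ContDiffAt.gradient' (l := 2) hu (by norm_num)).differentiableAt
      (by norm_num)).hasFDerivAt
  have hx : HasDerivAt (fun s : ℝ => y + s • η - x₀) η s := by
    simpa using (((hasDerivAt_id s).smul_const η).const_add y).sub_const x₀
  have hZ : HasDerivAt (fun s : ℝ => ξ + Z (y + s • η - x₀)) (Z η) s :=
    (Z.hasFDerivAt.comp_hasDerivAt s hx).const_add ξ
  have hρ' : HasDerivAt (fun s : ℝ => -ρ (y + s • η)) (-⟪gradient ρ (y + s • η), η⟫) s := by
    rw [inner_gradient_left]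
    exact (hasDerivAt_comp_line (hρ.differentiable (by simp) _).hasFDerivAt).neg
  have hkρ : HasDerivAt (fun s : ℝ => k (-ρ (y + s • η))) (k₁ * -⟪gradient ρ (y + s • η), η⟫) s :=
    HasDerivAt.comp (h := fun s : ℝ => -ρ (y + s • η)) s hk hρ'
  have hall := (((hG.inner ℝ hZ).sub (((hG.inner ℝ hG).sub
    ((hG.inner ℝ (hasDerivAt_const s e)).pow 2)).const_mul (1 / 2))).add hkρ).add
    ((hx.inner ℝ hx).const_mul B)
  refine (hall.congr_deriv ?_).congr_of_eventuallyEq (Filter.Eventually.of_forall fun s => rfl)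
  rw [real_inner_comm η (y + s • η - x₀),
    real_inner_comm (hessOp u (y + s • η) η) (gradient u (y + s • η))]
  simp
  ring

/-- The terms are grouped so that the Hessian is paired with the single vector `T = ξ + Z(y - x₀) -
perp e (Du)`. This determines `D²u T` in terms of `Du`, `∇ρ` and `k'`, hence bounds it linearly in
`k'`. -/
lemma testFunction_first_order {u ρ : E n → ℝ} {k : ℝ → ℝ} {k₁ B : ℝ} {x₀ e ξ : E n}
    {Z : E n →L[ℝ] E n} {y : E n} (hu : ContDiffAt ℝ 3 u y) (hρ : ContDiff ℝ ∞ ρ)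
    (hk : HasDerivAt k k₁ (-ρ y))
    (hmin : IsLocalMin (testFunction (gradient u) ρ k B x₀ e ξ Z) y) (η : E n) :
    ⟪hessOp u y η, ξ + Z (y - x₀) - perp e (gradient u y)⟫ + ⟪gradient u y, Z η⟫
      = k₁ * ⟪gradient ρ y, η⟫ - 2 * B * ⟪y - x₀, η⟫ := by
  have h0 : y + (0 : ℝ) • η = y := by simp
  have h := hasDerivAt_testFunction (u := u) (ρ := ρ) (k := k) (k₁ := k₁) (B := B) (x₀ := x₀)
    (e := e) (ξ := ξ) (Z := Z) (y := y) (η := η) (s := 0) (by rwa [h0]) hρ (by rwa [h0])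
  have hline : ContinuousAt (fun s : ℝ => y + s • η) 0 := by fun_prop
  have hmin' : IsLocalMin (fun s : ℝ => testFunction (gradient u) ρ k B x₀ e ξ Z (y + s • η)) 0 := by
    have : Filter.Tendsto (fun s : ℝ => y + s • η) (𝓝 0) (𝓝 y) := by
      simpa [ContinuousAt] using hline
    have h2 := this.eventually hmin
    simpa [IsLocalMin, IsMinFilter] using h2
  have h3 := hmin'.hasDerivAt_eq_zero h
  simp only [h0] at h3
  rw [inner_sub_right, inner_perp_right, real_inner_comm (gradient u y) (hessOp u y η)]
  linarith

/-- The negative square comes from `-½ |perp e (Du)|²`; it is the source of the good quadratic term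
in the curvatures. The third derivative is paired with the same `T` as in the first-order condition.
-/
lemma testFunction_second_order {u ρ : E n → ℝ} {k k' : ℝ → ℝ} {k₂ B : ℝ} {x₀ e ξ : E n}
    {Z : E n →L[ℝ] E n} {y : E n} (hu : ContDiffAt ℝ 3 u y) (hρ : ContDiff ℝ ∞ ρ) (he : ‖e‖ = 1)
    (hk : ∀ᶠ t in 𝓝 (-ρ y), HasDerivAt k (k' t) t) (hk' : HasDerivAt k' k₂ (-ρ y))
    (hmin : IsLocalMin (testFunction (gradient u) ρ k B x₀ e ξ Z) y) (η : E n) :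
    0 ≤ ⟪thirdOp u y η η, ξ + Z (y - x₀) - perp e (gradient u y)⟫ + 2 * ⟪hessOp u y η, Z η⟫
      - ‖perp e (hessOp u y η)‖ ^ 2 + k₂ * ⟪gradient ρ y, η⟫ ^ 2
      - k' (-ρ y) * ⟪hessOp ρ y η, η⟫ + 2 * B * ‖η‖ ^ 2 := by
  have h0 : y + (0 : ℝ) • η = y := by simp
  have hline : Filter.Tendsto (fun s : ℝ => y + s • η) (𝓝 0) (𝓝 y) := by
    have : ContinuousAt (fun s : ℝ => y + s • η) 0 := by fun_prop
    simpa [ContinuousAt] using this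
  have hmin' : IsLocalMin (fun s : ℝ => testFunction (gradient u) ρ k B x₀ e ξ Z (y + s • η)) 0 := by
    have h2 := hline.eventually hmin
    simpa [IsLocalMin, IsMinFilter] using h2
  have hρline : Filter.Tendsto (fun s : ℝ => -ρ (y + s • η)) (𝓝 0) (𝓝 (-ρ y)) :=
    (hρ.continuous.neg.tendsto y).comp hline
  have hfirst : ∀ᶠ s : ℝ in 𝓝 0,
      HasDerivAt (fun s : ℝ => testFunction (gradient u) ρ k B x₀ e ξ Z (y + s • η))
      (⟪hessOp u (y + s • η) η, ξ + Z (y + s • η - x₀)⟫ + ⟪gradient u (y + s • η), Z η⟫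
        - (⟪gradient u (y + s • η), hessOp u (y + s • η) η⟫
            - ⟪gradient u (y + s • η), e⟫ * ⟪hessOp u (y + s • η) η, e⟫)
        - k' (-ρ (y + s • η)) * ⟪gradient ρ (y + s • η), η⟫ + 2 * B * ⟪y + s • η - x₀, η⟫) s := by
    filter_upwards [hρline.eventually hk, hline.eventually (hu.eventually (by simp))] with s h1 h2
    exact hasDerivAt_testFunction h2 hρ h1
  have hG : HasDerivAt (fun s : ℝ => gradient u (y + s • η)) (hessOp u y η) 0 :=
    hasDerivAt_comp_line (by
      rw [h0]
      exact ((ContDiffAt.gradient' (l := 2) hu (by norm_num)).differentiableAt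
        (by norm_num)).hasFDerivAt)
  have hH : HasDerivAt (fun s : ℝ => hessOp u (y + s • η) η) (thirdOp u y η η) 0 := by
    have h1 : HasDerivAt (fun s : ℝ => hessOp u (y + s • η)) (thirdOp u y η) 0 :=
      hasDerivAt_comp_line (by
        rw [h0]
        exact ((contDiffAt_hessOp hu).differentiableAt (by norm_num)).hasFDerivAt)
    simpa using h1.clm_apply (hasDerivAt_const 0 η)
  have hx : HasDerivAt (fun s : ℝ => y + s • η - x₀) η 0 := by
    simpa using (((hasDerivAt_id (0 : ℝ)).smul_const η).const_add y).sub_const x₀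
  have hZ : HasDerivAt (fun s : ℝ => ξ + Z (y + s • η - x₀)) (Z η) 0 :=
    (Z.hasFDerivAt.comp_hasDerivAt (0 : ℝ) hx).const_add ξ
  have hρ' : HasDerivAt (fun s : ℝ => -ρ (y + s • η)) (-⟪gradient ρ y, η⟫) 0 := by
    rw [inner_gradient_left]
    exact (hasDerivAt_comp_line (by
      rw [h0]; exact (hρ.differentiable (by simp) _).hasFDerivAt)).neg
  have hkρ : HasDerivAt (fun s : ℝ => k' (-ρ (y + s • η))) (k₂ * -⟪gradient ρ y, η⟫) 0 :=
    HasDerivAt.comp (h := fun s : ℝ => -ρ (y + s • η)) (0 : ℝ) (by rwa [h0]) hρ'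
  have hGρ : HasDerivAt (fun s : ℝ => gradient ρ (y + s • η)) (hessOp ρ y η) 0 :=
    hasDerivAt_comp_line (by
      rw [h0]
      exact ((ContDiffAt.gradient' (l := 1) hρ.contDiffAt
        (by norm_cast)).differentiableAt (by norm_num)).hasFDerivAt)
  have hc : ∀ v : E n, HasDerivAt (fun _ : ℝ => v) 0 0 := fun v => hasDerivAt_const 0 v
  have hsecond := ((((hH.inner ℝ hZ).add (hG.inner ℝ (hc (Z η)))).sub ((hG.inner ℝ hH).sub
    ((hG.inner ℝ (hc e)).mul (hH.inner ℝ (hc e))))).sub (hkρ.mul (hGρ.inner ℝ (hc η)))).add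
    ((hx.inner ℝ (hc η)).const_mul (2 * B))
  have h1 := IsLocalMin.second_deriv_nonneg hmin' hfirst hsecond
  refine h1.trans (le_of_eq ?_)
  simp only [h0, inner_zero_right]
  rw [inner_sub_right, inner_perp_right, norm_perp_sq he, real_inner_comm (thirdOp u y η η),
    ← real_inner_self_eq_norm_sq, ← real_inner_self_eq_norm_sq]
  ring

end TestFunction

end PConvex

namespace PConvex

open Finset Matrix
open scoped RealInnerProductSpace Topology

/-! ### Exclusion of interior minima -/

section NoInteriorMin

variable {n p : ℕ}

lemma areaFactor_le {q : E n} {K : ℝ} (hq : ‖q‖ ≤ |K|) : areaFactor q ≤ 1 + |K| := by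
  refine Real.sqrt_le_iff.2 ⟨by positivity, ?_⟩
  nlinarith [norm_nonneg q]

/-- Take for `r` the index whose dual frame vector has the smallest projection. By
`one_le_norm_perp_metricRoot` every other squared projection is at least one half. -/
lemma IsCurvatureFrame.exists_perp_lower_bound {m L : ℝ} {q : E n} {H : E n →L[ℝ] E n}
    {Q : Fin n → E n} {κ : Fin n → ℝ} (h : IsCurvatureFrame p m L q H Q κ) (hn : 0 < n) {e : E n}
    (he : ‖e‖ = 1) :
    ∃ r, ∀ i, i ≠ r →
      1 / 2 * (areaFactor q * κ i) ^ 2 ≤ ‖perp e (H (metricRootInv q (Q i)))‖ ^ 2 := by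
  have : Nonempty (Fin n) := ⟨⟨0, hn⟩⟩
  obtain ⟨r, hr⟩ := Finite.exists_min fun i => ‖perp e (metricRoot q (Q i))‖ ^ 2
  refine ⟨r, fun i hi => ?_⟩
  have h1 := one_le_norm_perp_metricRoot he q (h.orthonormal.1 i) (h.orthonormal.1 r)
    (h.orthonormal.2 hi)
  have h2 := hr i
  have h3 : perp e (H (metricRootInv q (Q i)))
      = (areaFactor q * κ i) • perp e (metricRoot q (Q i)) := by
    rw [h.apply, perp, perp, inner_smul_left, smul_sub, smul_smul]
    simp
  rw [h3, norm_smul, mul_pow ‖areaFactor q * κ i‖, Real.norm_eq_abs, sq_abs]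
  nlinarith [sq_nonneg (areaFactor q * κ i)]

/-- The second-order conditions at a minimum, weighted with the linearized operator. -/
lemma linearized_second_order_sum_le {m L C₀ K θ k k₂ B a d ζ : ℝ} {q G y T : E n}
    {H Z : E n →L[ℝ] E n} {D : E n →L[ℝ] E n} {Hρ : E n →L[ℝ] E n} {Q : Fin n → E n}
    {κ : Fin n → ℝ} {e : E n}
    (hframe : IsCurvatureFrame p m L q H Q κ) (hn : 0 < n) (he : ‖e‖ = 1)
    (hsymm : ∀ x y, ⟪H x, y⟫ = ⟪x, H y⟫) (hK : ‖q‖ ≤ |K|) (hk : 0 ≤ k) (hk₂ : 0 ≤ k₂)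
    (hθ : 0 ≤ θ) (hB : 0 ≤ B) (hZ : ∀ v z, ⟪Z v, z⟫ = -⟪v, Z z⟫) (hHρ : ∀ η, θ * ‖η‖ ^ 2 ≤ ⟪Hρ η, η⟫)
    (hy : ‖y‖ ≤ d)
    (hlin : |∑ i, logSumDeriv p κ i * (⟪D (metricRootInv q (Q i)), metricRootInv q (Q i)⟫
              / areaFactor q
            - 2 * κ i * (⟪q, metricRootInv q (Q i)⟫ * ⟪H T, metricRootInv q (Q i)⟫)
            - κ i * ⟪q, H T⟫ / areaFactor q ^ 2)| ≤ C₀)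
    (hT : ‖H T‖ ≤ a) (hζ : (subsetsOfCard n p).card * (|K| * a) ≤ ζ)
    (hfirst : ∀ η, ⟪H η, T⟫ + ⟪q, Z η⟫ = k * ⟪G, η⟫ - 2 * B * ⟪y, η⟫)
    (hsecond : ∀ η, 0 ≤ ⟪D η, η⟫ + 2 * ⟪H η, Z η⟫ - ‖perp e (H η)‖ ^ 2 - k₂ * ⟪G, η⟫ ^ 2
      - k * ⟪Hρ η, η⟫ + 2 * B * ‖η‖ ^ 2) :
    ∃ r, 0 ≤ C₀ + ζ
      + 2 * |K| * (∑ i, logSumDeriv p κ i * |κ i| * (k * |⟪metricRootInv q (Q i), G⟫| + 2 * B * d))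
      - 1 / 2 * (∑ i ∈ univ.erase r, logSumDeriv p κ i * κ i ^ 2)
      - θ / (1 + |K|) ^ 3 * k * (∑ i, logSumDeriv p κ i)
      - k₂ / (1 + |K|) * (∑ i, logSumDeriv p κ i * |⟪metricRootInv q (Q i), G⟫| ^ 2)
      + 2 * B * (∑ i, logSumDeriv p κ i) := by
  obtain ⟨r, hr⟩ := hframe.exists_perp_lower_bound hn he
  refine ⟨r, ?_⟩
  set W := areaFactor q with hW
  have hW1 : 1 ≤ W := one_le_areaFactor q
  have hWpos : 0 < W := areaFactor_pos q
  have hWK : W ≤ 1 + |K| := areaFactor_le hK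
  have hf := logSumDeriv_nonneg hframe.pos
  set τ : Fin n → E n := fun i => metricRootInv q (Q i) with hτ
  have hτle : ∀ i, ‖τ i‖ ≤ 1 := fun i => (norm_metricRootInv_le q _).trans (hframe.orthonormal.1 i).le
  have hτge : ∀ i, 1 / W ^ 2 ≤ ‖τ i‖ ^ 2 := fun i => by
    have := div_le_norm_metricRootInv_sq q (Q i)
    rwa [hframe.orthonormal.1 i, one_pow] at this
  have hZz : ∀ v, ⟪v, Z v⟫ = 0 := fun v => by
    have := hZ v v
    rw [real_inner_comm] at this
    linarith
  -- `H τᵢ` is a multiple of `τᵢ + ⟨q, τᵢ⟩ q`, and skewness of `Z` removes the `τᵢ` part.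
  have hHZ : ∀ i, ⟪H (τ i), Z (τ i)⟫ = -(W * κ i * (⟪q, τ i⟫ * ⟪Z q, τ i⟫)) := by
    intro i
    rw [hframe.apply, ← metricRootInv_metric, inner_smul_left, inner_add_left, inner_smul_left,
      hZz, hZ]
    simp
    rfl
  have hV : ∀ η, ⟪H T, η⟫ - ⟪Z q, η⟫ = k * ⟪G, η⟫ - 2 * B * ⟪y, η⟫ := by
    intro η
    rw [← hfirst, hsymm η T, real_inner_comm, hZ]
    ring
  have hqτ : ∀ i, |⟪q, τ i⟫| ≤ |K| := fun i => by
    refine (abs_real_inner_le_norm _ _).trans ?_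
    calc ‖q‖ * ‖τ i‖ ≤ |K| * 1 := mul_le_mul hK (hτle i) (norm_nonneg _) (abs_nonneg _)
      _ = |K| := mul_one _
  have hVτ : ∀ i, |⟪H T, τ i⟫ - ⟪Z q, τ i⟫| ≤ k * |⟪τ i, G⟫| + 2 * B * d := by
    intro i
    rw [hV, real_inner_comm (τ i) G]
    refine (abs_sub _ _).trans ?_
    rw [abs_mul, abs_mul, abs_of_nonneg hk, abs_of_nonneg (by positivity : 0 ≤ 2 * B)]
    gcongr
    refine (abs_real_inner_le_norm _ _).trans ?_
    calc ‖y‖ * ‖τ i‖ ≤ d * 1 :=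
          mul_le_mul hy (hτle i) (norm_nonneg _) ((norm_nonneg _).trans hy)
      _ = d := mul_one _
  set P : Fin n → ℝ := fun i => if i = r then 0 else κ i ^ 2 with hP
  have hpoint : ∀ i, 0 ≤ (⟪D (τ i), τ i⟫ / W - 2 * κ i * (⟪q, τ i⟫ * ⟪H T, τ i⟫)
        - κ i * ⟪q, H T⟫ / W ^ 2) + κ i * (⟪q, H T⟫ / W ^ 2)
      + 2 * |K| * (|κ i| * (k * |⟪τ i, G⟫| + 2 * B * d)) - 1 / 2 * P i
      - θ / (1 + |K|) ^ 3 * k - k₂ / (1 + |K|) * |⟪τ i, G⟫| ^ 2 + 2 * B := by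
    intro i
    have h0 := div_nonneg (hsecond (τ i)) hWpos.le
    have e0 : (⟪D (τ i), τ i⟫ + 2 * ⟪H (τ i), Z (τ i)⟫ - ‖perp e (H (τ i))‖ ^ 2
        - k₂ * ⟪G, τ i⟫ ^ 2 - k * ⟪Hρ (τ i), τ i⟫ + 2 * B * ‖τ i‖ ^ 2) / W
        = ⟪D (τ i), τ i⟫ / W - 2 * κ i * (⟪q, τ i⟫ * ⟪Z q, τ i⟫) - ‖perp e (H (τ i))‖ ^ 2 / W
          - k₂ * ⟪G, τ i⟫ ^ 2 / W - k * ⟪Hρ (τ i), τ i⟫ / W + 2 * B * ‖τ i‖ ^ 2 / W := by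
      rw [hHZ]; field_simp; ring
    rw [e0] at h0
    -- The gradient term of the differentiated equation and the rotation term combine into `H T - Z
    -- q`, which the first-order condition identifies with `k G - 2 B y`.
    have e1 : 2 * κ i * (⟪q, τ i⟫ * ⟪H T, τ i⟫) - 2 * κ i * (⟪q, τ i⟫ * ⟪Z q, τ i⟫)
        ≤ 2 * |K| * (|κ i| * (k * |⟪τ i, G⟫| + 2 * B * d)) := by
      calc 2 * κ i * (⟪q, τ i⟫ * ⟪H T, τ i⟫) - 2 * κ i * (⟪q, τ i⟫ * ⟪Z q, τ i⟫)
          = 2 * (⟪q, τ i⟫ * (κ i * (⟪H T, τ i⟫ - ⟪Z q, τ i⟫))) := by ring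
        _ ≤ 2 * |⟪q, τ i⟫ * (κ i * (⟪H T, τ i⟫ - ⟪Z q, τ i⟫))| := by
          gcongr; exact le_abs_self _
        _ = 2 * (|⟪q, τ i⟫| * (|κ i| * |⟪H T, τ i⟫ - ⟪Z q, τ i⟫|)) := by
          rw [abs_mul, abs_mul]
        _ ≤ 2 * (|K| * (|κ i| * (k * |⟪τ i, G⟫| + 2 * B * d))) := by
          refine mul_le_mul_of_nonneg_left ?_ zero_le_two
          exact mul_le_mul (hqτ i) (mul_le_mul_of_nonneg_left (hVτ i) (abs_nonneg _))
            (by positivity) (abs_nonneg _)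
        _ = _ := by ring
    have e2 : 1 / 2 * P i ≤ ‖perp e (H (τ i))‖ ^ 2 / W := by
      rw [le_div_iff₀ hWpos]
      by_cases hi : i = r
      · simp only [hP, hi, if_true]; simp
      · simp only [hP, if_neg hi]
        refine le_trans ?_ (hr i hi)
        rw [mul_pow]
        have : 0 ≤ κ i ^ 2 * (W * (W - 1)) := by
          have : 0 ≤ W - 1 := by linarith
          positivity
        nlinarith
    have e3 : θ / (1 + |K|) ^ 3 * k ≤ k * ⟪Hρ (τ i), τ i⟫ / W := by
      have h1 : θ * (1 / W ^ 2) ≤ ⟪Hρ (τ i), τ i⟫ :=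
        (mul_le_mul_of_nonneg_left (hτge i) hθ).trans (hHρ _)
      calc θ / (1 + |K|) ^ 3 * k ≤ θ / W ^ 3 * k := by gcongr
        _ = k * (θ * (1 / W ^ 2)) / W := by field_simp
        _ ≤ _ := by gcongr
    have e4 : k₂ / (1 + |K|) * |⟪τ i, G⟫| ^ 2 ≤ k₂ * ⟪G, τ i⟫ ^ 2 / W := by
      rw [sq_abs, real_inner_comm G (τ i)]
      calc k₂ / (1 + |K|) * ⟪G, τ i⟫ ^ 2 ≤ k₂ / W * ⟪G, τ i⟫ ^ 2 := by gcongr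
        _ = _ := by ring
    have e5 : 2 * B * ‖τ i‖ ^ 2 / W ≤ 2 * B := by
      rw [div_le_iff₀ hWpos]
      have h1 : ‖τ i‖ ^ 2 ≤ 1 := pow_le_one₀ (norm_nonneg _) (hτle i)
      nlinarith
    have e6 : κ i * ⟪q, H T⟫ / W ^ 2 = κ i * (⟪q, H T⟫ / W ^ 2) := mul_div_assoc _ _ _
    linarith
  have hsum : 0 ≤ ∑ i, logSumDeriv p κ i * ((⟪D (τ i), τ i⟫ / W
        - 2 * κ i * (⟪q, τ i⟫ * ⟪H T, τ i⟫) - κ i * ⟪q, H T⟫ / W ^ 2) + κ i * (⟪q, H T⟫ / W ^ 2)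
      + 2 * |K| * (|κ i| * (k * |⟪τ i, G⟫| + 2 * B * d)) - 1 / 2 * P i
      - θ / (1 + |K|) ^ 3 * k - k₂ / (1 + |K|) * |⟪τ i, G⟫| ^ 2 + 2 * B) :=
    sum_nonneg fun i _ => mul_nonneg (hf i) (hpoint i)
  have hsplit : ∑ i, logSumDeriv p κ i * ((⟪D (τ i), τ i⟫ / W
        - 2 * κ i * (⟪q, τ i⟫ * ⟪H T, τ i⟫) - κ i * ⟪q, H T⟫ / W ^ 2) + κ i * (⟪q, H T⟫ / W ^ 2)
      + 2 * |K| * (|κ i| * (k * |⟪τ i, G⟫| + 2 * B * d)) - 1 / 2 * P i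
      - θ / (1 + |K|) ^ 3 * k - k₂ / (1 + |K|) * |⟪τ i, G⟫| ^ 2 + 2 * B)
      = ∑ i, logSumDeriv p κ i * (⟪D (τ i), τ i⟫ / W
        - 2 * κ i * (⟪q, τ i⟫ * ⟪H T, τ i⟫) - κ i * ⟪q, H T⟫ / W ^ 2)
        + (∑ i, logSumDeriv p κ i * κ i) * (⟪q, H T⟫ / W ^ 2)
        + 2 * |K| * (∑ i, logSumDeriv p κ i * |κ i| * (k * |⟪τ i, G⟫| + 2 * B * d))
        - 1 / 2 * (∑ i, logSumDeriv p κ i * P i)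
        - θ / (1 + |K|) ^ 3 * k * (∑ i, logSumDeriv p κ i)
        - k₂ / (1 + |K|) * (∑ i, logSumDeriv p κ i * |⟪τ i, G⟫| ^ 2)
        + 2 * B * (∑ i, logSumDeriv p κ i) := by
    simp only [mul_sum, sum_mul, ← sum_add_distrib, ← sum_sub_distrib]
    exact sum_congr rfl fun i _ => by ring
  have hPsum : ∑ i, logSumDeriv p κ i * P i
      = ∑ i ∈ univ.erase r, logSumDeriv p κ i * κ i ^ 2 := by
    rw [← add_sum_erase univ _ (mem_univ r)]
    simp only [hP, if_true, mul_zero, zero_add]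
    exact sum_congr rfl fun i hi => by rw [if_neg (ne_of_mem_erase hi)]
  -- Homogeneity makes `∑ fᵢ κᵢ` equal to the number of p-subsets, so this term does not depend on
  -- the size of the curvatures.
  have hdrift : (∑ i, logSumDeriv p κ i * κ i) * (⟪q, H T⟫ / W ^ 2) ≤ ζ := by
    rw [sum_logSumDeriv_mul_self hframe.pos]
    refine le_trans (mul_le_mul_of_nonneg_left ?_ (Nat.cast_nonneg _)) hζ
    have ha : 0 ≤ a := (norm_nonneg _).trans hT
    rw [div_le_iff₀ (by positivity)]
    calc ⟪q, H T⟫ ≤ ‖q‖ * ‖H T‖ := real_inner_le_norm _ _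
      _ ≤ |K| * a := by gcongr
      _ ≤ |K| * a * W ^ 2 := le_mul_of_one_le_right (by positivity) (one_le_pow₀ hW1)
  rw [hsplit, hPsum] at hsum
  have := (abs_le.1 hlin).2
  linarith

lemma barrier_coefficient_bounds {C₀ t₀ a₀ N K B D k : ℝ} (hC₀ : 0 ≤ C₀) (ht : 0 ≤ t₀)
    (ha : 0 ≤ a₀) (hN : 0 ≤ N) (hB : 0 ≤ B) (hD : 0 ≤ D) (hk : 0 ≤ k) :
    C₀ * (t₀ + a₀ * (1 + k)) + N * (|K| * (a₀ * (1 + k)))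
        ≤ (C₀ * (t₀ + a₀) + N * (|K| * a₀) + 2 * |K| + 4 * |K| * B * D + 2 * B + 1) * (1 + k) ∧
      2 * |K| ≤ C₀ * (t₀ + a₀) + N * (|K| * a₀) + 2 * |K| + 4 * |K| * B * D + 2 * B + 1 ∧
      4 * |K| * B * D ≤ C₀ * (t₀ + a₀) + N * (|K| * a₀) + 2 * |K| + 4 * |K| * B * D + 2 * B + 1 ∧
      2 * B ≤ C₀ * (t₀ + a₀) + N * (|K| * a₀) + 2 * |K| + 4 * |K| * B * D + 2 * B + 1 := by
  have h1 : 0 ≤ C₀ * (t₀ + a₀) := by positivity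
  have h2 : 0 ≤ N * (|K| * a₀) := by positivity
  have h3 : 0 ≤ 4 * |K| * B * D := by positivity
  have h4 := abs_nonneg K
  refine ⟨?_, by linarith, by linarith, by linarith⟩
  have d1 : C₀ * t₀ ≤ C₀ * t₀ * (1 + k) := le_mul_of_one_le_right (by positivity) (by linarith)
  have d2 : 0 ≤ (2 * |K| + 4 * |K| * B * D + 2 * B + 1) * (1 + k) := by positivity
  linarith

/-- `C₃` and `k₀` depend only on the data, so the barrier can be built from them afterwards. The
contradiction is between `linearized_second_order_sum_le` and `exists_barrier_constants`. -/
lemma exists_no_interior_min (n p : ℕ) (hp : 1 ≤ p) (hpn : p ≤ n) {K L m θ c R D A B : ℝ}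
    (hm : 0 < m) (hθ : 0 < θ) (hc : 0 < c) (hR : 0 ≤ R) (hD : 0 ≤ D) (hA : 0 ≤ A) (hB : 0 ≤ B) :
    ∃ C₃ : ℝ, 0 < C₃ ∧ ∃ k₀ : ℝ, 1 ≤ k₀ ∧ ∀ (Ω : Set (E n)), IsOpen Ω →
      ∀ (f : E n → ℝ → E (n + 1) → ℝ) (u : E n → ℝ), IsControlledSolution p Ω K L m f u →
      ∀ (ρ : E n → ℝ), ContDiff ℝ ∞ ρ → ∀ (k k' : ℝ → ℝ) (x₀ e ξ : E n) (Z : E n →L[ℝ] E n),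
      ∀ y ∈ Ω, ‖e‖ = 1 → ‖ξ‖ ≤ A → (∀ v, ‖Z v‖ ≤ A * ‖v‖) → (∀ v z, ⟪Z v, z⟫ = -⟪v, Z z⟫) →
      ‖y - x₀‖ ≤ D → (∀ η, θ * ‖η‖ ^ 2 ≤ ⟪hessOp ρ y η, η⟫) →
      c ≤ ‖gradient ρ y‖ → ‖gradient ρ y‖ ≤ R → k₀ ≤ k' (-ρ y) →
      (∀ᶠ t in 𝓝 (-ρ y), HasDerivAt k (k' t) t) →
      HasDerivAt k' (-(C₃ * k' (-ρ y) ^ 2)) (-ρ y) →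
      ¬ IsLocalMin (testFunction (gradient u) ρ k B x₀ e ξ Z) y := by
  obtain ⟨C₀, hC₀, hlin⟩ := exists_frame_linearized n p (K := K) (L := L) (m := m) hm
  set N : ℝ := ((subsetsOfCard n p).card : ℝ) with hN
  have hN0 : 0 ≤ N := Nat.cast_nonneg _
  set W : ℝ := 1 + |K| with hW
  have hW1 : 1 ≤ W := by rw [hW]; linarith [abs_nonneg K]
  -- `a₀ (1 + k')` will bound `|D²u T|`, and `t₀` will bound `|T|`.
  set a₀ : ℝ := R + 2 * B * D + A * |K| with ha₀
  have ha₀0 : 0 ≤ a₀ := by positivity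
  set t₀ : ℝ := A + A * D + |K| with ht₀
  have ht₀0 : 0 ≤ t₀ := by positivity
  set C : ℝ := C₀ * (t₀ + a₀) + N * (|K| * a₀) + 2 * |K| + 4 * |K| * B * D + 2 * B + 1 with hC
  have hCpos : 0 < C := by positivity
  obtain ⟨C₃, hC₃, k₀, hk₀, hbar⟩ := exists_barrier_constants n p hp hpn (L := |L| + 1) (C := C)
    (W := W) (θ := θ / W ^ 3) (R := R) (c := c ^ 2 / W ^ 2) (by positivity) hCpos hW1
    (by positivity) hR (by positivity)
  refine ⟨C₃, hC₃, k₀, hk₀, ?_⟩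
  intro Ω hΩ f u h ρ hρ k k' x₀ e ξ Z y hy he hξ hZA hZ hyD hHρ hcρ hρR hk hkd hkd' hmin
  obtain ⟨Q, κ, hframe, hlin⟩ := hlin Ω hΩ f u h y hy
  have hu := h.contDiffAt hΩ hy
  have hK : ‖gradient u y‖ ≤ |K| := (h.bound y hy).2.trans (le_abs_self K)
  have hsymm := hessOp_symm (hu.of_le (show (2 : WithTop ℕ∞) ≤ 3 by norm_num))
  set T := ξ + Z (y - x₀) - perp e (gradient u y) with hT
  set q := gradient u y with hq
  set k₁ := k' (-ρ y) with hk₁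
  have hk1 : 1 ≤ k₁ := hk₀.trans hk
  have hfirst := testFunction_first_order hu hρ hkd.self_of_nhds hmin
  have hTnorm : ‖T‖ ≤ t₀ := by
    refine (norm_sub_le _ _).trans ?_
    refine add_le_add ((norm_add_le _ _).trans (add_le_add hξ ?_)) ((norm_perp_le he _).trans hK)
    exact (hZA _).trans (mul_le_mul_of_nonneg_left hyD hA)
  have hHT : hessOp u y T = k₁ • gradient ρ y - (2 * B) • (y - x₀) + Z q := by
    refine ext_inner_right ℝ fun η => ?_
    have h1 := hfirst η
    rw [hsymm, real_inner_comm] at h1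
    have h2 := hZ q η
    rw [inner_add_left, inner_sub_left, inner_smul_left, inner_smul_left]
    simp only [conj_trivial]
    linarith
  have hHTnorm : ‖hessOp u y T‖ ≤ a₀ * (1 + k₁) := by
    have e1 : ‖hessOp u y T‖ ≤ k₁ * R + 2 * B * D + A * |K| := by
      rw [hHT]
      refine (norm_add_le _ _).trans (add_le_add ((norm_sub_le _ _).trans (add_le_add ?_ ?_)) ?_)
      · rw [norm_smul, Real.norm_of_nonneg (by linarith)]
        exact mul_le_mul_of_nonneg_left hρR (by linarith)
      · rw [norm_smul, Real.norm_of_nonneg (by positivity)]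
        exact mul_le_mul_of_nonneg_left hyD (by positivity)
      · exact (hZA _).trans (mul_le_mul_of_nonneg_left hK hA)
    refine e1.trans ?_
    have e2 : 0 ≤ (2 * B * D + A * |K|) * k₁ := by positivity
    rw [ha₀]
    nlinarith
  -- Symmetry of the third derivative brings in the derivative of the Hessian along `T`, and `k'' =
  -- -C₃ k'²` is inserted.
  have hsecond : ∀ η, 0 ≤ ⟪thirdOp u y T η, η⟫ + 2 * ⟪hessOp u y η, Z η⟫
      - ‖perp e (hessOp u y η)‖ ^ 2 - C₃ * k₁ ^ 2 * ⟪gradient ρ y, η⟫ ^ 2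
      - k₁ * ⟪hessOp ρ y η, η⟫ + 2 * B * ‖η‖ ^ 2 := by
    intro η
    have h1 := testFunction_second_order hu hρ he hkd hkd' hmin η
    rw [thirdOp_symm hu] at h1
    linarith
  obtain ⟨r, hr⟩ := linearized_second_order_sum_le (C₀ := C₀ * (t₀ + a₀ * (1 + k₁)))
    (ζ := N * (|K| * (a₀ * (1 + k₁)))) (d := D) hframe (by omega) he hsymm hK
    (by linarith) (by positivity) hθ.le hB hZ hHρ hyD
    ((hlin T).trans (mul_le_mul_of_nonneg_left (add_le_add hTnorm hHTnorm) hC₀.le))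
    hHTnorm le_rfl hfirst hsecond
  have hX : ∀ i, 0 ≤ |⟪metricRootInv q (Q i), gradient ρ y⟫| ∧
      |⟪metricRootInv q (Q i), gradient ρ y⟫| ≤ R := by
    refine fun i => ⟨abs_nonneg _, (abs_real_inner_le_norm _ _).trans ?_⟩
    calc _ ≤ 1 * R := mul_le_mul ((norm_metricRootInv_le q _).trans (hframe.orthonormal.1 i).le)
          hρR (norm_nonneg _) zero_le_one
      _ = R := one_mul R
  -- The squared pairings with the frame sum to `|g^{-1/2} ∇ρ|²`, which inherits a lower bound from
  -- that of `|∇ρ|`.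
  have hXc : c ^ 2 / W ^ 2 ≤ ∑ i, |⟪metricRootInv q (Q i), gradient ρ y⟫| ^ 2 := by
    simp only [sq_abs]
    rw [sum_inner_metricRootInv_sq hframe.orthonormal]
    refine le_trans ?_ (div_le_norm_metricRootInv_sq q _)
    have := areaFactor_pos q
    have := areaFactor_le hK
    gcongr
  have hneg := hbar κ (fun i => |⟪metricRootInv q (Q i), gradient ρ y⟫|) r k₁ hk hframe.pos
    (hframe.prod_le.trans (by linarith [le_abs_self L])) hX hXc
  have hf := logSumDeriv_nonneg hframe.pos
  have hF : 0 ≤ ∑ i, logSumDeriv p κ i := sum_nonneg fun i _ => hf i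
  obtain ⟨c1, c21, c22, c31⟩ := barrier_coefficient_bounds (K := K) (k := k₁) hC₀.le ht₀0 ha₀0 hN0
    hB hD (by linarith)
  rw [← hC] at c1 c21 c22 c31
  have c2 : 2 * |K| * (∑ i, logSumDeriv p κ i * |κ i|
        * (k₁ * |⟪metricRootInv q (Q i), gradient ρ y⟫| + 2 * B * D))
      ≤ C * (∑ i, logSumDeriv p κ i * |κ i|
        * (k₁ * |⟪metricRootInv q (Q i), gradient ρ y⟫| + 1)) := by
    rw [mul_sum, mul_sum]
    refine sum_le_sum fun i _ => ?_
    have d0 : 0 ≤ logSumDeriv p κ i * |κ i| := mul_nonneg (hf i) (abs_nonneg _)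
    have d1 : 0 ≤ k₁ * |⟪metricRootInv q (Q i), gradient ρ y⟫| := by positivity
    have d4 : 2 * |K| * (k₁ * |⟪metricRootInv q (Q i), gradient ρ y⟫| + 2 * B * D)
        ≤ C * (k₁ * |⟪metricRootInv q (Q i), gradient ρ y⟫| + 1) := by
      have := mul_le_mul_of_nonneg_right c21 d1
      linarith
    have := mul_le_mul_of_nonneg_left d4 d0
    linarith
  have c3 : 2 * B * (∑ i, logSumDeriv p κ i) ≤ C * (∑ i, logSumDeriv p κ i) := 
    mul_le_mul_of_nonneg_right c31 hF
  have c4 : C₃ * k₁ ^ 2 / W * (∑ i, logSumDeriv p κ i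
        * |⟪metricRootInv q (Q i), gradient ρ y⟫| ^ 2)
      = C₃ / W * k₁ ^ 2 * (∑ i, logSumDeriv p κ i
        * |⟪metricRootInv q (Q i), gradient ρ y⟫| ^ 2) := by ring
  rw [← hW, c4] at hr
  linarith

end NoInteriorMin

end PConvex

namespace PConvex

open Finset Matrix
open scoped RealInnerProductSpace Topology

/-! ### Signs of one-sided directional derivatives -/

section DirectionalSigns

variable {n : ℕ}

lemma tendsto_slope_line {g : E n → ℝ} {y : E n} (hg : DifferentiableAt ℝ g y) (hy : g y = 0)
    (d : E n) :
    Filter.Tendsto (fun s : ℝ => s⁻¹ * g (y + s • d)) (𝓝[>] 0) (𝓝 (fderiv ℝ g y d)) := by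
  have h : HasDerivAt (fun s : ℝ => g (y + s • d)) (fderiv ℝ g y d) 0 :=
    hasDerivAt_comp_line (by simpa using hg.hasFDerivAt)
  simpa [hy] using h.tendsto_slope_zero_right

lemma eventually_neg_of_fderiv_neg {g : E n → ℝ} {y d : E n} (hg : DifferentiableAt ℝ g y)
    (hy : g y = 0) (hd : fderiv ℝ g y d < 0) : ∀ᶠ s : ℝ in 𝓝[>] 0, g (y + s • d) < 0 := by
  filter_upwards [(tendsto_slope_line hg hy d).eventually (gt_mem_nhds hd),
    self_mem_nhdsWithin] with s h1 h2
  have h3 : 0 < s := h2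
  by_contra! h4
  have : 0 ≤ s⁻¹ * g (y + s • d) := by positivity
  linarith

lemma fderiv_nonpos_of_eventually {g : E n → ℝ} {y d : E n} (hg : DifferentiableAt ℝ g y)
    (hy : g y = 0) (hd : ∀ᶠ s : ℝ in 𝓝[>] 0, g (y + s • d) ≤ 0) : fderiv ℝ g y d ≤ 0 := by
  refine le_of_tendsto (tendsto_slope_line hg hy d) ?_
  filter_upwards [hd, self_mem_nhdsWithin] with s h1 h2
  have h3 : 0 < s := h2
  have := inv_pos.2 h3
  nlinarith

lemma tendsto_line (y d : E n) :
    Filter.Tendsto (fun s : ℝ => y + s • d) (𝓝[>] 0) (𝓝 y) := by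
  have : ContinuousAt (fun s : ℝ => y + s • d) 0 := by fun_prop
  have h : Filter.Tendsto (fun s : ℝ => y + s • d) (𝓝 0) (𝓝 y) := by
    simpa [ContinuousAt] using this
  exact h.mono_left nhdsWithin_le_nhds

end DirectionalSigns

/-! ### Gluing local defining functions -/

section GlobalDefiningFunction

variable {n : ℕ} {Ω : Set (E n)}

lemma eq_zero_of_mem_frontier {g : E n → ℝ} {y : E n} (hg : ContinuousAt g y)
    (hy : y ∈ frontier Ω) (hΩ : IsOpen Ω) (h : ∀ᶠ z in 𝓝 y, (z ∈ Ω ↔ g z < 0)) : g y = 0 := by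
  have hyΩ : y ∉ Ω := by
    rw [hΩ.frontier_eq] at hy; exact hy.2
  apply le_antisymm
  · have h1 : ∃ᶠ z in 𝓝 y, z ∈ Ω := mem_closure_iff_frequently.1 (frontier_subset_closure hy)
    by_contra! h2
    obtain ⟨z, hz1, hz2, hz3⟩ := (h1.and_eventually (h.and (hg.eventually (lt_mem_nhds h2)))).exists
    linarith [hz2.1 hz1]
  · by_contra! h2
    exact hyΩ (h.self_of_nhds.2 h2)

lemma exists_local_pair (hΩ : IsStrictlyConvexDomain Ω) (x : E n) (hx : x ∈ closure Ω) :
    ∃ (g : E n → ℝ) (r : ℝ), 0 < r ∧ ContDiff ℝ ∞ g ∧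
      (∀ y ∈ Metric.ball x r, (y ∈ Ω ↔ g y < 0)) ∧
      ∀ y ∈ Metric.ball x r, y ∈ frontier Ω → gradient g y ≠ 0 := by
  by_cases hxΩ : x ∈ Ω
  · obtain ⟨r, hr, hball⟩ := Metric.isOpen_iff.1 hΩ.isOpen x hxΩ
    refine ⟨fun _ => -1, r, hr, contDiff_const, fun y hy => ?_, fun y hy hfr => ?_⟩
    · simpa using hball hy
    · rw [hΩ.isOpen.frontier_eq] at hfr
      exact absurd (hball hy) hfr.2
  · have hfr : x ∈ frontier Ω := by rw [hΩ.isOpen.frontier_eq]; exact ⟨hx, hxΩ⟩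
    obtain ⟨g, hg, hgx, hev⟩ := hΩ.smooth_boundary x hfr
    have hcont : Continuous (gradient g) := by
      unfold gradient
      exact (InnerProductSpace.toDual ℝ (E n)).symm.continuous.comp
        (hg.continuous_fderiv (by simp))
    obtain ⟨r, hr, hball⟩ := Metric.eventually_nhds_iff_ball.1
      (hev.and (hcont.continuousAt.eventually_ne hgx))
    exact ⟨g, r, hr, hg, fun y hy => (hball y hy).1, fun y hy _ => (hball y hy).2⟩

/-- A domain with smooth boundary has a global smooth defining function. -/
lemma exists_global_definingFunction (hΩ : IsStrictlyConvexDomain Ω) :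
    ∃ ρ : E n → ℝ, ContDiff ℝ ∞ ρ ∧ (∀ x, x ∈ Ω ↔ ρ x < 0) ∧
      ∀ x ∈ frontier Ω, ρ x = 0 ∧ gradient ρ x ≠ 0 := by
  have hcomp : IsCompact (closure Ω) := hΩ.isBounded.isCompact_closure
  choose! g r hr hg hiff hgrad using exists_local_pair hΩ
  obtain ⟨t, htΩ, hcover⟩ := hcomp.elim_nhds_subcover (fun x => Metric.ball x (r x))
    fun x hx => Metric.ball_mem_nhds x (hr x hx)
  have hbump : ∀ x : E n, ∃ b : E n → ℝ, ContDiff ℝ ∞ b ∧ (∀ y, 0 ≤ b y) ∧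
      ∀ y, (x ∈ closure Ω → (0 < b y ↔ y ∈ Metric.ball x (r x))) := by
    intro x
    by_cases hx : x ∈ closure Ω
    · let b : ContDiffBump x := ⟨r x / 2, r x, half_pos (hr x hx), half_lt_self (hr x hx)⟩
      refine ⟨b, b.contDiff, fun y => b.nonneg, fun y _ => ?_⟩
      rw [← b.support_eq, Function.mem_support, b.nonneg.lt_iff_ne']
    · exact ⟨fun _ => 0, contDiff_const, fun _ => le_rfl, fun _ h => absurd h hx⟩
  choose b hb hb0 hbpos using hbump
  have hzero : ∀ i ∈ t, ∀ y, y ∉ Metric.ball i (r i) → b i y = 0 := fun i hi y hy =>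
    le_antisymm (not_lt.1 fun h => hy ((hbpos i y (htΩ i hi)).1 h)) (hb0 i y)
  have hsmooth : ContDiff ℝ ∞ fun x => ∑ i ∈ t, b i x * g i x :=
    ContDiff.sum fun i hi => (hb i).mul (hg i (htΩ i hi))
  have hfrzero : ∀ y ∈ frontier Ω, ∀ i ∈ t, y ∈ Metric.ball i (r i) → g i y = 0 := by
    intro y hy i hi hyi
    refine eq_zero_of_mem_frontier (hg i (htΩ i hi)).continuous.continuousAt hy hΩ.isOpen ?_
    filter_upwards [Metric.isOpen_ball.mem_nhds hyi] with z hz using hiff i (htΩ i hi) z hz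
  refine ⟨fun x => ∑ i ∈ t, b i x * g i x, hsmooth, fun x => ⟨fun hx => ?_, fun hx => ?_⟩,
    fun x hx => ⟨?_, ?_⟩⟩
  · have hle : ∀ i ∈ t, b i x * g i x ≤ 0 := by
      intro i hi
      by_cases hxi : x ∈ Metric.ball i (r i)
      · exact mul_nonpos_of_nonneg_of_nonpos (hb0 i x) ((hiff i (htΩ i hi) x hxi).1 hx).le
      · rw [hzero i hi x hxi, zero_mul]
    obtain ⟨i, hi, hxi⟩ := Set.mem_iUnion₂.1 (hcover (subset_closure hx))
    exact sum_neg' hle ⟨i, hi, mul_neg_of_pos_of_neg ((hbpos i x (htΩ i hi)).2 hxi)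
      ((hiff i (htΩ i hi) x hxi).1 hx)⟩
  · by_contra hxΩ
    refine absurd hx (not_lt.2 (sum_nonneg fun i hi => ?_))
    by_cases hxi : x ∈ Metric.ball i (r i)
    · exact mul_nonneg (hb0 i x) (not_lt.1 fun h => hxΩ ((hiff i (htΩ i hi) x hxi).2 h))
    · rw [hzero i hi x hxi, zero_mul]
  · refine sum_eq_zero fun i hi => ?_
    by_cases hxi : x ∈ Metric.ball i (r i)
    · rw [hfrzero x hx i hi hxi, mul_zero]
    · rw [hzero i hi x hxi, zero_mul]
  · obtain ⟨i₀, hi₀, hxi₀⟩ := Set.mem_iUnion₂.1 (hcover (frontier_subset_closure hx))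
    -- This direction enters `Ω`, so no local defining function near `x` can increase along it, and
    -- `g i₀` strictly decreases. A weighted sum with nonnegative weights therefore has a nonzero
    -- derivative.
    set d := -gradient (g i₀) x with hd
    have hdiff : ∀ i ∈ t, DifferentiableAt ℝ (g i) x := fun i hi =>
      (hg i (htΩ i hi)).differentiable (by simp) x
    have hneg : fderiv ℝ (g i₀) x d < 0 := by
      rw [← inner_gradient_left, hd, inner_neg_right, real_inner_self_eq_norm_sq]
      have := norm_pos_iff.2 (hgrad i₀ (htΩ i₀ hi₀) x hxi₀ hx)
      simp only [Left.neg_neg_iff]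
      positivity
    have hin : ∀ᶠ s : ℝ in 𝓝[>] 0, x + s • d ∈ Ω := by
      filter_upwards [eventually_neg_of_fderiv_neg (hdiff i₀ hi₀) (hfrzero x hx i₀ hi₀ hxi₀) hneg,
        (tendsto_line x d).eventually (Metric.isOpen_ball.mem_nhds hxi₀)] with s h1 h2
      exact (hiff i₀ (htΩ i₀ hi₀) _ h2).2 h1
    -- The derivative of the weight drops out: either `g i` vanishes at `x`, or the bump has its
    -- minimum value 0 there.
    have hder : ∀ i ∈ t, HasFDerivAt (fun y => b i y * g i y) (b i x • fderiv ℝ (g i) x) x := by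
      intro i hi
      have hbd : DifferentiableAt ℝ (b i) x := (hb i).differentiable (by simp) x
      refine (hbd.hasFDerivAt.mul (hdiff i hi).hasFDerivAt).congr_fderiv ?_
      by_cases hxi : x ∈ Metric.ball i (r i)
      · rw [hfrzero x hx i hi hxi, zero_smul, add_zero]
      · have hmin : IsLocalMin (b i) x := by
          refine Filter.Eventually.of_forall fun y => ?_
          rw [hzero i hi x hxi]; exact hb0 i y
        rw [hmin.fderiv_eq_zero, smul_zero, add_zero]
    have hsum : HasFDerivAt (fun y => ∑ i ∈ t, b i y * g i y)
        (∑ i ∈ t, b i x • fderiv ℝ (g i) x) x := HasFDerivAt.fun_sum hder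
    intro h0
    have h1 : fderiv ℝ (fun y => ∑ i ∈ t, b i y * g i y) x d = 0 := by
      rw [← inner_gradient_left, h0, inner_zero_left]
    rw [hsum.fderiv] at h1
    have h2 : ∑ i ∈ t, b i x * fderiv ℝ (g i) x d < 0 := by
      refine sum_neg' (fun i hi => ?_) ⟨i₀, hi₀, mul_neg_of_pos_of_neg
        ((hbpos i₀ x (htΩ i₀ hi₀)).2 hxi₀) hneg⟩
      by_cases hxi : x ∈ Metric.ball i (r i)
      · refine mul_nonpos_of_nonneg_of_nonpos (hb0 i x)
          (fderiv_nonpos_of_eventually (hdiff i hi) (hfrzero x hx i hi hxi) ?_)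
        filter_upwards [hin, (tendsto_line x d).eventually (Metric.isOpen_ball.mem_nhds hxi)]
          with s h3 h4
        exact ((hiff i (htΩ i hi) _ h4).1 h3).le
      · rw [hzero i hi x hxi, zero_mul]
    simp at h1
    linarith

end GlobalDefiningFunction

/-! ### A defining function that is convex near the boundary -/

section Convexify

variable {n : ℕ} {Ω : Set (E n)}

lemma continuous_gradient {ρ : E n → ℝ} (hρ : ContDiff ℝ ∞ ρ) : Continuous (gradient ρ) := by
  unfold gradient
  exact (InnerProductSpace.toDual ℝ (E n)).symm.continuous.comp (hρ.continuous_fderiv (by simp))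

lemma contDiff_gradient {ρ : E n → ℝ} (hρ : ContDiff ℝ ∞ ρ) : ContDiff ℝ ∞ (gradient ρ) :=
  contDiff_iff_contDiffAt.2 fun x => ContDiffAt.gradient' (l := ∞) hρ.contDiffAt (by simp)

lemma continuous_hessOp {ρ : E n → ℝ} (hρ : ContDiff ℝ ∞ ρ) : Continuous (hessOp ρ) :=
  (contDiff_gradient hρ).continuous_fderiv (by simp)

/-- A minimiser of the Hessian form on the unit tangent sphere is critical, so its value divided by
`|∇ρ|` is a principal curvature. The smallest value is thus positive, and so are all others. -/
lemma hessOp_pos_of_tangent (hΩ : IsStrictlyConvexDomain Ω) {ρ : E n → ℝ} (hρ : ContDiff ℝ ∞ ρ)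
    (hiff : ∀ x, x ∈ Ω ↔ ρ x < 0) {x : E n} (hx : x ∈ frontier Ω) (hgrad : gradient ρ x ≠ 0)
    {ξ : E n} (hξ : ξ ≠ 0) (hξt : ⟪gradient ρ x, ξ⟫ = 0) : 0 < ⟪hessOp ρ x ξ, ξ⟫ := by
  have hρ2 : ContDiffAt ℝ 2 ρ x := hρ.contDiffAt.of_le (by norm_cast)
  set S : Set (E n) := Metric.sphere 0 1 ∩ {η | ⟪gradient ρ x, η⟫ = 0} with hS
  have hScomp : IsCompact S := (isCompact_sphere 0 1).inter_right
    (isClosed_eq (by fun_prop) continuous_const)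
  have hnorm : ∀ η : E n, η ≠ 0 → ⟪gradient ρ x, η⟫ = 0 → ‖η‖⁻¹ • η ∈ S := by
    intro η hη hηt
    refine ⟨?_, ?_⟩
    · simp [norm_smul, hη]
    · change ⟪gradient ρ x, ‖η‖⁻¹ • η⟫ = 0
      rw [inner_smul_right, hηt, mul_zero]
  obtain ⟨ξ₀, hξ₀, hmin⟩ := hScomp.exists_isMinOn ⟨_, hnorm ξ hξ hξt⟩
    (f := fun η => ⟪hessOp ρ x η, η⟫) (by fun_prop)
  set l := ⟪hessOp ρ x ξ₀, ξ₀⟫ with hl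
  have hξ₀n : ‖ξ₀‖ = 1 := by simpa using hξ₀.1
  have hQ : ∀ η, ⟪gradient ρ x, η⟫ = 0 → l * ‖η‖ ^ 2 ≤ ⟪hessOp ρ x η, η⟫ := by
    intro η hηt
    by_cases hη : η = 0
    · simp [hη]
    · have h1 : l ≤ ⟪hessOp ρ x (‖η‖⁻¹ • η), ‖η‖⁻¹ • η⟫ := hmin (hnorm η hη hηt)
      rw [map_smul, inner_smul_left, inner_smul_right] at h1
      have h2 : 0 < ‖η‖ := norm_pos_iff.2 hη
      simp only [conj_trivial] at h1
      calc l * ‖η‖ ^ 2 ≤ (‖η‖⁻¹ * (‖η‖⁻¹ * ⟪hessOp ρ x η, η⟫)) * ‖η‖ ^ 2 := by gcongr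
        _ = _ := by field_simp
  have hcrit : ∀ η, ⟪gradient ρ x, η⟫ = 0 → ⟪hessOp ρ x ξ₀, η⟫ = l * ⟪ξ₀, η⟫ := by
    intro η hηt
    set b := ⟪hessOp ρ x ξ₀, η⟫ - l * ⟪ξ₀, η⟫ with hb
    set a := ⟪hessOp ρ x η, η⟫ - l * ‖η‖ ^ 2 with ha
    have ha0 : 0 ≤ a := by linarith [hQ η hηt]
    have hpoly : ∀ s : ℝ, 0 ≤ 2 * s * b + s ^ 2 * a := by
      intro s
      have h1 := hQ (ξ₀ + s • η) (by
        rw [inner_add_right, inner_smul_right, hηt, mul_zero, add_zero]; exact hξ₀.2)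
      rw [map_add, map_smul, inner_add_left, inner_add_right, inner_add_right, inner_smul_left,
        inner_smul_left, inner_smul_right, inner_smul_right, norm_add_sq_real, inner_smul_right,
        norm_smul, mul_pow, Real.norm_eq_abs, sq_abs, hξ₀n, hessOp_symm hρ2 η ξ₀,
        real_inner_comm _ η] at h1
      simp only [conj_trivial] at h1
      rw [hb, ha]
      linarith
    -- Nearly the minimiser `-b/a` of the quadratic polynomial; `a + 1` avoids a zero denominator.
    have h2 := hpoly (-b / (a + 1))
    have h3 : 2 * (-b / (a + 1)) * b + (-b / (a + 1)) ^ 2 * a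
        = -(b ^ 2 * (a + 2) / (a + 1) ^ 2) := by
      field_simp; ring
    rw [h3] at h2
    have h4 : 0 ≤ b ^ 2 * (a + 2) / (a + 1) ^ 2 := by positivity
    have h5 : b ^ 2 * (a + 2) / (a + 1) ^ 2 = 0 := by linarith
    have h6 : b ^ 2 * (a + 2) = 0 := by
      rwa [div_eq_zero_iff, or_iff_left (by positivity)] at h5
    have h7 : b = 0 := by
      rcases mul_eq_zero.1 h6 with h | h
      · exact pow_eq_zero_iff two_ne_zero |>.1 h
      · linarith
    linarith
  have hgn : 0 < ‖gradient ρ x‖ := norm_pos_iff.2 hgrad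
  have hcurv := hΩ.curvature_pos x hx (l / ‖gradient ρ x‖)
    ⟨ρ, ⟨hρ, hgrad, Filter.Eventually.of_forall hiff⟩, ξ₀,
      fun h => by rw [h, norm_zero] at hξ₀n; exact zero_ne_one hξ₀n, hξ₀.2, fun η hη => by
        rw [iteratedFDeriv_two_apply, div_mul_cancel₀ _ hgn.ne', ← hcrit η hη,
          ← fderiv_fderiv_apply hρ2]
        rfl⟩
  have hl0 : 0 < l := by
    by_contra! h
    have : l / ‖gradient ρ x‖ ≤ 0 := div_nonpos_of_nonpos_of_nonneg h hgn.le
    linarith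
  have := hQ ξ hξt
  have : 0 < ‖ξ‖ := norm_pos_iff.2 hξ
  have : 0 < l * ‖ξ‖ ^ 2 := by positivity
  linarith

/-- The open sets `{a + k b > 0}` increase with `k` and cover the compact set, so one of them
contains it. -/
lemma exists_mul_add_pos_of_isCompact {X : Type*} [TopologicalSpace X] {S : Set X}
    (hS : IsCompact S) {a b : X → ℝ} (ha : Continuous a) (hb : Continuous b)
    (hb0 : ∀ z, 0 ≤ b z) (hpos : ∀ z ∈ S, b z = 0 → 0 < a z) :
    ∃ A : ℝ, 0 < A ∧ ∀ z ∈ S, 0 < a z + A * b z := by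
  by_cases hne : S.Nonempty
  · obtain ⟨k, hk⟩ := hS.elim_directed_cover (fun k : ℕ => {z | 0 < a z + k * b z})
      (fun k => isOpen_lt continuous_const (by fun_prop)) (by
        intro z hz
        rw [Set.mem_iUnion]
        rcases (hb0 z).eq_or_lt with h | h
        · exact ⟨0, by simpa using hpos z hz h.symm⟩
        · obtain ⟨k, hk⟩ := exists_nat_gt (-a z / b z)
          refine ⟨k, ?_⟩
          rw [div_lt_iff₀ h] at hk
          simp only [Set.mem_ofPred_eq]; linarith)
      (by
        intro i j
        refine ⟨max i j, fun z hz => ?_, fun z hz => ?_⟩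
        · have h1 : (i : ℝ) ≤ (max i j : ℕ) := by exact_mod_cast le_max_left i j
          have := mul_le_mul_of_nonneg_right h1 (hb0 z)
          simp only [Set.mem_ofPred_eq] at hz ⊢; linarith
        · have h1 : (j : ℝ) ≤ (max i j : ℕ) := by exact_mod_cast le_max_right i j
          have := mul_le_mul_of_nonneg_right h1 (hb0 z)
          simp only [Set.mem_ofPred_eq] at hz ⊢; linarith)
    refine ⟨k + 1, by positivity, fun z hz => ?_⟩
    have h1 : 0 < a z + k * b z := hk hz
    linarith [hb0 z]
  · exact ⟨1, one_pos, fun z hz => absurd ⟨z, hz⟩ hne⟩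

/-- A smooth defining function of `Ω` that is uniformly convex near the boundary. -/
structure IsConvexDefiningFunction (Ω : Set (E n)) (ρ : E n → ℝ) (θ c δ : ℝ) : Prop where
  contDiff : ContDiff ℝ ∞ ρ
  mem_iff : ∀ x, x ∈ Ω ↔ ρ x < 0
  eq_zero : ∀ x ∈ frontier Ω, ρ x = 0
  convexity_pos : 0 < θ
  slope_pos : 0 < c
  width_pos : 0 < δ
  le_hess : ∀ x ∈ closure Ω, -δ ≤ ρ x → ∀ η, θ * ‖η‖ ^ 2 ≤ ⟪hessOp ρ x η, η⟫
  le_grad : ∀ x ∈ closure Ω, -δ ≤ ρ x → c ≤ ‖gradient ρ x‖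

lemma gradient_exp_mul {ρ : E n → ℝ} (hρ : ContDiff ℝ ∞ ρ) (A : ℝ) (x : E n) :
    gradient (fun y => Real.exp (A * ρ y) - 1) x = (A * Real.exp (A * ρ x)) • gradient ρ x := by
  have h1 : HasFDerivAt ρ (fderiv ℝ ρ x) x := (hρ.differentiable (by simp) x).hasFDerivAt
  have h2 := ((h1.const_mul A).exp).sub_const 1
  refine ext_inner_right ℝ fun η => ?_
  rw [inner_gradient_left, h2.fderiv, inner_smul_left, inner_gradient_left]
  simp; ring

/-- Exponentiating adds a multiple of the squared normal derivative, which supplies convexity in the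
normal direction. -/
lemma hessOp_exp_mul {ρ : E n → ℝ} (hρ : ContDiff ℝ ∞ ρ) (A : ℝ) (x η : E n) :
    ⟪hessOp (fun y => Real.exp (A * ρ y) - 1) x η, η⟫
      = A * Real.exp (A * ρ x) * (⟪hessOp ρ x η, η⟫ + A * ⟪gradient ρ x, η⟫ ^ 2) := by
  have h1 : HasFDerivAt ρ (fderiv ℝ ρ x) x := (hρ.differentiable (by simp) x).hasFDerivAt
  have h2 := ((h1.const_mul A).exp).const_mul A
  have h3 : HasFDerivAt (gradient ρ) (hessOp ρ x) x :=
    ((contDiff_gradient hρ).differentiable (by simp) x).hasFDerivAt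
  have h4 := h2.smul h3
  have h5 : gradient (fun y => Real.exp (A * ρ y) - 1)
      = fun y => (A * Real.exp (A * ρ y)) • gradient ρ y := funext (gradient_exp_mul hρ A)
  rw [hessOp, h5]
  rw [show fderiv ℝ (fun y => (A * Real.exp (A * ρ y)) • gradient ρ y) x = _ from h4.fderiv]
  simp [inner_add_left, inner_smul_left, inner_gradient_left]
  ring

/-- Positivity on the boundary persists in a collar: the set where `F ≤ θ`, half the boundary
minimum, is compact and its points project into `Ω`, so ρ is bounded away from 0 on it. -/
lemma exists_collar {Ω : Set (E n)} (hΩ : IsOpen Ω) (hcomp : IsCompact (closure Ω)) {ρ : E n → ℝ}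
    (hρ : Continuous ρ) (hneg : ∀ x ∈ Ω, ρ x < 0) {X : Type*} [TopologicalSpace X] {S : Set X}
    (hS : IsCompact S) {F : E n × X → ℝ} (hF : Continuous F)
    (hpos : ∀ x ∈ frontier Ω, ∀ z ∈ S, 0 < F (x, z)) :
    ∃ θ δ : ℝ, 0 < θ ∧ 0 < δ ∧ ∀ x ∈ closure Ω, -δ ≤ ρ x → ∀ z ∈ S, θ ≤ F (x, z) := by
  have hfr : IsCompact (frontier Ω) := hcomp.of_isClosed_subset isClosed_frontier
    frontier_subset_closure
  obtain ⟨θ, hθ, hθF⟩ : ∃ θ : ℝ, 0 < θ ∧ ∀ z ∈ frontier Ω ×ˢ S, 2 * θ ≤ F z := by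
    rcases (frontier Ω ×ˢ S).eq_empty_or_nonempty with he | hne
    · exact ⟨1, one_pos, by simp [he]⟩
    · obtain ⟨z, hz, hmin⟩ := (hfr.prod hS).exists_isMinOn hne hF.continuousOn
      exact ⟨F z / 2, half_pos (hpos _ hz.1 _ hz.2), fun y hy => by
        have : F z ≤ F y := hmin hy
        linarith⟩
  set B : Set (E n × X) := (closure Ω ×ˢ S) ∩ {z | F z ≤ θ} with hB
  have hBcomp : IsCompact B := (hcomp.prod hS).inter_right (isClosed_le hF continuous_const)
  have hBneg : ∀ z ∈ B, ρ z.1 < 0 := by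
    intro z hz
    apply hneg
    by_contra h
    have h1 : z.1 ∈ frontier Ω := by rw [hΩ.frontier_eq]; exact ⟨hz.1.1, h⟩
    have h2 := hθF z ⟨h1, hz.1.2⟩
    have h3 : F z ≤ θ := hz.2
    linarith
  obtain ⟨δ, hδ, hδB⟩ : ∃ δ : ℝ, 0 < δ ∧ ∀ z ∈ B, ρ z.1 ≤ -(2 * δ) := by
    rcases B.eq_empty_or_nonempty with he | hne
    · exact ⟨1, one_pos, by simp [he]⟩
    · obtain ⟨z, hz, hmax⟩ := hBcomp.exists_isMaxOn hne
        (hρ.comp continuous_fst).continuousOn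
      refine ⟨-ρ z.1 / 2, by linarith [hBneg z hz], fun y hy => ?_⟩
      have : ρ y.1 ≤ ρ z.1 := hmax hy
      linarith
  refine ⟨θ, δ, hθ, hδ, fun x hx hxδ z hz => ?_⟩
  by_contra! h
  have := hδB (x, z) ⟨⟨hx, hz⟩, h.le⟩
  simp only at this
  linarith

theorem exists_convexDefiningFunction (hΩ : IsStrictlyConvexDomain Ω) :
    ∃ (ρ : E n → ℝ) (θ c δ : ℝ), IsConvexDefiningFunction Ω ρ θ c δ := by
  obtain ⟨ρ, hρ, hiff, hfr⟩ := exists_global_definingFunction hΩ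
  have hcomp : IsCompact (closure Ω) := hΩ.isBounded.isCompact_closure
  have hfrc : IsCompact (frontier Ω) := hcomp.of_isClosed_subset isClosed_frontier
    frontier_subset_closure
  have hG := continuous_gradient hρ
  have hH := continuous_hessOp hρ
  -- Where the normal component of a unit vector vanishes, strict convexity makes the Hessian form
  -- positive; elsewhere a large `A` does.
  obtain ⟨A, hA, hApos⟩ := exists_mul_add_pos_of_isCompact
    (S := frontier Ω ×ˢ Metric.sphere (0 : E n) 1) (hfrc.prod (isCompact_sphere 0 1))
    (a := fun z => ⟪hessOp ρ z.1 z.2, z.2⟫) (b := fun z => ⟪gradient ρ z.1, z.2⟫ ^ 2)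
    (((hH.comp continuous_fst).clm_apply continuous_snd).inner continuous_snd)
    (((hG.comp continuous_fst).inner continuous_snd).pow 2)
    (fun z => sq_nonneg _) (by
      rintro ⟨x, ξ⟩ ⟨hx, hξ⟩ h0
      refine hessOp_pos_of_tangent hΩ hρ hiff hx (hfr x hx).2 ?_ (pow_eq_zero_iff two_ne_zero |>.1 h0)
      rintro rfl
      simp at hξ)
  set σ : E n → ℝ := fun y => Real.exp (A * ρ y) - 1 with hσ
  have hσs : ContDiff ℝ ∞ σ := ((contDiff_const.mul hρ).exp).sub contDiff_const
  have hσneg : ∀ x, ρ x < 0 ↔ σ x < 0 := by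
    intro x
    simp only [hσ, sub_neg, Real.exp_lt_one_iff]
    constructor
    · intro h; exact mul_neg_of_pos_of_neg hA h
    · intro h; exact (pos_iff_neg_of_mul_neg h).1 hA
  have hσiff : ∀ x, x ∈ Ω ↔ σ x < 0 := fun x => (hiff x).trans (hσneg x)
  obtain ⟨θ, δ₁, hθ, hδ₁, hcol₁⟩ := exists_collar hΩ.isOpen hcomp hσs.continuous
    (fun x hx => (hσiff x).1 hx) (isCompact_sphere (0 : E n) 1)
    (F := fun z => ⟪hessOp σ z.1 z.2, z.2⟫)
    ((((continuous_hessOp hσs).comp continuous_fst).clm_apply continuous_snd).inner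
      continuous_snd) (by
      intro x hx ξ hξ
      simp only [hσ]
      rw [hessOp_exp_mul hρ]
      have := hApos (x, ξ) ⟨hx, hξ⟩
      positivity)
  obtain ⟨c, δ₂, hc, hδ₂, hcol₂⟩ := exists_collar hΩ.isOpen hcomp hσs.continuous
    (fun x hx => (hσiff x).1 hx) (isCompact_univ (X := Unit))
    (F := fun z => ‖gradient σ z.1‖) (((continuous_gradient hσs).comp continuous_fst).norm) (by
      intro x hx _ _
      simp only [hσ]
      rw [gradient_exp_mul hρ, norm_pos_iff]
      exact smul_ne_zero (by positivity) (hfr x hx).2)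
  refine ⟨σ, θ, c, min δ₁ δ₂, hσs, hσiff, fun x hx => by simp [hσ, (hfr x hx).1], hθ, hc,
    lt_min hδ₁ hδ₂, fun x hx hxδ η => ?_, fun x hx hxδ => ?_⟩
  · by_cases hη : η = 0
    · simp [hη]
    · have h1 := hcol₁ x hx ((neg_le_neg (min_le_left _ _)).trans hxδ) (‖η‖⁻¹ • η)
        (by simp [norm_smul, hη])
      simp only [map_smul, inner_smul_left, inner_smul_right, conj_trivial] at h1
      have h2 : 0 < ‖η‖ := norm_pos_iff.2 hη
      calc θ * ‖η‖ ^ 2 ≤ (‖η‖⁻¹ * (‖η‖⁻¹ * ⟪hessOp σ x η, η⟫)) * ‖η‖ ^ 2 := by gcongr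
        _ = _ := by field_simp
  · exact hcol₂ x hx ((neg_le_neg (min_le_right _ _)).trans hxδ) () trivial

end Convexify

end PConvex

namespace PConvex

open Finset Matrix
open scoped RealInnerProductSpace Topology

/-! ### Calculus on the closed domain -/

section BoundaryCalculus

variable {n : ℕ} {Ω : Set (E n)} {ρ : E n → ℝ} {θ c δ : ℝ}

namespace IsConvexDefiningFunction

lemma isOpen (h : IsConvexDefiningFunction Ω ρ θ c δ) : IsOpen Ω := by
  have : Ω = {x | ρ x < 0} := Set.ext h.mem_iff
  rw [this]
  exact isOpen_lt h.contDiff.continuous continuous_const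

lemma le_norm_gradient (h : IsConvexDefiningFunction Ω ρ θ c δ) {x : E n} (hx : x ∈ frontier Ω) :
    c ≤ ‖gradient ρ x‖ :=
  h.le_grad x (frontier_subset_closure hx) (by rw [h.eq_zero x hx]; linarith [h.width_pos])

lemma norm_gradient_pos (h : IsConvexDefiningFunction Ω ρ θ c δ) {x : E n}
    (hx : x ∈ frontier Ω) : 0 < ‖gradient ρ x‖ := h.slope_pos.trans_le (h.le_norm_gradient hx)

lemma nonpos_of_mem_closure (h : IsConvexDefiningFunction Ω ρ θ c δ) {x : E n}
    (hx : x ∈ closure Ω) : ρ x ≤ 0 :=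
  closure_minimal (fun y hy => ((h.mem_iff y).1 hy).le)
    (isClosed_le h.contDiff.continuous continuous_const) hx

lemma mem_frontier_of_mem_closure (h : IsConvexDefiningFunction Ω ρ θ c δ) {x : E n}
    (hx : x ∈ closure Ω) (hxΩ : x ∉ Ω) : x ∈ frontier Ω := by
  rw [h.isOpen.frontier_eq]; exact ⟨hx, hxΩ⟩

lemma differentiableAt (h : IsConvexDefiningFunction Ω ρ θ c δ) (x : E n) :
    DifferentiableAt ℝ ρ x := h.contDiff.differentiable (by simp) x

lemma eventually_mem (h : IsConvexDefiningFunction Ω ρ θ c δ) {x d : E n} (hx : x ∈ frontier Ω)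
    (hd : ⟪gradient ρ x, d⟫ < 0) : ∀ᶠ s : ℝ in 𝓝[>] 0, x + s • d ∈ Ω := by
  filter_upwards [eventually_neg_of_fderiv_neg (h.differentiableAt x) (h.eq_zero x hx)
    (by rwa [← inner_gradient_left])] with s hs using (h.mem_iff _).2 hs

lemma eventually_notMem (h : IsConvexDefiningFunction Ω ρ θ c δ) {x d : E n} (hx : x ∈ frontier Ω)
    (hd : 0 < ⟪gradient ρ x, d⟫) : ∀ᶠ s : ℝ in 𝓝[>] 0, x + s • d ∉ Ω := by
  have hneg := eventually_neg_of_fderiv_neg (g := fun y => -ρ y) (d := d)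
    (h.differentiableAt x).neg (by simp [h.eq_zero x hx]) (by
      rw [fderiv_fun_neg, _root_.neg_apply, ← inner_gradient_left]; linarith)
  filter_upwards [hneg] with s hs
  rw [h.mem_iff]; linarith

/-- The closure of a smooth domain is a set of unique differentiability. -/
lemma uniqueDiffOn (h : IsConvexDefiningFunction Ω ρ θ c δ) : UniqueDiffOn ℝ (closure Ω) := by
  intro x hx
  by_cases hxΩ : x ∈ Ω
  · exact uniqueDiffWithinAt_of_mem_nhds
      (Filter.mem_of_superset (h.isOpen.mem_nhds hxΩ) subset_closure)
  have hfr := h.mem_frontier_of_mem_closure hx hxΩ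
  have hcone : ∀ d, ⟪gradient ρ x, d⟫ < 0 → d ∈ tangentConeAt ℝ (closure Ω) x := by
    intro d hd
    refine mem_tangentConeAt_of_add_smul_mem (Filter.tendsto_id'.mpr <| nhdsGT_le_nhdsNE 0) ?_
    filter_upwards [h.eventually_mem hfr hd] with s hs using subset_closure hs
  refine ⟨?_, subset_closure hx⟩
  have htop : Submodule.span ℝ (tangentConeAt ℝ (closure Ω) x) = ⊤ := by
    rw [eq_top_iff]
    intro v _
    have hpos := h.norm_gradient_pos hfr
    set g := gradient ρ x with hg
    have hgg : 0 < ‖g‖ ^ 2 := by positivity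
    -- Large enough that `v - t g` points into `Ω`, so that `v` is a combination of two inward
    -- directions.
    set t : ℝ := (|⟪g, v⟫| + 1) / ‖g‖ ^ 2 with ht
    have ht0 : 0 < t := by positivity
    have htg : t * ‖g‖ ^ 2 = |⟪g, v⟫| + 1 := div_mul_cancel₀ _ hgg.ne'
    have h1 : v - t • g ∈ tangentConeAt ℝ (closure Ω) x := by
      apply hcone
      rw [inner_sub_right, inner_smul_right, real_inner_self_eq_norm_sq, htg]
      linarith [le_abs_self ⟪g, v⟫]
    have h2 : -g ∈ tangentConeAt ℝ (closure Ω) x := by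
      apply hcone
      rw [inner_neg_right, real_inner_self_eq_norm_sq]; linarith
    have h3 : v = (v - t • g) + (-t) • (-g) := by simp
    rw [h3]
    exact add_mem (Submodule.subset_span h1) (Submodule.smul_mem _ _ (Submodule.subset_span h2))
  rw [htop]
  exact dense_univ

/-- The tangential derivative of a function that vanishes on the boundary is zero. -/
lemma tangential_deriv_eq_zero (h : IsConvexDefiningFunction Ω ρ θ c δ) {g : E n → ℝ}
    {g' : E n →L[ℝ] ℝ} {x η : E n} (hx : x ∈ frontier Ω)
    (hg : HasFDerivWithinAt g g' (closure Ω) x) (hg0 : ∀ y ∈ frontier Ω, g y = 0)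
    (hη : ⟪gradient ρ x, η⟫ = 0) : g' η = 0 := by
  set N := gradient ρ x with hN
  have hNpos : 0 < ‖N‖ := h.norm_gradient_pos hx
  have key : ∀ ε : ℝ, 0 < ε → ε ≤ 1 → |g' η| ≤ ε * (‖η‖ + ‖N‖ + ‖g'‖ * ‖N‖) := by
    intro ε hε hε1
    have hin := h.eventually_mem (d := η - ε • N) hx (by
      rw [inner_sub_right, inner_smul_right, ← hN, hη, real_inner_self_eq_norm_sq]
      have : 0 < ε * ‖N‖ ^ 2 := by positivity
      linarith)
    have hout := h.eventually_notMem (d := η + ε • N) hx (by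
      rw [inner_add_right, inner_smul_right, ← hN, hη, real_inner_self_eq_norm_sq]
      have : 0 < ε * ‖N‖ ^ 2 := by positivity
      linarith)
    have hlittle := hg.isLittleO.def hε
    rw [eventually_nhdsWithin_iff, Metric.eventually_nhds_iff] at hlittle
    obtain ⟨r, hr, hball⟩ := hlittle
    have hsmall : ∀ᶠ s : ℝ in 𝓝[>] 0, s * (‖η‖ + ‖N‖) < r := by
      have : Filter.Tendsto (fun s : ℝ => s * (‖η‖ + ‖N‖)) (𝓝 0) (𝓝 (0 * (‖η‖ + ‖N‖))) :=
        Filter.tendsto_id.mul_const _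
      rw [zero_mul] at this
      exact (this.eventually (gt_mem_nhds hr)).filter_mono nhdsWithin_le_nhds
    obtain ⟨s, hs1, hs2, hs3, hs4⟩ := (hin.and (hout.and (hsmall.and self_mem_nhdsWithin))).exists
    have hs0 : 0 < s := hs4
    -- No boundary curve is constructed. The segment from `η - ε N` to `η + ε N`, scaled by `s`,
    -- joins a point of `Ω` to a point outside `Ω`, and connectedness gives a boundary point on it,
    -- where `g` vanishes. Its direction differs from `η` by at most `ε |N|`.
    obtain ⟨t, ht, htfr⟩ : ∃ t ∈ Set.Icc (-ε) ε, x + s • (η + t • N) ∈ frontier Ω := by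
      by_contra! hno
      have hcont : Continuous fun t : ℝ => x + s • (η + t • N) := by fun_prop
      have hsub : Set.Icc (-ε) ε ⊆ (fun t : ℝ => x + s • (η + t • N)) ⁻¹' Ω
          ∪ (fun t : ℝ => x + s • (η + t • N)) ⁻¹' (closure Ω)ᶜ := by
        intro t ht
        by_cases hc : x + s • (η + t • N) ∈ closure Ω
        · left
          by_contra hc2
          exact hno t ht (h.mem_frontier_of_mem_closure hc hc2)
        · right; exact hc
      obtain ⟨t, -, ht1, ht2⟩ := isPreconnected_Icc _ _ (h.isOpen.preimage hcont)
        (isClosed_closure.isOpen_compl.preimage hcont) hsub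
        ⟨-ε, ⟨le_rfl, by linarith⟩, by simpa [sub_eq_add_neg] using hs1⟩
        ⟨ε, ⟨by linarith, le_rfl⟩, fun hc => hno ε ⟨by linarith, le_rfl⟩
          (h.mem_frontier_of_mem_closure hc hs2)⟩
      exact ht2 (subset_closure ht1)
    have hd : ‖t • N‖ ≤ ε * ‖N‖ := by
      rw [norm_smul, Real.norm_eq_abs]
      exact mul_le_mul_of_nonneg_right (abs_le.2 ht) hNpos.le
    have hd2 : ‖η + t • N‖ ≤ ‖η‖ + ‖N‖ := by
      refine (norm_add_le _ _).trans (add_le_add le_rfl (hd.trans ?_))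
      exact mul_le_of_le_one_left hNpos.le hε1
    have hnorm : ‖s • (η + t • N)‖ ≤ s * (‖η‖ + ‖N‖) := by
      rw [norm_smul, Real.norm_of_nonneg hs0.le]
      exact mul_le_mul_of_nonneg_left hd2 hs0.le
    have h1 := hball (y := x + s • (η + t • N))
      (by rw [dist_eq_norm, add_sub_cancel_left]; exact hnorm.trans_lt hs3)
      (frontier_subset_closure htfr)
    rw [hg0 _ htfr, hg0 _ hx, add_sub_cancel_left, sub_zero, zero_sub, norm_neg, map_smul,
      smul_eq_mul, norm_mul, Real.norm_of_nonneg hs0.le] at h1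
    have h2 : ‖g' (η + t • N)‖ ≤ ε * (‖η‖ + ‖N‖) := by
      have h3 : s * ‖g' (η + t • N)‖ ≤ s * (ε * (‖η‖ + ‖N‖)) :=
        h1.trans (by nlinarith [mul_le_mul_of_nonneg_left hnorm hε.le])
      exact le_of_mul_le_mul_left h3 hs0
    have h4 : ‖g' (t • N)‖ ≤ ‖g'‖ * (ε * ‖N‖) :=
      (g'.le_opNorm _).trans (mul_le_mul_of_nonneg_left hd (norm_nonneg _))
    have h5 : g' η = g' (η + t • N) - g' (t • N) := by rw [map_add]; ring
    rw [← Real.norm_eq_abs, h5]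
    refine (norm_sub_le _ _).trans ?_
    linarith
  by_contra hne
  have hpos : 0 < |g' η| := abs_pos.2 hne
  set M := ‖η‖ + ‖N‖ + ‖g'‖ * ‖N‖ with hM
  have hM0 : 0 < M := by positivity
  have h1 := key (min 1 (|g' η| / (2 * M))) (lt_min one_pos (by positivity)) (min_le_left _ _)
  have h2 : min 1 (|g' η| / (2 * M)) * M ≤ |g' η| / (2 * M) * M :=
    mul_le_mul_of_nonneg_right (min_le_right _ _) hM0.le
  have h3 : |g' η| / (2 * M) * M = |g' η| / 2 := by field_simp
  linarith

end IsConvexDefiningFunction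

/-- The Hessian operator of `u` up to the boundary. -/
noncomputable def hessWithin (u : E n → ℝ) (s : Set (E n)) (x : E n) : E n →L[ℝ] E n :=
  fderivWithin ℝ (gradientWithin u s) s x

/-! ### Derivatives up to the boundary -/

section Within

variable {u : E n → ℝ} {s : Set (E n)}

lemma contDiffOn_gradientWithin (hs : UniqueDiffOn ℝ s) (hu : ContDiffOn ℝ 3 u s) :
    ContDiffOn ℝ 2 (gradientWithin u s) s :=
  (InnerProductSpace.toDual ℝ (E n)).symm.contDiff.comp_contDiffOn
    (hu.fderivWithin hs (by norm_num))

lemma hasFDerivWithinAt_gradientWithin (hs : UniqueDiffOn ℝ s) (hu : ContDiffOn ℝ 3 u s) {x : E n}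
    (hx : x ∈ s) : HasFDerivWithinAt (gradientWithin u s) (hessWithin u s x) s x :=
  ((contDiffOn_gradientWithin hs hu).differentiableOn (by norm_num) x hx).hasFDerivWithinAt

lemma continuousOn_hessWithin (hs : UniqueDiffOn ℝ s) (hu : ContDiffOn ℝ 3 u s) :
    ContinuousOn (hessWithin u s) s :=
  (contDiffOn_gradientWithin hs hu).continuousOn_fderivWithin hs (by norm_num)

lemma iteratedFDerivWithin_two_eq (hs : UniqueDiffOn ℝ s) (hu : ContDiffOn ℝ 3 u s) {x : E n}
    (hx : x ∈ s) (v : Fin 2 → E n) :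
    iteratedFDerivWithin ℝ 2 u s x v = ⟪hessWithin u s x (v 0), v 1⟫ := by
  rw [iteratedFDerivWithin_two_apply u hs hx]
  have h2 : fderivWithin ℝ u s = fun y => InnerProductSpace.toDual ℝ (E n) (gradientWithin u s y) :=
    funext fun y => toDual_gradientWithin.symm
  have h3 : HasFDerivWithinAt (fun y => InnerProductSpace.toDual ℝ (E n) (gradientWithin u s y))
      ((InnerProductSpace.toDual ℝ (E n)).toContinuousLinearEquiv.toContinuousLinearMap.comp
        (hessWithin u s x)) s x :=
    (InnerProductSpace.toDual ℝ
      (E n)).toContinuousLinearEquiv.toContinuousLinearMap.hasFDerivAt.comp_hasFDerivWithinAt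
      x (hasFDerivWithinAt_gradientWithin hs hu hx)
  rw [h2, h3.fderivWithin (hs x hx)]
  simp

lemma gradientWithin_of_mem_nhds {x : E n} (hx : s ∈ 𝓝 x) :
    gradientWithin u s x = gradient u x := by
  rw [gradientWithin, gradient, fderivWithin_of_mem_nhds hx]

lemma closure_mem_nhds {Ω : Set (E n)} (hΩ : IsOpen Ω) {x : E n} (hx : x ∈ Ω) :
    closure Ω ∈ 𝓝 x := Filter.mem_of_superset (hΩ.mem_nhds hx) subset_closure

lemma gradientWithin_closure_eq {Ω : Set (E n)} (hΩ : IsOpen Ω) {x : E n} (hx : x ∈ Ω) :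
    gradientWithin u (closure Ω) x = gradient u x :=
  gradientWithin_of_mem_nhds (closure_mem_nhds hΩ hx)

lemma hessWithin_closure_eq {Ω : Set (E n)} (hΩ : IsOpen Ω) {x : E n} (hx : x ∈ Ω) :
    hessWithin u (closure Ω) x = hessOp u x := by
  rw [hessWithin, fderivWithin_of_mem_nhds (closure_mem_nhds hΩ hx), hessOp]
  refine Filter.EventuallyEq.fderiv_eq ?_
  filter_upwards [hΩ.mem_nhds hx] with y hy using gradientWithin_closure_eq hΩ hy

end Within

/-! ### Limits of curvature frames at the boundary -/

section BoundaryFrames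

variable {p : ℕ} {K L m : ℝ} {f : E n → ℝ → E (n + 1) → ℝ} {u : E n → ℝ}

lemma tendsto_clm_apply {α : Type*} {l : Filter α} {A : α → E n →L[ℝ] E n} {v : α → E n}
    {A₀ : E n →L[ℝ] E n} {v₀ : E n} (hA : Filter.Tendsto A l (𝓝 A₀))
    (hv : Filter.Tendsto v l (𝓝 v₀)) : Filter.Tendsto (fun a => A a (v a)) l (𝓝 (A₀ v₀)) :=
  ((isBoundedBilinearMap_apply (𝕜 := ℝ) (E := E n) (F := E n)).continuous.tendsto
    (A₀, v₀)).comp (hA.prodMk_nhds hv)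

lemma neBot_nhdsWithin_of_mem_closure {x : E n} (hx : x ∈ closure Ω) : (𝓝[Ω] x).NeBot :=
  mem_closure_iff_nhdsWithin_neBot.1 hx

lemma tendsto_gradient (h : IsConvexDefiningFunction Ω ρ θ c δ)
    (hu : ContDiffOn ℝ 3 u (closure Ω)) {x : E n} (hx : x ∈ closure Ω) :
    Filter.Tendsto (gradient u) (𝓝[Ω] x) (𝓝 (gradientWithin u (closure Ω) x)) := by
  have h1 := ((contDiffOn_gradientWithin h.uniqueDiffOn hu).continuousOn x hx).mono_left
    (nhdsWithin_mono x subset_closure)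
  refine Filter.Tendsto.congr' ?_ h1
  filter_upwards [self_mem_nhdsWithin] with y hy using gradientWithin_closure_eq h.isOpen hy

lemma tendsto_hessOp (h : IsConvexDefiningFunction Ω ρ θ c δ)
    (hu : ContDiffOn ℝ 3 u (closure Ω)) {x : E n} (hx : x ∈ closure Ω) :
    Filter.Tendsto (hessOp u) (𝓝[Ω] x) (𝓝 (hessWithin u (closure Ω) x)) := by
  have h1 := (continuousOn_hessWithin h.uniqueDiffOn hu x hx).mono_left
    (nhdsWithin_mono x subset_closure)
  refine Filter.Tendsto.congr' ?_ h1
  filter_upwards [self_mem_nhdsWithin] with y hy using hessWithin_closure_eq h.isOpen hy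

lemma IsControlledSolution.norm_gradientWithin_le (hu : IsControlledSolution p Ω K L m f u)
    (h : IsConvexDefiningFunction Ω ρ θ c δ) {x : E n} (hx : x ∈ closure Ω) :
    ‖gradientWithin u (closure Ω) x‖ ≤ K := by
  have := neBot_nhdsWithin_of_mem_closure hx
  refine le_of_tendsto (tendsto_gradient h hu.solution.contDiffOn hx).norm ?_
  filter_upwards [self_mem_nhdsWithin] with y hy using (hu.bound y hy).2

lemma IsControlledSolution.hessWithin_symm (hu : IsControlledSolution p Ω K L m f u)
    (h : IsConvexDefiningFunction Ω ρ θ c δ) {x : E n} (hx : x ∈ closure Ω) (a b : E n) :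
    ⟪hessWithin u (closure Ω) x a, b⟫ = ⟪a, hessWithin u (closure Ω) x b⟫ := by
  have := neBot_nhdsWithin_of_mem_closure hx
  have hH := tendsto_hessOp h hu.solution.contDiffOn hx
  have hev : ∀ v, Filter.Tendsto (fun y => hessOp u y v) (𝓝[Ω] x)
      (𝓝 (hessWithin u (closure Ω) x v)) := fun v => tendsto_clm_apply hH tendsto_const_nhds
  refine tendsto_nhds_unique ((hev a).inner tendsto_const_nhds)
    (Filter.Tendsto.congr' ?_ (Filter.Tendsto.inner (f := fun _ => a) tendsto_const_nhds (hev b)))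
  filter_upwards [self_mem_nhdsWithin] with y hy
  exact (hessOp_symm ((hu.contDiffAt h.isOpen hy).of_le (by norm_num)) a b).symm

lemma continuous_areaFactor : Continuous (areaFactor (n := n)) :=
  differentiable_areaFactor.continuous

lemma tendsto_metricRootInv {α : Type*} {l : Filter α} {q v : α → E n} {q₀ v₀ : E n}
    (hq : Filter.Tendsto q l (𝓝 q₀)) (hv : Filter.Tendsto v l (𝓝 v₀)) :
    Filter.Tendsto (fun a => metricRootInv (q a) (v a)) l (𝓝 (metricRootInv q₀ v₀)) := by
  have hw : Filter.Tendsto (fun a => areaFactor (q a)) l (𝓝 (areaFactor q₀)) :=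
    (continuous_areaFactor.tendsto q₀).comp hq
  unfold metricRootInv
  refine hv.sub (Filter.Tendsto.smul ((hq.inner hv).div (hw.mul (tendsto_const_nhds.add hw)) ?_) hq)
  have := areaFactor_pos q₀
  positivity

/-- Curvature frames exist up to the boundary. -/
lemma IsControlledSolution.exists_frame_closure (hm : 0 < m)
    (hu : IsControlledSolution p Ω K L m f u)
    (h : IsConvexDefiningFunction Ω ρ θ c δ) {x : E n} (hx : x ∈ closure Ω) :
    ∃ Q κ, IsCurvatureFrame p m L (gradientWithin u (closure Ω) x)
      (hessWithin u (closure Ω) x) Q κ := by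
  have hne := neBot_nhdsWithin_of_mem_closure hx
  have hex : ∀ y, ∃ Qκ : (Fin n → E n) × (Fin n → ℝ), y ∈ Ω →
      IsCurvatureFrame p m L (gradient u y) (hessOp u y) Qκ.1 Qκ.2 := by
    intro y
    by_cases hy : y ∈ Ω
    · obtain ⟨Q, κ, hQ⟩ := hu.exists_frame h.isOpen hy
      exact ⟨(Q, κ), fun _ => hQ⟩
    · exact ⟨0, fun h => absurd h hy⟩
  choose F hF using hex
  -- Along an ultrafilter the unit vectors of the frames converge by compactness, without passing to
  -- subsequences; the curvatures then converge as diagonal entries.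
  set U : Ultrafilter (E n) := Ultrafilter.of (𝓝[Ω] x) with hU
  have hUle : (U : Filter (E n)) ≤ 𝓝[Ω] x := Ultrafilter.of_le _
  have hUΩ : ∀ᶠ y in (U : Filter (E n)), y ∈ Ω := hUle self_mem_nhdsWithin
  have hG := (tendsto_gradient h hu.solution.contDiffOn hx).mono_left hUle
  have hH := (tendsto_hessOp h hu.solution.contDiffOn hx).mono_left hUle
  set q := gradientWithin u (closure Ω) x with hq
  set H := hessWithin u (closure Ω) x with hHdef
  have hball : ∀ᶠ y in (U : Filter (E n)), (F y).1 ∈ Metric.closedBall (0 : Fin n → E n) 1 := by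
    filter_upwards [hUΩ] with y hy
    rw [mem_closedBall_zero_iff, pi_norm_le_iff_of_nonneg zero_le_one]
    exact fun i => ((hF y hy).orthonormal.1 i).le
  obtain ⟨Q, -, hQ⟩ := (isCompact_closedBall (0 : Fin n → E n) 1).ultrafilter_le_nhds
    (U.map fun y => (F y).1) (Filter.le_principal_iff.2 hball)
  have hQt : Filter.Tendsto (fun y => (F y).1) (U : Filter (E n)) (𝓝 Q) := hQ
  have hQi : ∀ i, Filter.Tendsto (fun y => (F y).1 i) (U : Filter (E n)) (𝓝 (Q i)) :=
    fun i => ((continuous_apply i).tendsto Q).comp hQt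
  have hτ : ∀ i, Filter.Tendsto (fun y => metricRootInv (gradient u y) ((F y).1 i))
      (U : Filter (E n)) (𝓝 (metricRootInv q (Q i))) := fun i => tendsto_metricRootInv hG (hQi i)
  have hw : Filter.Tendsto (fun y => areaFactor (gradient u y)) (U : Filter (E n))
      (𝓝 (areaFactor q)) := (continuous_areaFactor.tendsto q).comp hG
  have hwq := (areaFactor_pos q).ne'
  have hb : ∀ i j, Filter.Tendsto (fun y => ⟪hessOp u y (metricRootInv (gradient u y) ((F y).1 i)),
      metricRootInv (gradient u y) ((F y).1 j)⟫) (U : Filter (E n))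
      (𝓝 ⟪H (metricRootInv q (Q i)), metricRootInv q (Q j)⟫) :=
    fun i j => (tendsto_clm_apply hH (hτ i)).inner (hτ j)
  set κ : Fin n → ℝ := fun i => ⟪H (metricRootInv q (Q i)), metricRootInv q (Q i)⟫ / areaFactor q
    with hκ
  have hκt : ∀ i, Filter.Tendsto (fun y => (F y).2 i) (U : Filter (E n)) (𝓝 (κ i)) := by
    intro i
    refine Filter.Tendsto.congr' ?_ ((hb i i).div hw hwq)
    filter_upwards [hUΩ] with y hy
    change ⟪hessOp u y (metricRootInv (gradient u y) ((F y).1 i)),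
      metricRootInv (gradient u y) ((F y).1 i)⟫ / areaFactor (gradient u y) = _
    rw [(hF y hy).diag, if_pos rfl, mul_div_cancel_left₀ _ (areaFactor_pos _).ne']
  have hsum : ∀ J : Finset (Fin n), Filter.Tendsto (fun y => ∑ j ∈ J, (F y).2 j)
      (U : Filter (E n)) (𝓝 (∑ j ∈ J, κ j)) := fun J => tendsto_finsetSum J fun i _ => hκt i
  have hprod : Filter.Tendsto (fun y => ∏ J ∈ subsetsOfCard n p, ∑ j ∈ J, (F y).2 j)
      (U : Filter (E n)) (𝓝 (∏ J ∈ subsetsOfCard n p, ∑ j ∈ J, κ j)) :=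
    tendsto_finsetProd _ fun J _ => hsum J
  have hle : m ≤ ∏ J ∈ subsetsOfCard n p, ∑ j ∈ J, κ j :=
    ge_of_tendsto hprod (by filter_upwards [hUΩ] with y hy using (hF y hy).le_prod)
  refine ⟨Q, κ, ?_, ?_, ?_, hle,
    le_of_tendsto hprod (by filter_upwards [hUΩ] with y hy using (hF y hy).prod_le)⟩
  · rw [orthonormal_iff_ite]
    intro i j
    refine tendsto_nhds_unique ((hQi i).inner (hQi j)) (tendsto_const_nhds.congr' ?_)
    filter_upwards [hUΩ] with y hy
    rw [orthonormal_iff_ite.1 (hF y hy).orthonormal i j]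
  · intro i j
    split_ifs with hij
    · rw [← hij, hκ]; field_simp
    · refine tendsto_nhds_unique (hb i j) (tendsto_const_nhds.congr' ?_)
      filter_upwards [hUΩ] with y hy
      rw [(hF y hy).diag, if_neg hij]
  · intro J hJ
    -- In the limit a p-sum is only nonnegative; it cannot vanish because the product stays at least
    -- `m > 0`.
    refine lt_of_le_of_ne (ge_of_tendsto (hsum J)
      (by filter_upwards [hUΩ] with y hy using ((hF y hy).pos J hJ).le)) fun h0 => ?_
    rw [prod_eq_zero hJ h0.symm] at hle
    linarith

end BoundaryFrames

end BoundaryCalculus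

end PConvex

namespace PConvex

open Finset Matrix
open scoped RealInnerProductSpace Topology

/-! ### Gradient and tangential Hessian on the boundary -/

section BoundaryGradient

variable {n p : ℕ} {Ω : Set (E n)} {ρ : E n → ℝ} {θ c δ : ℝ} {K L m : ℝ}
  {f : E n → ℝ → E (n + 1) → ℝ} {u : E n → ℝ}

lemma hasFDerivWithinAt_of_contDiffOn {s : Set (E n)} (hu : ContDiffOn ℝ 3 u s) {x : E n}
    (hx : x ∈ s) : HasFDerivWithinAt u (InnerProductSpace.toDual ℝ (E n) (gradientWithin u s x)) s x := by
  rw [toDual_gradientWithin]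
  exact (hu.differentiableOn (by norm_num) x hx).hasFDerivWithinAt

lemma inner_gradientWithin_eq_zero (h : IsConvexDefiningFunction Ω ρ θ c δ)
    (hu : IsAdmissibleSolution p Ω f u) {x η : E n} (hx : x ∈ frontier Ω)
    (hη : ⟪gradient ρ x, η⟫ = 0) : ⟪gradientWithin u (closure Ω) x, η⟫ = 0 := by
  have := h.tangential_deriv_eq_zero hx (hasFDerivWithinAt_of_contDiffOn hu.contDiffOn
    (frontier_subset_closure hx)) hu.boundary hη
  simpa using this

/-- On the boundary the gradient of the solution is normal. -/
lemma gradientWithin_eq_smul (h : IsConvexDefiningFunction Ω ρ θ c δ)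
    (hu : IsAdmissibleSolution p Ω f u) {x : E n} (hx : x ∈ frontier Ω) :
    gradientWithin u (closure Ω) x
      = (⟪gradientWithin u (closure Ω) x, gradient ρ x⟫ / ‖gradient ρ x‖ ^ 2) • gradient ρ x := by
  set G := gradientWithin u (closure Ω) x with hG
  set N := gradient ρ x with hN
  have hNpos : 0 < ‖N‖ := h.norm_gradient_pos hx
  set a := ⟪G, N⟫ / ‖N‖ ^ 2 with ha
  have hperp : ⟪N, G - a • N⟫ = 0 := by
    rw [inner_sub_right, inner_smul_right, real_inner_self_eq_norm_sq, ha, real_inner_comm]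
    field_simp; ring
  have h1 := inner_gradientWithin_eq_zero h hu hx hperp
  have h2 : ⟪G - a • N, G - a • N⟫ = 0 := by
    rw [inner_sub_left, h1, inner_smul_left, hperp]; simp
  exact sub_eq_zero.1 (inner_self_eq_zero.1 h2)

/-- The tangential second derivatives on the boundary. -/
lemma tangential_hessWithin (h : IsConvexDefiningFunction Ω ρ θ c δ)
    (hu : IsAdmissibleSolution p Ω f u) {x η ζ : E n} (hx : x ∈ frontier Ω)
    (hη : ⟪gradient ρ x, η⟫ = 0) (hζ : ⟪gradient ρ x, ζ⟫ = 0) :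
    ‖gradient ρ x‖ ^ 2 * ⟪hessWithin u (closure Ω) x ζ, η⟫
      = ⟪gradientWithin u (closure Ω) x, gradient ρ x⟫ * ⟪hessOp ρ x ζ, η⟫ := by
  -- A field tangential to the boundary everywhere that equals `|∇ρ|² η` at `x`. Differentiating
  -- `⟨Du, V⟩ = 0` along `ζ` gives the formula.
  set V : E n → E n := fun y => ⟪gradient ρ y, gradient ρ y⟫ • η - ⟪gradient ρ y, η⟫ • gradient ρ y
    with hV
  have hN : HasFDerivWithinAt (gradient ρ) (hessOp ρ x) (closure Ω) x :=
    ((contDiff_gradient h.contDiff).differentiable (by simp) x).hasFDerivAt.hasFDerivWithinAt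
  have hc : HasFDerivWithinAt (fun _ : E n => η) (0 : E n →L[ℝ] E n) (closure Ω) x :=
    hasFDerivWithinAt_const η x _
  have hVd := ((hN.inner ℝ hN).smul hc).sub ((hN.inner ℝ hc).smul hN)
  have hG := hasFDerivWithinAt_gradientWithin h.uniqueDiffOn hu.contDiffOn
    (frontier_subset_closure hx)
  have hgd := hG.inner ℝ hVd
  have hzero : ∀ y ∈ frontier Ω, ⟪gradientWithin u (closure Ω) y, V y⟫ = 0 := by
    intro y hy
    apply inner_gradientWithin_eq_zero h hu hy
    simp only [hV, inner_sub_right, inner_smul_right]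
    ring
  have h1 := h.tangential_deriv_eq_zero hx hgd hzero hζ
  have hGη := inner_gradientWithin_eq_zero h hu hx hη
  simp only [ContinuousLinearMap.comp_apply, ContinuousLinearMap.prod_apply, fderivInnerCLM_apply,
    _root_.sub_apply, _root_.add_apply, ContinuousLinearMap.smulRight_apply, Pi.sub_apply, Pi.smul_apply',
    _root_.zero_apply, inner_add_right, inner_sub_right,
    inner_smul_right, hη, hGη, inner_zero_right, smul_zero, zero_smul,
    real_inner_self_eq_norm_sq] at h1
  linarith

end BoundaryGradient

/-! ### Lower bound for the normal derivative -/

section Hopf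

variable {n p : ℕ} {Ω : Set (E n)} {ρ : E n → ℝ} {θ c δ : ℝ} {K L m : ℝ}
  {f : E n → ℝ → E (n + 1) → ℝ} {u : E n → ℝ}

lemma hessOp_le_of_isLocalMax {σ : E n → ℝ} {y : E n} (hu : ContDiffAt ℝ 3 u y)
    (hσ : ContDiff ℝ ∞ σ) {ε : ℝ} (hmax : IsLocalMax (fun x => u x - ε * σ x) y) (η : E n) :
    ⟪hessOp u y η, η⟫ ≤ ε * ⟪hessOp σ y η, η⟫ := by
  have h0 : y + (0 : ℝ) • η = y := by simp
  have hline : Filter.Tendsto (fun s : ℝ => y + s • η) (𝓝 0) (𝓝 y) := by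
    have : ContinuousAt (fun s : ℝ => y + s • η) 0 := by fun_prop
    simpa [ContinuousAt] using this
  have hmin : IsLocalMin (fun s : ℝ => ε * σ (y + s • η) - u (y + s • η)) 0 := by
    filter_upwards [hline.eventually hmax] with s hs
    simp only [h0]; linarith
  have hd : ∀ᶠ s : ℝ in 𝓝 0, HasDerivAt (fun s : ℝ => ε * σ (y + s • η) - u (y + s • η))
      (ε * ⟪gradient σ (y + s • η), η⟫ - ⟪gradient u (y + s • η), η⟫) s := by
    filter_upwards [hline.eventually (hu.eventually (by simp))] with s hs
    rw [inner_gradient_left, inner_gradient_left]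
    exact ((hasDerivAt_comp_line (hσ.differentiable (by simp) _).hasFDerivAt).const_mul ε).sub
      (hasDerivAt_comp_line (hs.differentiableAt (by norm_num)).hasFDerivAt)
  have hG : HasDerivAt (fun s : ℝ => gradient u (y + s • η)) (hessOp u y η) 0 :=
    hasDerivAt_comp_line (by
      rw [h0]
      exact ((ContDiffAt.gradient' (l := 2) hu (by norm_num)).differentiableAt
        (by norm_num)).hasFDerivAt)
  have hGσ : HasDerivAt (fun s : ℝ => gradient σ (y + s • η)) (hessOp σ y η) 0 :=
    hasDerivAt_comp_line (by
      rw [h0]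
      exact ((contDiff_gradient hσ).differentiable (by simp) y).hasFDerivAt)
  have h1 := IsLocalMin.second_deriv_nonneg hmin hd
    (((hGσ.inner ℝ (hasDerivAt_const 0 η)).const_mul ε).sub (hG.inner ℝ (hasDerivAt_const 0 η)))
  simp only [inner_zero_right, zero_add] at h1
  linarith

/-- The solution lies below a multiple of the defining function. -/
lemma exists_le_mul_definingFunction (hp : 1 ≤ p) (hpn : p ≤ n) (hm : 0 < m)
    (h : IsConvexDefiningFunction Ω ρ θ c δ) (hcomp : IsCompact (closure Ω)) :
    ∃ ε : ℝ, 0 < ε ∧ ∀ (f : E n → ℝ → E (n + 1) → ℝ) (u : E n → ℝ),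
      IsControlledSolution p Ω K L m f u → ∀ x ∈ closure Ω, u x ≤ ε * ρ x := by
  obtain ⟨M, hM⟩ := hcomp.exists_bound_of_continuousOn (continuous_hessOp h.contDiff).continuousOn
  set M' : ℝ := |M| + 1 with hM'
  have hM'pos : 0 < M' := by positivity
  have hp0 : (0 : ℝ) < p := by exact_mod_cast hp
  -- Makes every p-sum at a positive maximum of `u - ε ρ` at most `min 1 (m/2)`. The cap at 1 keeps
  -- the product of all p-sums below that same number, hence below `m`.
  set ε : ℝ := min 1 (m / 2) / (p * M') with hε
  have hεpos : 0 < ε := div_pos (lt_min one_pos (by linarith)) (by positivity)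
  refine ⟨ε, hεpos, fun f u hu x hx => ?_⟩
  by_contra! hcon
  have hcont : ContinuousOn (fun y => u y - ε * ρ y) (closure Ω) :=
    hu.solution.contDiffOn.continuousOn.sub
      (continuous_const.mul h.contDiff.continuous).continuousOn
  obtain ⟨y, hy, hmax⟩ := hcomp.exists_isMaxOn ⟨x, hx⟩ hcont
  have hypos : 0 < u y - ε * ρ y := by
    have : u x - ε * ρ x ≤ u y - ε * ρ y := hmax hx
    linarith
  have hyΩ : y ∈ Ω := by
    by_contra hc
    have hfr := h.mem_frontier_of_mem_closure hy hc
    rw [hu.solution.boundary y hfr, h.eq_zero y hfr] at hypos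
    simp at hypos
  have hloc : IsLocalMax (fun y => u y - ε * ρ y) y :=
    hmax.isLocalMax (closure_mem_nhds h.isOpen hyΩ)
  have hH := hessOp_le_of_isLocalMax (hu.contDiffAt h.isOpen hyΩ) h.contDiff hloc
  obtain ⟨Q, κ, hframe⟩ := hu.exists_frame h.isOpen hyΩ
  set q := gradient u y
  have hκ : ∀ i, κ i ≤ ε * M' := by
    intro i
    have h1 := hframe.diag i i
    rw [if_pos rfl] at h1
    have h2 : ⟪hessOp ρ y (metricRootInv q (Q i)), metricRootInv q (Q i)⟫ ≤ M' := by
      have hτ : ‖metricRootInv q (Q i)‖ ≤ 1 :=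
        (norm_metricRootInv_le q _).trans (hframe.orthonormal.1 i).le
      refine (real_inner_le_norm _ _).trans ?_
      calc ‖hessOp ρ y (metricRootInv q (Q i))‖ * ‖metricRootInv q (Q i)‖
          ≤ (M' * 1) * 1 := by
            refine mul_le_mul (((hessOp ρ y).le_opNorm _).trans
              (mul_le_mul ((hM y hy).trans ?_) hτ (norm_nonneg _) hM'pos.le)) hτ (norm_nonneg _)
              (by positivity)
            rw [hM']; linarith [le_abs_self M]
        _ = M' := by ring
    have h3 := (hH (metricRootInv q (Q i))).trans (mul_le_mul_of_nonneg_left h2 hεpos.le)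
    rw [h1] at h3
    by_contra! h4
    have h5 : κ i ≤ areaFactor q * κ i :=
      le_mul_of_one_le_left ((mul_pos hεpos hM'pos).trans h4).le (one_le_areaFactor q)
    linarith
  set t : ℝ := min 1 (m / 2) with ht
  have hJ : ∀ J ∈ subsetsOfCard n p, ∑ j ∈ J, κ j ≤ t := by
    intro J hJ
    calc ∑ j ∈ J, κ j ≤ ∑ _j ∈ J, ε * M' := sum_le_sum fun j _ => hκ j
      _ = p * (ε * M') := by
        rw [sum_const, nsmul_eq_mul, (mem_powersetCard.1 hJ).2]
      _ = t := by rw [hε]; field_simp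
  have ht0 : 0 ≤ t := (lt_min one_pos (by linarith)).le
  have hprod : ∏ J ∈ subsetsOfCard n p, ∑ j ∈ J, κ j ≤ t ^ (subsetsOfCard n p).card := by
    rw [← prod_const]
    exact prod_le_prod (fun J hJ => (hframe.pos J hJ).le) hJ
  have hcard : (subsetsOfCard n p).card ≠ 0 := by
    have : 0 < n := by omega
    obtain ⟨J, hJ, -⟩ := exists_mem_subsetsOfCard hp hpn (⟨0, this⟩ : Fin n)
    exact (card_pos.2 ⟨J, hJ⟩).ne'
  have h6 : t ^ (subsetsOfCard n p).card ≤ t := pow_le_of_le_one ht0 (min_le_left _ _) hcard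
  have h7 := hframe.le_prod
  have h8 : t ≤ m / 2 := min_le_right _ _
  linarith

lemma inward_deriv_nonneg (h : IsConvexDefiningFunction Ω ρ θ c δ) {Φ : E n → ℝ}
    {Φ' : E n →L[ℝ] ℝ} {x d : E n} (hx : x ∈ frontier Ω)
    (hΦ : HasFDerivWithinAt Φ Φ' (closure Ω) x) (hmin : IsLocalMinOn Φ (closure Ω) x)
    (hd : ⟪gradient ρ x, d⟫ < 0) : 0 ≤ Φ' d := by
  refine hmin.hasFDerivWithinAt_nonneg hΦ (mem_posTangentConeAt_of_frequently_mem ?_)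
  refine Filter.Eventually.frequently ?_
  filter_upwards [h.eventually_mem hx hd] with s hs using subset_closure hs

/-- A quantitative boundary point lemma. -/
lemma exists_le_inner_gradientWithin (hp : 1 ≤ p) (hpn : p ≤ n) (hm : 0 < m)
    (h : IsConvexDefiningFunction Ω ρ θ c δ) (hcomp : IsCompact (closure Ω)) :
    ∃ ε : ℝ, 0 < ε ∧ ∀ (f : E n → ℝ → E (n + 1) → ℝ) (u : E n → ℝ),
      IsControlledSolution p Ω K L m f u → ∀ x ∈ frontier Ω,
        ε * ‖gradient ρ x‖ ^ 2 ≤ ⟪gradientWithin u (closure Ω) x, gradient ρ x⟫ := by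
  obtain ⟨ε, hε, hle⟩ := exists_le_mul_definingFunction (K := K) (L := L) hp hpn hm h hcomp
  refine ⟨ε, hε, fun f u hu x hx => ?_⟩
  have hder := ((h.differentiableAt x).hasFDerivAt.const_mul ε).hasFDerivWithinAt.sub
    (hasFDerivWithinAt_of_contDiffOn hu.solution.contDiffOn (frontier_subset_closure hx))
  have hmin : IsLocalMinOn (fun y => ε * ρ y - u y) (closure Ω) x := by
    filter_upwards [self_mem_nhdsWithin] with y hy
    rw [h.eq_zero x hx, hu.solution.boundary x hx]
    linarith [hle f u hu y hy]
  have hN := h.norm_gradient_pos hx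
  have h1 := inward_deriv_nonneg h hx hder hmin (d := -gradient ρ x) (by
    rw [inner_neg_right, real_inner_self_eq_norm_sq]
    have : 0 < ‖gradient ρ x‖ ^ 2 := by positivity
    linarith)
  simp only [_root_.sub_apply, _root_.smul_apply, smul_eq_mul,
    ← inner_gradient_left, inner_neg_right, real_inner_self_eq_norm_sq,
    InnerProductSpace.toDual_apply_apply] at h1
  linarith

end Hopf

end PConvex

namespace PConvex

open Finset Matrix
open scoped RealInnerProductSpace Topology

/-- The mean value inequality needs a convex set, so the compact set is enclosed in a ball. -/
lemma exists_taylor_bound {n : ℕ} {F : Type*} [NormedAddCommGroup F] [NormedSpace ℝ F]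
    {g : E n → F} (hg : ContDiff ℝ ∞ g) {s : Set (E n)} (hs : IsCompact s) :
    ∃ C : ℝ, 0 ≤ C ∧ ∀ x ∈ s, ∀ y ∈ s, ‖g y - g x‖ ≤ C * ‖y - x‖ ∧
      ‖g y - g x - fderiv ℝ g x (y - x)‖ ≤ C * ‖y - x‖ ^ 2 := by
  obtain ⟨r, hr⟩ := hs.isBounded.subset_closedBall 0
  set t := Metric.closedBall (0 : E n) r
  have ht : IsCompact t := isCompact_closedBall 0 r
  have htc : Convex ℝ t := convex_closedBall 0 r
  have hg1 : ContDiff ℝ ∞ (fderiv ℝ g) := hg.fderiv_right (by simp)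
  obtain ⟨C₁, hC₁⟩ := ht.exists_bound_of_continuousOn hg1.continuous.continuousOn
  obtain ⟨C₂, hC₂⟩ := ht.exists_bound_of_continuousOn
    (hg1.continuous_fderiv (by simp)).continuousOn
  refine ⟨max (max C₁ C₂) 0, le_max_right _ _, fun x hx y hy => ⟨?_, ?_⟩⟩
  · exact htc.norm_image_sub_le_of_norm_fderiv_le
      (fun z _ => hg.differentiable (by simp) z)
      (fun z hz => (hC₁ z hz).trans ((le_max_left _ _).trans (le_max_left _ _))) (hr hx) (hr hy)
  · have hball : Convex ℝ (t ∩ Metric.closedBall x ‖y - x‖) :=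
      htc.inter (convex_closedBall _ _)
    have := hball.norm_image_sub_le_of_norm_fderiv_le' (f := g) (φ := fderiv ℝ g x)
      (C := max (max C₁ C₂) 0 * ‖y - x‖) (x := x) (y := y)
      (fun z _ => hg.differentiable (by simp) z) (fun z hz => ?_)
      ⟨hr hx, Metric.mem_closedBall_self (norm_nonneg _)⟩
      ⟨hr hy, by rw [Metric.mem_closedBall, dist_eq_norm]⟩
    · calc _ ≤ _ := this
        _ = _ := by ring
    · have h1 := htc.norm_image_sub_le_of_norm_fderiv_le
        (fun z _ => hg1.differentiable (by simp) z) hC₂ (hr hx) hz.1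
      have h2 : ‖z - x‖ ≤ ‖y - x‖ := by
        have := hz.2; rwa [Metric.mem_closedBall, dist_eq_norm] at this
      have h3 : C₂ ≤ max (max C₁ C₂) 0 := (le_max_right _ _).trans (le_max_left _ _)
      refine h1.trans (mul_le_mul h3 h2 (norm_nonneg _) (le_max_right _ _))

/-- The logarithmic barrier. -/
lemma exists_log_barrier {C₃ k₀ δ : ℝ} (hC₃ : 0 < C₃) (hk₀ : 0 < k₀) (hδ : 0 < δ) (V : ℝ) :
    ∃ (δ' : ℝ) (k k' : ℝ → ℝ), 0 < δ' ∧ δ' ≤ δ ∧ k 0 = 0 ∧ V ≤ k δ' ∧ ∀ t, 0 ≤ t → t ≤ δ' →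
      k₀ ≤ k' t ∧ (∀ᶠ s in 𝓝 t, HasDerivAt k (k' s) s) ∧
        HasDerivAt k' (-(C₃ * k' t ^ 2)) t := by
  -- The width keeps `C₃ k₀ t ≤ 1/2`. With `2 k₀ C₃ ≤ M` this gives `k' ≥ k₀`; the exponential
  -- summand of `M` makes `k` reach `V` at `δ'`.
  set δ' := min δ (1 / (2 * C₃ * k₀)) with hδ'
  have hδ'pos : 0 < δ' := lt_min hδ (by positivity)
  set M := 2 * k₀ * C₃ + Real.exp (C₃ * V) / δ' with hM
  have hMpos : 0 < M := by positivity
  refine ⟨δ', fun t => Real.log (1 + M * t) / C₃, fun t => M / (C₃ * (1 + M * t)), hδ'pos,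
    min_le_left _ _, by simp, ?_, fun t ht0 ht => ⟨?_, ?_, ?_⟩⟩
  · rw [le_div_iff₀ hC₃, mul_comm, Real.le_log_iff_exp_le (by positivity)]
    have : M * δ' = 2 * k₀ * C₃ * δ' + Real.exp (C₃ * V) := by rw [hM]; field_simp
    rw [this]
    have : 0 < 2 * k₀ * C₃ * δ' := by positivity
    linarith
  · have h1 : 0 < 1 + M * t := by positivity
    rw [le_div_iff₀ (by positivity)]
    have h2 : t * (2 * C₃ * k₀) ≤ 1 := by
      rw [← le_div_iff₀ (by positivity)]; exact ht.trans (min_le_right _ _)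
    have h3 : 2 * k₀ * C₃ ≤ M := by
      rw [hM]; have : 0 < Real.exp (C₃ * V) / δ' := by positivity
      linarith
    nlinarith [mul_le_mul_of_nonneg_right h2 hMpos.le]
  · have h1 : 0 < 1 + M * t := by positivity
    have hc : ContinuousAt (fun s : ℝ => 1 + M * s) t := by fun_prop
    filter_upwards [hc.eventually (lt_mem_nhds h1)] with s hs
    have h2 : HasDerivAt (fun s : ℝ => 1 + M * s) M s := by
      simpa using ((hasDerivAt_id s).const_mul M).const_add 1
    exact ((h2.log hs.ne').div_const C₃).congr_deriv (by field_simp)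
  · have h1 : 0 < 1 + M * t := by positivity
    have h2 : HasDerivAt (fun s : ℝ => C₃ * (1 + M * s)) (C₃ * M) t := by
      simpa using (((hasDerivAt_id t).const_mul M).const_add 1).const_mul C₃
    refine ((hasDerivAt_const t M).div h2 (by positivity)).congr_deriv ?_
    field_simp
    ring

/-! ### Rotating a tangent vector along the boundary -/

section Rotation

variable {n p : ℕ} {Ω : Set (E n)} {ρ : E n → ℝ} {θ c δ : ℝ}

/-- The exterior unit normal given by a defining function. -/
noncomputable def unitNormal (ρ : E n → ℝ) (x : E n) : E n := ‖gradient ρ x‖⁻¹ • gradient ρ x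

lemma norm_unitNormal {x : E n} (hx : 0 < ‖gradient ρ x‖) : ‖unitNormal ρ x‖ = 1 := by
  rw [unitNormal, norm_smul, norm_inv, norm_norm, inv_mul_cancel₀ hx.ne']

lemma gradient_eq_smul_unitNormal {x : E n} (hx : 0 < ‖gradient ρ x‖) :
    gradient ρ x = ‖gradient ρ x‖ • unitNormal ρ x := by
  rw [unitNormal, smul_smul, mul_inv_cancel₀ hx.ne', one_smul]

/-- An infinitesimal rotation which keeps a given tangent vector field tangential to first
order. -/
lemma exists_rotation (h : IsConvexDefiningFunction Ω ρ θ c δ) (hcomp : IsCompact (closure Ω)) :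
    ∃ A : ℝ, 1 ≤ A ∧ ∃ C : ℝ, 0 ≤ C ∧ (∀ x ∈ closure Ω, ∀ y ∈ closure Ω,
      ‖gradient ρ y - gradient ρ x‖ ≤ C * ‖y - x‖) ∧ ∀ x₀ ∈ frontier Ω, ∀ ξ : E n, ‖ξ‖ ≤ 1 →
      ⟪gradient ρ x₀, ξ⟫ = 0 → ∃ Z : E n →L[ℝ] E n, (∀ v, ‖Z v‖ ≤ A * ‖v‖) ∧
        (∀ v z, ⟪Z v, z⟫ = -⟪v, Z z⟫) ∧ ∀ x ∈ frontier Ω,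
          |⟪gradient ρ x, ξ + Z (x - x₀)⟫| ≤ C * ‖x - x₀‖ ^ 2 := by
  obtain ⟨C₀, hC₀, h0⟩ := exists_taylor_bound h.contDiff hcomp
  obtain ⟨C₁, hC₁, h1⟩ := exists_taylor_bound (contDiff_gradient h.contDiff) hcomp
  obtain ⟨M, hM⟩ := hcomp.exists_bound_of_continuousOn (continuous_hessOp h.contDiff).continuousOn
  have hc := h.slope_pos
  set α := |M| / c with hα
  have hα0 : 0 ≤ α := by positivity
  refine ⟨2 * α + 1, by linarith, C₁ * (2 + 2 * α) + C₀ * α, by positivity,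
    fun x hx y hy => ((h1 x hx y hy).1).trans ?_, fun x₀ hx₀ ξ hξ hξN => ?_⟩
  · refine mul_le_mul_of_nonneg_right ?_ (norm_nonneg _)
    nlinarith [mul_nonneg hC₁ hα0, mul_nonneg hC₀ hα0]
  have hx₀' := frontier_subset_closure hx₀
  set N₀ := gradient ρ x₀ with hN₀
  have hρ2 : ContDiffAt ℝ 2 ρ x₀ := h.contDiff.contDiffAt.of_le (by norm_cast)
  have hNpos : 0 < ‖N₀‖ := h.norm_gradient_pos hx₀
  obtain ⟨e, hen, hNe⟩ : ∃ e : E n, ‖e‖ = 1 ∧ N₀ = ‖N₀‖ • e :=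
    ⟨unitNormal ρ x₀, norm_unitNormal hNpos, gradient_eq_smul_unitNormal hNpos⟩
  -- With `Z d = ⟨e, d⟩ a - ⟨a, d⟩ e`, the `e`-component of `Z d` cancels the first-order change of
  -- `⟨∇ρ, ξ⟩`.
  obtain ⟨a, ha⟩ : ∃ a : E n, a = ‖N₀‖⁻¹ • hessOp ρ x₀ ξ := ⟨_, rfl⟩
  have han : ‖a‖ ≤ α := by
    rw [ha, norm_smul, norm_inv, norm_norm, inv_mul_eq_div]
    refine div_le_div₀ (abs_nonneg _) ?_ hc (h.le_norm_gradient hx₀)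
    calc ‖hessOp ρ x₀ ξ‖ ≤ ‖hessOp ρ x₀‖ * ‖ξ‖ := (hessOp ρ x₀).le_opNorm ξ
      _ ≤ |M| * 1 := mul_le_mul ((hM x₀ hx₀').trans (le_abs_self M)) hξ (norm_nonneg _)
        (abs_nonneg _)
      _ = |M| := mul_one _
  set Z : E n →L[ℝ] E n := (innerSL ℝ e).smulRight a - (innerSL ℝ a).smulRight e with hZ
  have hZv : ∀ v, Z v = ⟪e, v⟫ • a - ⟪a, v⟫ • e := fun v => by simp [hZ]
  have hZn : ∀ v, ‖Z v‖ ≤ 2 * α * ‖v‖ := by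
    intro v
    rw [hZv]
    refine (norm_sub_le _ _).trans ?_
    rw [norm_smul, norm_smul, hen]
    have h3 : ‖⟪e, v⟫‖ ≤ ‖v‖ := by simpa [hen] using norm_inner_le_norm (𝕜 := ℝ) e v
    have h4 : ‖⟪a, v⟫‖ ≤ α * ‖v‖ := (norm_inner_le_norm (𝕜 := ℝ) a v).trans (by gcongr)
    have h5 : ‖⟪e, v⟫‖ * ‖a‖ ≤ ‖v‖ * α := by gcongr
    linarith
  refine ⟨Z, fun v => (hZn v).trans ?_, fun v z => ?_, fun x hx => ?_⟩
  · linarith [norm_nonneg v]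
  · rw [hZv, hZv, inner_sub_left, inner_sub_right, inner_smul_left, inner_smul_left,
      inner_smul_right, inner_smul_right, real_inner_comm v a, real_inner_comm v e]
    simp only [conj_trivial]; ring
  have hx' := frontier_subset_closure hx
  set d := x - x₀ with hd
  obtain ⟨r, hr⟩ : ∃ r : E n, r = gradient ρ x - N₀ - hessOp ρ x₀ d := ⟨_, rfl⟩
  have hrn : ‖r‖ ≤ C₁ * ‖d‖ ^ 2 := by rw [hr]; exact (h1 x₀ hx₀' x hx').2
  -- ρ vanishes at both boundary points, so their difference is tangential up to a quadratic error.
  have hdn : |⟪N₀, d⟫| ≤ C₀ * ‖d‖ ^ 2 := by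
    have := (h0 x₀ hx₀' x hx').2
    rw [h.eq_zero x hx, h.eq_zero x₀ hx₀, ← inner_gradient_left] at this
    simpa only [sub_self, zero_sub, norm_neg, Real.norm_eq_abs] using this
  have hNa : ⟪N₀, Z d⟫ = ⟪N₀, d⟫ * ⟪e, a⟫ - ⟪hessOp ρ x₀ d, ξ⟫ := by
    have h6 : ⟪N₀, d⟫ * ⟪e, a⟫ = ⟪e, d⟫ * ⟪N₀, a⟫ := by
      have h9 : ∀ v, ⟪N₀, v⟫ = ‖N₀‖ * ⟪e, v⟫ := fun v => by
        conv_lhs => rw [hNe]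
        exact real_inner_smul_left _ _ _
      rw [h9, h9]; ring
    have h7 : ⟪a, d⟫ * ⟪N₀, e⟫ = ⟪hessOp ρ x₀ d, ξ⟫ := by
      have : ⟪N₀, e⟫ = ‖N₀‖ := by
        conv_lhs => rw [hNe]
        rw [real_inner_smul_left, real_inner_self_eq_norm_sq, hen]; ring
      rw [this, ha, real_inner_smul_left, hessOp_symm hρ2,
        real_inner_comm]
      field_simp
    rw [hZv, inner_sub_right, inner_smul_right, inner_smul_right, h6, h7]
  have hsplit : ⟪gradient ρ x, ξ + Z d⟫
      = ⟪r, ξ⟫ + ⟪N₀, d⟫ * ⟪e, a⟫ + ⟪gradient ρ x - N₀, Z d⟫ := by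
    have h8 : ⟪gradient ρ x - N₀, ξ⟫ = ⟪r, ξ⟫ + ⟪hessOp ρ x₀ d, ξ⟫ := by
      rw [← inner_add_left, hr, sub_add_cancel]
    rw [inner_sub_left, hξN, sub_zero] at h8
    rw [inner_add_right, h8, inner_sub_left, hNa]; ring
  have b1 : |⟪r, ξ⟫| ≤ C₁ * ‖d‖ ^ 2 := by
    refine (abs_real_inner_le_norm _ _).trans ?_
    calc ‖r‖ * ‖ξ‖ ≤ C₁ * ‖d‖ ^ 2 * 1 := by gcongr
      _ = _ := mul_one _
  have b2 : |⟪N₀, d⟫ * ⟪e, a⟫| ≤ C₀ * ‖d‖ ^ 2 * α := by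
    rw [abs_mul]
    refine mul_le_mul hdn ((abs_real_inner_le_norm _ _).trans ?_) (abs_nonneg _) (by positivity)
    rw [hen, one_mul]; exact han
  have b3 : |⟪gradient ρ x - N₀, Z d⟫| ≤ C₁ * ‖d‖ * (2 * α * ‖d‖) := by
    refine (abs_real_inner_le_norm _ _).trans ?_
    exact mul_le_mul (h1 x₀ hx₀' x hx').1 (hZn d) (norm_nonneg _) (by positivity)
  rw [hsplit]
  refine ((abs_add_le _ _).trans (add_le_add_left (abs_add_le _ _) _)).trans ?_
  have : 0 ≤ C₁ * ‖d‖ ^ 2 := by positivity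
  linarith

end Rotation

end PConvex

namespace PConvex

open Finset Matrix
open scoped RealInnerProductSpace Topology

/-! ### Mixed tangential-normal second derivatives -/

section Mixed

variable {n p : ℕ} {Ω : Set (E n)} {ρ : E n → ℝ} {θ c δ : ℝ} {K L m : ℝ}
  {f : E n → ℝ → E (n + 1) → ℝ} {u : E n → ℝ}

lemma IsControlledSolution.gradientWithin_eq (hu : IsControlledSolution p Ω K L m f u)
    (h : IsConvexDefiningFunction Ω ρ θ c δ) {x : E n} (hx : x ∈ frontier Ω) :
    ∃ a : ℝ, |a| ≤ |K| / c ∧ gradientWithin u (closure Ω) x = a • gradient ρ x := by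
  refine ⟨_, ?_, gradientWithin_eq_smul h hu.solution hx⟩
  have hN := h.norm_gradient_pos hx
  rw [abs_div, abs_of_nonneg (sq_nonneg ‖gradient ρ x‖)]
  have h1 := (hu.norm_gradientWithin_le h (frontier_subset_closure hx)).trans (le_abs_self K)
  calc _ ≤ |K| * ‖gradient ρ x‖ / ‖gradient ρ x‖ ^ 2 :=
        div_le_div_of_nonneg_right ((abs_real_inner_le_norm _ _).trans (by gcongr)) (by positivity)
    _ = |K| / ‖gradient ρ x‖ := by field_simp
    _ ≤ |K| / c :=
        div_le_div_of_nonneg_left (abs_nonneg _) h.slope_pos (h.le_norm_gradient hx)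

lemma inner_self_sub_sq {e : E n} (he : ‖e‖ = 1) (v : E n) :
    ⟪v, v⟫ - ⟪v, e⟫ ^ 2 = ‖perp e v‖ ^ 2 := by
  rw [norm_perp_sq he, real_inner_self_eq_norm_sq]

lemma perp_smul (e v : E n) (a : ℝ) : perp e (a • v) = a • perp e v := by
  rw [perp, perp, real_inner_smul_left, smul_sub, smul_smul]

lemma perp_sub (e v z : E n) : perp e (v - z) = perp e v - perp e z := by
  rw [perp, perp, perp, inner_sub_left, sub_smul]; abel

lemma perp_unitNormal {x : E n} (hx : 0 < ‖gradient ρ x‖) :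
    perp (unitNormal ρ x) (gradient ρ x) = 0 := by
  have h1 := gradient_eq_smul_unitNormal hx
  have h2 : ⟪gradient ρ x, unitNormal ρ x⟫ = ‖gradient ρ x‖ := by
    rw [unitNormal, real_inner_smul_right, real_inner_self_eq_norm_sq]; field_simp
  rw [perp, h2, ← h1, sub_self]

/-- The test function is nonnegative on the boundary. -/
lemma testFunction_nonneg_of_mem_frontier (h : IsConvexDefiningFunction Ω ρ θ c δ)
    (hu : IsControlledSolution p Ω K L m f u) {k : ℝ → ℝ} (hk : k 0 = 0) {C B : ℝ}
    (hB : |K| / c * C + 1 / 2 * (|K| / c * C) ^ 2 ≤ B) {x₀ x ξ : E n}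
    {Z : E n →L[ℝ] E n} (hx₀ : x₀ ∈ frontier Ω) (hx : x ∈ frontier Ω)
    (hN : ‖gradient ρ x - gradient ρ x₀‖ ≤ C * ‖x - x₀‖)
    (hZ : |⟪gradient ρ x, ξ + Z (x - x₀)⟫| ≤ C * ‖x - x₀‖ ^ 2) :
    0 ≤ testFunction (gradientWithin u (closure Ω)) ρ k B x₀ (unitNormal ρ x₀) ξ Z x := by
  obtain ⟨a, ha, hG⟩ := hu.gradientWithin_eq h hx
  have hN₀ := h.norm_gradient_pos hx₀
  have he := norm_unitNormal hN₀
  have hc := h.slope_pos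
  rw [testFunction, inner_self_sub_sq he, h.eq_zero x hx, neg_zero, hk,
    real_inner_self_eq_norm_sq, hG, perp_smul, norm_smul, Real.norm_eq_abs, real_inner_smul_left]
  set d := ‖x - x₀‖
  -- On the boundary `Du` is a multiple of `∇ρ`, whose direction varies by `O(|x - x₀|)`. Both
  -- potentially negative terms are therefore `O(|x - x₀|²)`, and `B` is chosen to absorb them.
  have h1 : ‖perp (unitNormal ρ x₀) (gradient ρ x)‖ ≤ C * d := by
    have : perp (unitNormal ρ x₀) (gradient ρ x)
        = perp (unitNormal ρ x₀) (gradient ρ x - gradient ρ x₀) := by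
      rw [perp_sub, perp_unitNormal hN₀, sub_zero]
    rw [this]
    exact (norm_perp_le he _).trans hN
  have h2 : (|a| * ‖perp (unitNormal ρ x₀) (gradient ρ x)‖) ^ 2 ≤ (|K| / c * (C * d)) ^ 2 := by
    gcongr
  have h3 : |a * ⟪gradient ρ x, ξ + Z (x - x₀)⟫| ≤ |K| / c * (C * d ^ 2) := by
    rw [abs_mul]; gcongr
  have h4 := (abs_le.1 h3).1
  have h5 : (|K| / c * C + 1 / 2 * (|K| / c * C) ^ 2) * d ^ 2 ≤ B * d ^ 2 := by gcongr
  have h6 : (|K| / c * (C * d)) ^ 2 = (|K| / c * C) ^ 2 * d ^ 2 := by ring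
  nlinarith

/-- The test function is nonnegative where the barrier dominates. -/
lemma testFunction_nonneg_of_le {G : E n → E n} {k : ℝ → ℝ} {A B D K' : ℝ} (hA : 0 ≤ A)
    (hB : 0 ≤ B) (hK' : 0 ≤ K') {x₀ x e ξ : E n} {Z : E n →L[ℝ] E n} (he : ‖e‖ = 1)
    (hξ : ‖ξ‖ ≤ 1) (hZ : ∀ v, ‖Z v‖ ≤ A * ‖v‖) (hx : ‖x - x₀‖ ≤ D) (hG : ‖G x‖ ≤ K')
    (hk : K' * (1 + A * D) + 1 / 2 * K' ^ 2 ≤ k (-ρ x)) :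
    0 ≤ testFunction G ρ k B x₀ e ξ Z x := by
  rw [testFunction, inner_self_sub_sq he, real_inner_self_eq_norm_sq]
  have h1 : ‖ξ + Z (x - x₀)‖ ≤ 1 + A * D :=
    (norm_add_le _ _).trans (add_le_add hξ ((hZ _).trans (by gcongr)))
  have h2 : |⟪G x, ξ + Z (x - x₀)⟫| ≤ K' * (1 + A * D) :=
    (abs_real_inner_le_norm _ _).trans (by gcongr)
  have h3 : ‖perp e (G x)‖ ^ 2 ≤ K' ^ 2 := by
    gcongr; exact (norm_perp_le he _).trans hG
  have h4 : 0 ≤ B * ‖x - x₀‖ ^ 2 := by positivity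
  linarith [(abs_le.1 h2).1]

lemma hasFDerivWithinAt_testFunction (h : IsConvexDefiningFunction Ω ρ θ c δ)
    (hu : ContDiffOn ℝ 3 u (closure Ω)) {k : ℝ → ℝ} {k₁ B : ℝ} {x₀ e ξ : E n}
    {Z : E n →L[ℝ] E n} (hx₀ : x₀ ∈ closure Ω) (hk : HasDerivAt k k₁ (-ρ x₀)) :
    ∃ Φ' : E n →L[ℝ] ℝ, HasFDerivWithinAt
      (testFunction (gradientWithin u (closure Ω)) ρ k B x₀ e ξ Z) Φ' (closure Ω) x₀ ∧
      ∀ d, Φ' d = ⟪hessWithin u (closure Ω) x₀ d, ξ⟫ + ⟪gradientWithin u (closure Ω) x₀, Z d⟫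
        - (⟪hessWithin u (closure Ω) x₀ d, perp e (gradientWithin u (closure Ω) x₀)⟫)
        - k₁ * ⟪gradient ρ x₀, d⟫ := by
  have hG := hasFDerivWithinAt_gradientWithin h.uniqueDiffOn hu hx₀
  have hid : HasFDerivWithinAt (fun x : E n => x - x₀) (ContinuousLinearMap.id ℝ (E n))
      (closure Ω) x₀ := (hasFDerivWithinAt_id x₀ _).sub_const x₀
  have hT : HasFDerivWithinAt (fun x : E n => ξ + Z (x - x₀)) (Z.comp (.id ℝ (E n)))
      (closure Ω) x₀ := (Z.hasFDerivAt.comp_hasFDerivWithinAt x₀ hid).const_add ξ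
  have hkρ : HasFDerivWithinAt (fun x => k (-ρ x)) (k₁ • -fderiv ℝ ρ x₀) (closure Ω) x₀ :=
    (hk.comp_hasFDerivAt x₀ (h.differentiableAt x₀).hasFDerivAt.neg).hasFDerivWithinAt
  have hΦ := (((hG.inner ℝ hT).sub (((hG.inner ℝ hG).sub
    ((hG.inner ℝ (hasFDerivWithinAt_const e x₀ _)).pow 2)).const_mul (1 / 2))).add hkρ).add
    ((hid.inner ℝ hid).const_mul B)
  refine ⟨_, hΦ, fun d => ?_⟩
  simp only [_root_.add_apply, _root_.sub_apply, _root_.smul_apply, _root_.neg_apply,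
    ContinuousLinearMap.comp_apply, ContinuousLinearMap.prod_apply, fderivInnerCLM_apply,
    smul_eq_mul, ContinuousLinearMap.id_apply, sub_self, inner_zero_left, inner_zero_right,
    map_zero, add_zero, _root_.zero_apply, ← inner_gradient_left, inner_perp_right, zero_add,
    real_inner_comm (hessWithin u (closure Ω) x₀ d) (gradientWithin u (closure Ω) x₀)]
  simp
  ring

/-- One-sided bound for the mixed second derivatives on the boundary. -/
lemma exists_inner_hessWithin_unitNormal_le (hp : 1 ≤ p) (hpn : p ≤ n) (hm : 0 < m)
    (h : IsConvexDefiningFunction Ω ρ θ c δ) (hcomp : IsCompact (closure Ω)) :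
    ∃ C : ℝ, 0 ≤ C ∧ ∀ (f : E n → ℝ → E (n + 1) → ℝ) (u : E n → ℝ),
      IsControlledSolution p Ω K L m f u → ∀ x₀ ∈ frontier Ω, ∀ ξ : E n, ‖ξ‖ ≤ 1 →
        ⟪gradient ρ x₀, ξ⟫ = 0 → ⟪hessWithin u (closure Ω) x₀ (unitNormal ρ x₀), ξ⟫ ≤ C := by
  obtain ⟨A, hA, C, hC, hgrad, hrot⟩ := exists_rotation h hcomp
  obtain ⟨D, hD⟩ := Metric.isBounded_iff.1 hcomp.isBounded
  obtain ⟨R, hR⟩ := hcomp.exists_bound_of_continuousOn (continuous_gradient h.contDiff).continuousOn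
  have hc := h.slope_pos
  set B := |K| / c * C + 1 / 2 * (|K| / c * C) ^ 2 with hB
  have hB0 : 0 ≤ B := by positivity
  have hA0 : 0 ≤ A := by linarith
  obtain ⟨C₃, hC₃, k₀, hk₀, hmain⟩ := exists_no_interior_min n p hp hpn (K := K) (L := L)
    (R := |R|) (D := |D|) hm h.convexity_pos hc (abs_nonneg R) (abs_nonneg D) hA0 hB0
  obtain ⟨δ', k, k', hδ', hδ'δ, hk0, hkδ', hk⟩ := exists_log_barrier hC₃ (by linarith : 0 < k₀)
    h.width_pos (|K| * (1 + A * |D|) + 1 / 2 * |K| ^ 2)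
  have hk'0 := hk 0 le_rfl hδ'.le
  have hk'pos : 0 ≤ k' 0 := by linarith [hk'0.1]
  refine ⟨|K| * A + k' 0 * |R|, by positivity, fun f u hu x₀ hx₀ ξ hξ hξN => ?_⟩
  obtain ⟨Z, hZ, hZskew, hZfr⟩ := hrot x₀ hx₀ ξ hξ hξN
  have hx₀' := frontier_subset_closure hx₀
  have hN₀ := h.norm_gradient_pos hx₀
  have he := norm_unitNormal hN₀
  set e := unitNormal ρ x₀ with he_def
  set Φ := testFunction (gradientWithin u (closure Ω)) ρ k B x₀ e ξ Z with hΦ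
  have hdist : ∀ x ∈ closure Ω, ‖x - x₀‖ ≤ |D| := fun x hx => by
    rw [← dist_eq_norm]; exact (hD hx hx₀').trans (le_abs_self D)
  have hG : ∀ x ∈ closure Ω, ‖gradientWithin u (closure Ω) x‖ ≤ |K| := fun x hx =>
    (hu.norm_gradientWithin_le h hx).trans (le_abs_self K)
  have hρc := h.contDiff.continuous
  set S := closure Ω ∩ {x | -δ' ≤ ρ x} with hS
  have hScomp : IsCompact S := hcomp.inter_right (isClosed_le continuous_const hρc)
  have hx₀S : x₀ ∈ S := ⟨hx₀', show -δ' ≤ ρ x₀ by rw [h.eq_zero x₀ hx₀]; linarith⟩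
  have hkcont : ContinuousOn (fun x => k (-ρ x)) S := fun x hx => by
    have h1 := h.nonpos_of_mem_closure hx.1
    have h2 : -δ' ≤ ρ x := hx.2
    have h3 := (hk (-ρ x) (by linarith) (by linarith)).2.1.self_of_nhds.continuousAt
    exact (ContinuousAt.comp (f := fun x => -ρ x) h3 hρc.neg.continuousAt).continuousWithinAt
  have hGcont : ContinuousOn (gradientWithin u (closure Ω)) S :=
    (contDiffOn_gradientWithin h.uniqueDiffOn hu.solution.contDiffOn).continuousOn.mono
      Set.inter_subset_left
  have hΦcont : ContinuousOn Φ S := by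
    refine ContinuousOn.add (ContinuousOn.add (ContinuousOn.sub ?_ ?_) hkcont) ?_
    · exact hGcont.inner (by fun_prop)
    · exact continuousOn_const.mul ((hGcont.inner hGcont).sub
        ((hGcont.inner continuousOn_const).pow 2))
    · fun_prop
  have hnonneg : ∀ x ∈ S, 0 ≤ Φ x := by
    -- A minimum over the collar lies on `∂Ω` or on the inner level `ρ = -δ'`, where the sign is
    -- known, or in the open collar, which `exists_no_interior_min` forbids.
    obtain ⟨y, hyS, hymin⟩ := hScomp.exists_isMinOn ⟨x₀, hx₀S⟩ hΦcont
    suffices 0 ≤ Φ y from fun x hx => this.trans (hymin hx)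
    by_cases hyΩ : y ∈ Ω
    · rcases (show -δ' ≤ ρ y from hyS.2).eq_or_lt with hρy | hρy
      · refine testFunction_nonneg_of_le hA0 hB0 (abs_nonneg K) he hξ hZ (hdist y hyS.1)
          (hG y hyS.1) ?_
        rw [← hρy, neg_neg]; exact hkδ'
      · exfalso
        have hneg := (h.mem_iff y).1 hyΩ
        have hky := hk (-ρ y) (by linarith) (by linarith)
        have hSy : S ∈ 𝓝 y := Filter.inter_mem (closure_mem_nhds h.isOpen hyΩ)
          (Filter.mem_of_superset (hρc.continuousAt.eventually (lt_mem_nhds hρy))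
            fun z hz => show -δ' ≤ ρ z from le_of_lt hz)
        refine hmain Ω h.isOpen f u hu ρ h.contDiff k k' x₀ e ξ Z y hyΩ he (hξ.trans hA) hZ
          hZskew (hdist y hyS.1) (h.le_hess y hyS.1 (by linarith)) (h.le_grad y hyS.1 (by linarith))
          ((hR y hyS.1).trans (le_abs_self R)) hky.1 hky.2.1 hky.2.2
          ((hymin.isLocalMin hSy).congr ?_)
        filter_upwards [h.isOpen.mem_nhds hyΩ] with z hz
        rw [hΦ, testFunction, testFunction, gradientWithin_closure_eq h.isOpen hz]
    · have hfr := h.mem_frontier_of_mem_closure hyS.1 hyΩ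
      exact testFunction_nonneg_of_mem_frontier h hu hk0 le_rfl hx₀ hfr
        (hgrad x₀ hx₀' y hyS.1) (hZfr y hfr)
  obtain ⟨a, -, hGa⟩ := hu.gradientWithin_eq h hx₀
  have hperp : perp e (gradientWithin u (closure Ω) x₀) = 0 := by
    rw [hGa, perp_smul, perp_unitNormal hN₀, smul_zero]
  have hΦ0 : Φ x₀ = 0 := by
    rw [hΦ, testFunction, inner_self_sub_sq he, hperp, h.eq_zero x₀ hx₀, neg_zero, hk0, sub_self,
      map_zero, add_zero, add_zero, hGa, real_inner_smul_left, hξN]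
    simp
  have hmin : IsLocalMinOn Φ (closure Ω) x₀ := by
    have h1 : ∀ᶠ x in 𝓝[closure Ω] x₀, -δ' < ρ x :=
      (hρc.continuousAt.eventually (lt_mem_nhds (by rw [h.eq_zero x₀ hx₀]; linarith))).filter_mono
        nhdsWithin_le_nhds
    filter_upwards [self_mem_nhdsWithin, h1] with x hx hx1
    rw [hΦ0]; exact hnonneg x ⟨hx, hx1.le⟩
  obtain ⟨Φ', hΦ', hΦ'd⟩ := hasFDerivWithinAt_testFunction (B := B) (e := e) (ξ := ξ) (Z := Z) h
    hu.solution.contDiffOn hx₀' (k := k) (k₁ := k' 0)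
    (by rw [h.eq_zero x₀ hx₀, neg_zero]; exact hk'0.2.1.self_of_nhds)
  have hNe : ⟪gradient ρ x₀, e⟫ = ‖gradient ρ x₀‖ := by
    rw [he_def, unitNormal, real_inner_smul_right, real_inner_self_eq_norm_sq]; field_simp
  -- At `x₀` the projected gradient vanishes and the `B` term has zero derivative. What remains
  -- along `-e` is the mixed second derivative, a bounded rotation term and `k'(0) |∇ρ|`.
  have hfin := inward_deriv_nonneg h hx₀ hΦ' hmin (d := -e) (by
    rw [inner_neg_right, hNe]; linarith)
  rw [hΦ'd, hperp, inner_zero_right, map_neg, map_neg, inner_neg_left, inner_neg_right,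
    inner_neg_right, hNe] at hfin
  have h1 : |⟪gradientWithin u (closure Ω) x₀, Z e⟫| ≤ |K| * A := by
    refine (abs_real_inner_le_norm _ _).trans (mul_le_mul (hG x₀ hx₀') ?_ (norm_nonneg _)
      (abs_nonneg K))
    simpa [he] using hZ e
  have h2 : k' 0 * ‖gradient ρ x₀‖ ≤ k' 0 * |R| :=
    mul_le_mul_of_nonneg_left ((hR x₀ hx₀').trans (le_abs_self R)) hk'pos
  linarith [(abs_le.1 h1).1]

/-- Bound for the mixed second derivatives on the boundary. -/
lemma exists_abs_inner_hessWithin_unitNormal_le (hp : 1 ≤ p) (hpn : p ≤ n) (hm : 0 < m)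
    (h : IsConvexDefiningFunction Ω ρ θ c δ) (hcomp : IsCompact (closure Ω)) :
    ∃ C : ℝ, 0 ≤ C ∧ ∀ (f : E n → ℝ → E (n + 1) → ℝ) (u : E n → ℝ),
      IsControlledSolution p Ω K L m f u → ∀ x₀ ∈ frontier Ω, ∀ ξ : E n,
        ⟪gradient ρ x₀, ξ⟫ = 0 →
          |⟪hessWithin u (closure Ω) x₀ (unitNormal ρ x₀), ξ⟫| ≤ C * ‖ξ‖ := by
  obtain ⟨C, hC, hle⟩ := exists_inner_hessWithin_unitNormal_le (K := K) (L := L) hp hpn hm h hcomp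
  refine ⟨C, hC, fun f u hu x₀ hx₀ ξ hξ => ?_⟩
  have key : ∀ ξ : E n, ⟪gradient ρ x₀, ξ⟫ = 0 →
      ⟪hessWithin u (closure Ω) x₀ (unitNormal ρ x₀), ξ⟫ ≤ C * ‖ξ‖ := by
    intro ξ hξ
    rcases eq_or_ne ξ 0 with rfl | h0
    · simp
    have hpos : 0 < ‖ξ‖ := norm_pos_iff.2 h0
    have := hle f u hu x₀ hx₀ (‖ξ‖⁻¹ • ξ) (by
      rw [norm_smul, norm_inv, norm_norm, inv_mul_cancel₀ hpos.ne']) (by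
      rw [real_inner_smul_right, hξ, mul_zero])
    rwa [real_inner_smul_right, inv_mul_le_iff₀ hpos, mul_comm] at this
  have h1 := key (-ξ) (by rw [inner_neg_right, hξ, neg_zero])
  rw [inner_neg_right, norm_neg] at h1
  exact abs_le.2 ⟨by linarith, key ξ hξ⟩

end Mixed

end PConvex

namespace PConvex

open Finset Matrix
open scoped RealInnerProductSpace Topology

/-! ### The double normal derivative -/

section NormalAlgebra

variable {n p : ℕ} {H : E n →L[ℝ] E n} {e : E n}

lemma inner_perp_self {e : E n} (he : ‖e‖ = 1) (v : E n) : ⟪perp e v, e⟫ = 0 := by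
  rw [perp, inner_sub_left, real_inner_smul_left, real_inner_self_eq_norm_sq, he]; ring

lemma inner_apply_eq_perp (hH : ∀ a b, ⟪H a, b⟫ = ⟪a, H b⟫) (v z : E n) :
    ⟪H v, z⟫ = ⟪H (perp e v), perp e z⟫ + ⟪z, e⟫ * ⟪H e, perp e v⟫ + ⟪v, e⟫ * ⟪H e, perp e z⟫
      + ⟪v, e⟫ * ⟪z, e⟫ * ⟪H e, e⟫ := by
  conv_lhs => rw [← perp_add_smul e v, ← perp_add_smul e z]
  rw [map_add, map_smul, inner_add_left, inner_add_right, inner_add_right, real_inner_smul_left,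
    real_inner_smul_left, real_inner_smul_right, real_inner_smul_right, hH (perp e v) e,
    real_inner_comm (H e) (perp e v)]
  ring

lemma abs_inner_le_norm_of_unit (he : ‖e‖ = 1) (v : E n) : |⟪v, e⟫| ≤ ‖v‖ := by
  simpa [he] using abs_real_inner_le_norm v e

lemma abs_inner_apply_sub_le (he : ‖e‖ = 1) (hH : ∀ a b, ⟪H a, b⟫ = ⟪a, H b⟫) {M₁ C₂ : ℝ}
    (hM₁ : 0 ≤ M₁) (hC₂ : 0 ≤ C₂) (hmix : ∀ ξ, ⟪ξ, e⟫ = 0 → |⟪H e, ξ⟫| ≤ C₂ * ‖ξ‖)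
    (htan : ∀ ξ η, ⟪ξ, e⟫ = 0 → ⟪η, e⟫ = 0 → |⟪H ξ, η⟫| ≤ M₁ * (‖ξ‖ * ‖η‖)) (v z : E n) :
    |⟪H v, z⟫ - ⟪v, e⟫ * ⟪z, e⟫ * ⟪H e, e⟫| ≤ (M₁ + 2 * C₂) * (‖v‖ * ‖z‖) := by
  rw [inner_apply_eq_perp hH v z, add_sub_cancel_right]
  have h1 := htan _ _ (inner_perp_self he v) (inner_perp_self he z)
  have h2 := hmix _ (inner_perp_self he v)
  have h3 := hmix _ (inner_perp_self he z)
  have hv := norm_perp_le he v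
  have hz := norm_perp_le he z
  have hv' := abs_inner_le_norm_of_unit he v
  have hz' := abs_inner_le_norm_of_unit he z
  have b1 : |⟪H (perp e v), perp e z⟫| ≤ M₁ * (‖v‖ * ‖z‖) := h1.trans (by gcongr)
  have b2 : |⟪z, e⟫ * ⟪H e, perp e v⟫| ≤ ‖z‖ * (C₂ * ‖v‖) := by
    rw [abs_mul]; exact mul_le_mul hz' (h2.trans (by gcongr)) (abs_nonneg _) (norm_nonneg _)
  have b3 : |⟪v, e⟫ * ⟪H e, perp e z⟫| ≤ ‖v‖ * (C₂ * ‖z‖) := by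
    rw [abs_mul]; exact mul_le_mul hv' (h3.trans (by gcongr)) (abs_nonneg _) (norm_nonneg _)
  refine ((abs_add_le _ _).trans (add_le_add_left (abs_add_le _ _) _)).trans ?_
  linarith

/-- Young's inequality charges the cross term half to the tangential block and half to the normal
entry. The threshold on `⟨H e, e⟩` is what the latter costs, plus the claimed lower bound. -/
lemma le_inner_apply_self (he : ‖e‖ = 1) (hH : ∀ a b, ⟪H a, b⟫ = ⟪a, H b⟫) {c₀ C₂ : ℝ}
    (hc₀ : 0 < c₀) (hmix : ∀ ξ, ⟪ξ, e⟫ = 0 → |⟪H e, ξ⟫| ≤ C₂ * ‖ξ‖)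
    (hpos : ∀ ξ, ⟪ξ, e⟫ = 0 → c₀ * ‖ξ‖ ^ 2 ≤ ⟪H ξ, ξ⟫)
    (hR : 2 * C₂ ^ 2 / c₀ + c₀ / 2 ≤ ⟪H e, e⟫) (v : E n) : c₀ / 2 * ‖v‖ ^ 2 ≤ ⟪H v, v⟫ := by
  rw [inner_apply_eq_perp hH v v]
  have h1 := hpos _ (inner_perp_self he v)
  have h2 := hmix _ (inner_perp_self he v)
  have h3 := norm_perp_sq he v
  set s := ⟪v, e⟫
  set x := ‖perp e v‖
  set y := ⟪H e, perp e v⟫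
  have h4 : y ^ 2 ≤ C₂ ^ 2 * x ^ 2 := by
    rw [← mul_pow]; exact sq_le_sq' (by linarith [(abs_le.1 h2).1]) (abs_le.1 h2).2
  have h5 : -(2 * s * y) ≤ c₀ / 2 * x ^ 2 + 2 * C₂ ^ 2 / c₀ * s ^ 2 := by
    rcases eq_or_ne C₂ 0 with h0 | h0
    · have : y = 0 := by rw [h0] at h4; nlinarith [sq_nonneg y]
      rw [this, h0]; simp; positivity
    · have hC : 0 < C₂ ^ 2 := by positivity
      have h6 : c₀ / (2 * C₂ ^ 2) * y ^ 2 ≤ c₀ / 2 * x ^ 2 := by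
        calc c₀ / (2 * C₂ ^ 2) * y ^ 2 ≤ c₀ / (2 * C₂ ^ 2) * (C₂ ^ 2 * x ^ 2) := by gcongr
          _ = _ := by field_simp
      have h7 : 0 ≤ c₀ / (2 * C₂ ^ 2) * (y + 2 * C₂ ^ 2 / c₀ * s) ^ 2 := by positivity
      have h8 : c₀ / (2 * C₂ ^ 2) * (y + 2 * C₂ ^ 2 / c₀ * s) ^ 2
          = c₀ / (2 * C₂ ^ 2) * y ^ 2 + 2 * s * y + 2 * C₂ ^ 2 / c₀ * s ^ 2 := by
        field_simp; ring
      linarith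
  have h9 : (2 * C₂ ^ 2 / c₀ + c₀ / 2) * s ^ 2 ≤ ⟪H e, e⟫ * s ^ 2 := by gcongr
  have h10 : ‖v‖ ^ 2 = x ^ 2 + s ^ 2 := by linarith
  rw [h10]
  nlinarith

/-- The double normal derivative is controlled by the other second derivatives. -/
lemma exists_abs_inner_normal_le (n p : ℕ) (hp : 1 ≤ p) (hpn : p ≤ n) {K L m M₁ C₂ c₀ : ℝ}
    (hM₁ : 0 ≤ M₁) (hC₂ : 0 ≤ C₂) (hc₀ : 0 < c₀) :
    ∃ C : ℝ, 0 ≤ C ∧ ∀ (q : E n) (H : E n →L[ℝ] E n) (Q : Fin n → E n) (κ : Fin n → ℝ) (e : E n),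
      IsCurvatureFrame p m L q H Q κ → ‖q‖ ≤ |K| → ‖e‖ = 1 → (∀ a b, ⟪H a, b⟫ = ⟪a, H b⟫) →
      (∀ ξ, ⟪ξ, e⟫ = 0 → |⟪H e, ξ⟫| ≤ C₂ * ‖ξ‖) →
      (∀ ξ η, ⟪ξ, e⟫ = 0 → ⟪η, e⟫ = 0 → |⟪H ξ, η⟫| ≤ M₁ * (‖ξ‖ * ‖η‖)) →
      (∀ ξ, ⟪ξ, e⟫ = 0 → c₀ * ‖ξ‖ ^ 2 ≤ ⟪H ξ, ξ⟫) → |⟪H e, e⟫| ≤ C := by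
  have hn0 : 0 < n := by omega
  have hn : (0 : ℝ) < n := by exact_mod_cast hn0
  set W : ℝ := 1 + |K| with hW
  have hW1 : 0 < W := by positivity
  set C' : ℝ := M₁ + 2 * C₂ with hC'
  have hC'0 : 0 ≤ C' := by positivity
  set b : ℝ := 1 / (n * W ^ 2) with hb
  have hb0 : 0 < b := by positivity
  set c₁ : ℝ := c₀ / 2 / W ^ 3 with hc₁
  have hc₁0 : 0 < c₁ := by positivity
  set N := (subsetsOfCard n p).card
  set R₁ : ℝ := 2 * C₂ ^ 2 / c₀ + c₀ / 2 with hR₁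
  have hR₁0 : 0 ≤ R₁ := by positivity
  set S : ℝ := (W * (|L| / c₁ ^ (N - 1)) + C') / b with hS
  have hS0 : 0 ≤ S := by positivity
  have hT0 : 0 ≤ p * C' / b := by positivity
  refine ⟨p * C' / b + R₁ + S, by positivity, fun q H Q κ e hF hq he hH hmix htan hpos => ?_⟩
  set w := areaFactor q with hw
  have hw1 : 1 ≤ w := one_le_areaFactor q
  have hwW : w ≤ W := areaFactor_le hq
  have hτ : ∀ i, ‖metricRootInv q (Q i)‖ ≤ 1 := fun i =>
    (norm_metricRootInv_le q _).trans (hF.orthonormal.1 i).le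
  set s : Fin n → ℝ := fun i => ⟪metricRootInv q (Q i), e⟫ with hs
  have hκ : ∀ i, |w * κ i - s i ^ 2 * ⟪H e, e⟫| ≤ C' := by
    intro i
    have h1 := abs_inner_apply_sub_le he hH hM₁ hC₂ hmix htan (metricRootInv q (Q i))
      (metricRootInv q (Q i))
    rw [hF.diag, if_pos rfl, ← sq] at h1
    refine h1.trans (mul_le_of_le_one_right hC'0 ?_)
    exact mul_le_one₀ (hτ i) (norm_nonneg _) (hτ i)
  -- The `sᵢ²` sum to `|g^{-1/2} e|² ≥ 1/W²`, so some frame vector has a definite normal component.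
  obtain ⟨i₀, hi₀⟩ : ∃ i, b ≤ s i ^ 2 := by
    by_contra! hcon
    have h1 := sum_inner_metricRootInv_sq hF.orthonormal q e
    have h2 := div_le_norm_metricRootInv_sq q e
    have h3 : ∑ i, s i ^ 2 < ∑ _i : Fin n, b :=
      sum_lt_sum_of_nonempty ⟨⟨0, hn0⟩, mem_univ _⟩ fun i _ => hcon i
    rw [sum_const, card_univ, Fintype.card_fin, nsmul_eq_mul] at h3
    have h4 : (n : ℝ) * b = 1 / W ^ 2 := by rw [hb]; field_simp
    have h5 : 1 / W ^ 2 ≤ ‖e‖ ^ 2 / w ^ 2 := by rw [he]; simp only [one_pow]; gcongr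
    linarith
  obtain ⟨J, hJ, hiJ⟩ := exists_mem_subsetsOfCard hp hpn i₀
  -- Admissibility: a p-sum containing `i₀` is positive, but up to bounded terms it is a nonnegative
  -- multiple, bounded below by `b`, of `⟨H e, e⟩`.
  have hlower : -(p * C' / b) ≤ ⟪H e, e⟫ := by
    rcases le_or_gt 0 ⟪H e, e⟫ with h0 | h0
    · linarith
    have h1 : w * ∑ j ∈ J, κ j ≤ (∑ j ∈ J, s j ^ 2) * ⟪H e, e⟫ + p * C' := by
      rw [mul_sum, sum_mul]
      have : (p : ℝ) * C' = ∑ _j ∈ J, C' := by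
        rw [sum_const, nsmul_eq_mul, (mem_powersetCard.1 hJ).2]
      rw [this, ← sum_add_distrib]
      exact sum_le_sum fun j _ => by linarith [(abs_le.1 (hκ j)).2]
    have h2 : 0 < w * ∑ j ∈ J, κ j := mul_pos (by linarith) (hF.pos J hJ)
    have h3 : b ≤ ∑ j ∈ J, s j ^ 2 :=
      hi₀.trans (single_le_sum (f := fun j => s j ^ 2) (fun j _ => sq_nonneg _) hiJ)
    have h4 : (∑ j ∈ J, s j ^ 2) * ⟪H e, e⟫ ≤ b * ⟪H e, e⟫ :=
      mul_le_mul_of_nonpos_right h3 h0.le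
    rw [neg_le, le_div_iff₀ hb0]; linarith
  have hupper : ⟪H e, e⟫ ≤ R₁ + S := by
    rcases le_or_gt ⟪H e, e⟫ R₁ with h0 | h0
    · linarith
    -- Past the threshold `R₁` the Hessian is positive definite, so all curvatures are at least
    -- `c₁`. The bounded product then limits `κ i₀`, and with it `⟨H e, e⟩`.
    have hHpos := le_inner_apply_self he hH hc₀ hmix hpos h0.le
    have hκ1 : ∀ i, c₁ ≤ κ i := by
      intro i
      have h1 := hHpos (metricRootInv q (Q i))
      rw [hF.diag, if_pos rfl] at h1
      have h2 := div_le_norm_metricRootInv_sq q (Q i)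
      rw [hF.orthonormal.1 i, one_pow] at h2
      have h3 : 1 / W ^ 2 ≤ 1 / areaFactor q ^ 2 := by gcongr
      have h4 : c₀ / 2 * (1 / W ^ 2) ≤ w * κ i :=
        (mul_le_mul_of_nonneg_left (h3.trans h2) (by positivity)).trans h1
      have h5 : 0 < κ i := by
        have : 0 < w * κ i := lt_of_lt_of_le (by positivity) h4
        exact (mul_pos_iff_of_pos_left (by linarith)).1 this
      have h6 : w * κ i ≤ W * κ i := by gcongr
      have h7 : c₁ * W = c₀ / 2 * (1 / W ^ 2) := by rw [hc₁]; field_simp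
      have h8 : c₁ * W ≤ κ i * W := by linarith
      exact le_of_mul_le_mul_right h8 hW1
    have hsum : ∀ I : Finset (Fin n), ∀ i ∈ I, κ i ≤ ∑ j ∈ I, κ j := fun I i hi =>
      single_le_sum (f := κ) (fun j _ => hc₁0.le.trans (hκ1 j)) hi
    have hrest : c₁ ^ (N - 1) ≤ ∏ I ∈ (subsetsOfCard n p).erase J, ∑ j ∈ I, κ j := by
      rw [← card_erase_of_mem hJ, ← prod_const]
      refine prod_le_prod (fun _ _ => hc₁0.le) fun I hI => ?_
      have hcard : I.card = p := (mem_powersetCard.1 (mem_of_mem_erase hI)).2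
      obtain ⟨i, hi⟩ : I.Nonempty := card_pos.1 (by omega)
      exact (hκ1 i).trans (hsum I i hi)
    have hprod := hF.prod_le
    rw [← mul_prod_erase _ _ hJ] at hprod
    have hκ0 : 0 ≤ κ i₀ := hc₁0.le.trans (hκ1 i₀)
    have h1 : κ i₀ * c₁ ^ (N - 1) ≤ |L| :=
      ((mul_le_mul (hsum J i₀ hiJ) hrest (by positivity) (hF.pos J hJ).le).trans hprod).trans
        (le_abs_self L)
    have h2 : κ i₀ ≤ |L| / c₁ ^ (N - 1) := by rwa [le_div_iff₀ (by positivity)]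
    have h3 : w * κ i₀ ≤ W * (|L| / c₁ ^ (N - 1)) := by gcongr
    have h4 : b * ⟪H e, e⟫ ≤ s i₀ ^ 2 * ⟪H e, e⟫ :=
      mul_le_mul_of_nonneg_right hi₀ (by linarith)
    have h5 : ⟪H e, e⟫ ≤ S := by
      rw [hS, le_div_iff₀ hb0]
      linarith [(abs_le.1 (hκ i₀)).1]
    linarith
  exact abs_le.2 ⟨by linarith, by linarith⟩

end NormalAlgebra

/-! ### Assembling the boundary estimate -/

section BoundaryHessian

variable {n p : ℕ} {Ω : Set (E n)} {ρ : E n → ℝ} {θ c δ : ℝ} {K L m : ℝ}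

/-- Bound for all second derivatives on the boundary. -/
lemma exists_norm_iteratedFDerivWithin_le (hp : 1 ≤ p) (hpn : p ≤ n) (hm : 0 < m)
    (h : IsConvexDefiningFunction Ω ρ θ c δ) (hcomp : IsCompact (closure Ω)) :
    ∃ C : ℝ, 0 < C ∧ ∀ (f : E n → ℝ → E (n + 1) → ℝ) (u : E n → ℝ),
      IsControlledSolution p Ω K L m f u → ∀ x ∈ frontier Ω,
        ‖iteratedFDerivWithin ℝ 2 u (closure Ω) x‖ ≤ C := by
  obtain ⟨C₂, hC₂, hmixed⟩ := exists_abs_inner_hessWithin_unitNormal_le (K := K) (L := L)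
    hp hpn hm h hcomp
  obtain ⟨ε, hε, hhopf⟩ := exists_le_inner_gradientWithin (K := K) (L := L) hp hpn hm h hcomp
  obtain ⟨M, hM⟩ := hcomp.exists_bound_of_continuousOn (continuous_hessOp h.contDiff).continuousOn
  have hc := h.slope_pos
  have hM₁ : 0 ≤ |K| / c * |M| := by positivity
  obtain ⟨C, hC, hnormal⟩ := exists_abs_inner_normal_le n p hp hpn (K := K) (L := L) (m := m) hM₁
    hC₂ (mul_pos hε h.convexity_pos)
  refine ⟨|K| / c * |M| + 2 * C₂ + C + 1, by positivity, fun f u hu x hx => ?_⟩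
  have hx' := frontier_subset_closure hx
  have hN := h.norm_gradient_pos hx
  have he := norm_unitNormal hN
  have hNe := gradient_eq_smul_unitNormal hN
  have hN2 : 0 < ‖gradient ρ x‖ ^ 2 := by positivity
  obtain ⟨Q, κ, hF⟩ := hu.exists_frame_closure hm h hx'
  obtain ⟨a, ha, hG⟩ := hu.gradientWithin_eq h hx
  set H := hessWithin u (closure Ω) x
  set e := unitNormal ρ x
  have hperp : ∀ ξ, ⟪ξ, e⟫ = 0 → ⟪gradient ρ x, ξ⟫ = 0 := fun ξ hξ => by
    rw [hNe, real_inner_smul_left, real_inner_comm, hξ, mul_zero]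
  have htan : ∀ ξ η, ⟪ξ, e⟫ = 0 → ⟪η, e⟫ = 0 → ⟪H ξ, η⟫ = a * ⟪hessOp ρ x ξ, η⟫ := by
    intro ξ η hξ hη
    have h1 := tangential_hessWithin h hu.solution hx (hperp η hη) (hperp ξ hξ)
    rw [hG, real_inner_smul_left, real_inner_self_eq_norm_sq] at h1
    refine mul_left_cancel₀ hN2.ne' (h1.trans ?_)
    ring
  -- With the uniform convexity of ρ this gives the tangential lower bound `ε θ` needed for the
  -- double normal derivative.
  have ha' : ε ≤ a := by
    have h1 := hhopf f u hu x hx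
    rw [hG, real_inner_smul_left, real_inner_self_eq_norm_sq] at h1
    exact le_of_mul_le_mul_right h1 hN2
  have hH := hu.hessWithin_symm h hx'
  have htan' : ∀ ξ η, ⟪ξ, e⟫ = 0 → ⟪η, e⟫ = 0 →
      |⟪H ξ, η⟫| ≤ |K| / c * |M| * (‖ξ‖ * ‖η‖) := by
    intro ξ η hξ hη
    rw [htan ξ η hξ hη, abs_mul, mul_assoc]
    refine mul_le_mul ha ((abs_real_inner_le_norm _ _).trans ?_) (abs_nonneg _) (by positivity)
    rw [← mul_assoc]
    refine mul_le_mul_of_nonneg_right (((hessOp ρ x).le_opNorm ξ).trans ?_) (norm_nonneg _)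
    exact mul_le_mul_of_nonneg_right ((hM x hx').trans (le_abs_self M)) (norm_nonneg _)
  have hmix : ∀ ξ, ⟪ξ, e⟫ = 0 → |⟪H e, ξ⟫| ≤ C₂ * ‖ξ‖ := fun ξ hξ =>
    hmixed f u hu x hx ξ (hperp ξ hξ)
  have hnn : |⟪H e, e⟫| ≤ C := by
    refine hnormal _ H Q κ e hF ((hu.norm_gradientWithin_le h hx').trans (le_abs_self K)) he hH hmix
      htan' fun ξ hξ => ?_
    rw [htan ξ ξ hξ hξ, mul_assoc]
    refine mul_le_mul ha' (h.le_hess x hx' (by rw [h.eq_zero x hx]; linarith [h.width_pos]) ξ)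
      (mul_nonneg h.convexity_pos.le (sq_nonneg _)) (hε.le.trans ha')
  refine ContinuousMultilinearMap.opNorm_le_bound (by positivity) fun v => ?_
  rw [iteratedFDerivWithin_two_eq h.uniqueDiffOn hu.solution.contDiffOn hx', Fin.prod_univ_two,
    Real.norm_eq_abs]
  have h1 := abs_inner_apply_sub_le he hH hM₁ hC₂ hmix htan' (v 0) (v 1)
  have h2 : |⟪v 0, e⟫ * ⟪v 1, e⟫ * ⟪H e, e⟫| ≤ ‖v 0‖ * ‖v 1‖ * C := by
    rw [abs_mul, abs_mul]
    exact mul_le_mul (mul_le_mul (abs_inner_le_norm_of_unit he _) (abs_inner_le_norm_of_unit he _)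
      (abs_nonneg _) (norm_nonneg _)) hnn (abs_nonneg _) (by positivity)
  have h3 : |⟪H (v 0), v 1⟫| ≤ |⟪H (v 0), v 1⟫ - ⟪v 0, e⟫ * ⟪v 1, e⟫ * ⟪H e, e⟫|
      + |⟪v 0, e⟫ * ⟪v 1, e⟫ * ⟪H e, e⟫| := by
    simpa using abs_add_le (⟪H (v 0), v 1⟫ - ⟪v 0, e⟫ * ⟪v 1, e⟫ * ⟪H e, e⟫)
      (⟪v 0, e⟫ * ⟪v 1, e⟫ * ⟪H e, e⟫)
  have h4 : 0 ≤ ‖v 0‖ * ‖v 1‖ := by positivity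
  linarith

end BoundaryHessian

end PConvex

theorem mainTheorem5 (n p : ℕ) (hp : 1 ≤ p) (hpn : p ≤ n)
    (Ω : Set (PConvex.E n)) (hΩ : PConvex.IsStrictlyConvexDomain Ω)
    (K L m : ℝ) (hm : 0 < m) :
    ∃ C : ℝ, 0 < C ∧
      ∀ (f : PConvex.E n → ℝ → PConvex.E (n + 1) → ℝ) (u : PConvex.E n → ℝ),
        PConvex.IsSmoothPositive Ω f →
        PConvex.IsAdmissibleSolution p Ω f u →
        (∀ x ∈ Ω, |u x| ≤ K ∧ ‖gradient u x‖ ≤ K) →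
        (∀ q ∈ PConvex.relevantPoints Ω u,
          |f q.1 q.2.1 q.2.2| ≤ L ∧ ‖fderiv ℝ (PConvex.radialExtension f) q‖ ≤ L) →
        (∀ q ∈ PConvex.relevantPoints Ω u, m ≤ f q.1 q.2.1 q.2.2) →
        ∀ x ∈ frontier Ω, ‖iteratedFDerivWithin ℝ 2 u (closure Ω) x‖ ≤ C := by
  obtain ⟨ρ, θ, c, δ, h⟩ := PConvex.exists_convexDefiningFunction hΩ
  obtain ⟨C, hC, hle⟩ := PConvex.exists_norm_iteratedFDerivWithin_le (K := K) (L := L) hp hpn hm h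
    hΩ.isBounded.isCompact_closure
  exact ⟨C, hC, fun f u hf hu hbound hrhs hle_rhs =>
    hle f u ⟨hf, hu, hbound, hrhs, hle_rhs⟩⟩
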